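/- **Setting.** Let $(N,g)$ be a closed connected Riemannian manifold with universal cover $p:\widetilde N\to N$ (with the lifted metric), $\tau:T^*N\to N$ the projection, $\lambda=p\,dq$ the Liouville form and $\omega_\rho=d\lambda+\tau^*\rho$ for $\rho\in\Omega^2(N)$. Let $U\in C^\infty(N)$, $k\in\mathbb R$, $\xi>0$, and $H=\chi\circ(\tfrac12|p|^2+U(q)-k)$, where $\chi\in C^\infty(\mathbb R)$ satisfies $0\le\chi'\le1$, $\chi(r)=r$ for $|r|\le\xi-\epsilon$ and $\chi(r)=\pm\xi$ for $\pm r\ge\xi+\epsilon$, with $\epsilon=\min\{1/3,\xi/3\}$. For $\rho\in\Omega^2(N)$ let $\mathcal L_\rho=\{\theta\in\Omega^1(\widetilde N): d\theta=p^*\rho\}$ and let $$c(g,\rho,U)=\inf_{\theta\in\mathcal L_\rho}\sup_{z\in\widetilde N}\bigl(\tfrac12|\theta_z|^2+U(p(z))\bigr)\in[-\infty,\infty]$$ be the Mañé critical value. Fix $\mu\in\Omega^2(N)$ with $c(g,\mu,U)<k$ and a smooth reference loop $v_\nu:S^1=\mathbb R/\mathbb Z\to T^*N$; put $q_\nu=\tau\circ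 v_\nu$. The isoperimetric constant of $\sigma\in\Omega^2(N)$ is $$C(\sigma)=\inf_{\theta\in\mathcal L_\sigma}\max\bigl\{\|\theta\|_\infty,\ 2\|\theta\|_\infty\,\mathrm{length}(q_\nu),\ 4\|\theta\|_\infty\,\mathrm{diam}(N)\bigr\}\in[0,\infty].$$ For a loop $x$ freely homotopic to $v_\nu$, and $\eta\in\mathbb R$, let $$\mathcal A_{\omega_\rho}(x,\eta)=\int_D\bar x^*\omega_\rho-\eta\int_0^1H(x(t))\,dt,$$ where $\bar x:D=S^1\times[0,1]\to T^*N$ is any smooth cylinder from $v_\nu$ to $x$; the boundary component $x$ carries the boundary orientation and $v_\nu$ the opposite one. The Hamiltonian vector field is given by $dH=-\iota_{X_H^{\omega}}\omega$. A critical point of $\mathcal A_{\omega_\rho}$ is a pair $(x,\eta)$ with $\dot x=\eta X_H^{\omega_\rho}(x)$ and $\int_0^1H(x)\,dt=0$. **Lemma.** For every $\Lambda\in\mathbb R$ there is a constant $C_0>0$, depending only on the data fixed above and on $\Lambda$, with the following property. Let $\sigma\in\Omega^2(N)$ satisfy $C(\sigma)<C_0$. Let $\beta\in C^\infty(\mathbb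 R,[0,1])$ be a cut-off function with $\beta=0$ on $(-\infty,0]$, $\beta=1$ on $[1,\infty)$ and $0\le\beta'\le2$. Put $\omega_s=\omega_\mu+\beta(s)\,\tau^*\sigma$, and assume $c(g,\mu+\beta(s)\sigma,U)<k$ for all $s\in\mathbb R$. Let $J_{t,s}$ ($t\in S^1$, $s\in\mathbb R$) be a smooth family of $\omega_s$-compatible almost complex structures on $T^*N$ whose metrics $|\cdot|_{t,s}^2=\omega_s(\cdot,J_{t,s}\cdot)$ satisfy, everywhere on $T^*N$ and for all $s,t$, the bounds $|d\tau\,\zeta|_g^2\le\Lambda|\zeta|_{t,s}^2$ for all tangent vectors $\zeta$, and $|X_H^{\omega_s}|_{t,s}^2\le\Lambda$. Let $w=(v,\eta)\in C^\infty(\mathbb R\times S^1,T^*N)\times C^\infty(\mathbb R,\mathbb R)$ be a gradient flow line of the time dependent action functional $\mathcal A_{\omega_s}$, that is, $$\partial_sv+J_{t,s}(v)\bigl(\partial_tv-\eta X_H^{\omega_s}(v)\bigr)=0,\qquad \partial_s\eta+\int_0^1H(v(s,t))\,dt=0,$$ which converges as $s\to-\infty$ to a critical point $w_-$ of $\mathcal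 A_{\omega_0}$ and as $s\to+\infty$ to a critical point $w_+$ of $\mathcal A_{\omega_1}$ (in $C^\infty(S^1,T^*N)\times\mathbb R$), in the free homotopy class of $v_\nu$; here $\omega_0=\omega_\mu$ and $\omega_1=\omega_{\mu+\sigma}$ are the values of $\omega_s$ at $s=0,1$. Put $a=\mathcal A_{\omega_0}(w_-)$ and $b=\mathcal A_{\omega_1}(w_+)$. Then: 1. if $a\ge\frac19$, then $b\ge\frac a2$; 2. if $b\le-\frac19$, then $a\le\frac b2$. -/

import Mathlib

open scoped Manifold ContDiff Bundle ENNReal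
open Bundle Filter Topology

noncomputable section

namespace RFH

/-! ### Differential forms of degree one and two on a manifold -/

section Forms

variable {E : Type*} [NormedAddCommGroup E] [NormedSpace ℝ E]
  {H : Type*} [TopologicalSpace H] (I : ModelWithCorners ℝ E H)
  {M : Type*} [TopologicalSpace M] [ChartedSpace H M]

/-- Velocity `γ'(t)` of a curve in a manifold. -/
def velocity (γ : ℝ → M) (t : ℝ) : TangentSpace I (γ t) :=
  mfderiv 𝓘(ℝ, ℝ) I γ t (1 : ℝ)

/-- A 1-form on `M` (no regularity). -/
abbrev OneForm (M : Type*) [TopologicalSpace M] [ChartedSpace H M] : Type _ :=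
  ∀ x : M, TangentSpace I x →L[ℝ] ℝ

/-- A field of bilinear forms on `M`; the 2-forms are those that satisfy `IsSmoothTwoForm`. -/
abbrev BilinField (M : Type*) [TopologicalSpace M] [ChartedSpace H M] : Type _ :=
  ∀ x : M, TangentSpace I x →L[ℝ] TangentSpace I x →L[ℝ] ℝ

/-- Exterior derivative `dα` of a 1-form on a manifold without boundary: at `x` the form is
written in the preferred chart `φ` at `x` as a map `α_φ : E → E →L[ℝ] ℝ`, and
`(dα)ₓ(u, v) = D_{u'} α_φ (v') - D_{v'} α_φ (u')` with `u' = dφ u`, `v' = dφ v`. -/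
def extDerivOne (α : OneForm I M) (x : M) (u v : TangentSpace I x) : ℝ :=
  let αφ : E → E →L[ℝ] ℝ := fun y =>
    (α ((extChartAt I x).symm y)).comp (mfderiv 𝓘(ℝ, E) I (extChartAt I x).symm y)
  let u' : E := mfderiv I 𝓘(ℝ, E) (extChartAt I x) x u
  let v' : E := mfderiv I 𝓘(ℝ, E) (extChartAt I x) x v
  fderiv ℝ αφ (extChartAt I x x) u' v' - fderiv ℝ αφ (extChartAt I x x) v' u'

variable [IsManifold I ∞ M]

/-- Smoothness of a 1-form, as a section of the cotangent bundle. -/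
def IsSmoothOneForm (α : OneForm I M) : Prop :=
  ContMDiff I (I.prod 𝓘(ℝ, E →L[ℝ] ℝ)) ∞
    (fun x : M => TotalSpace.mk' (E →L[ℝ] ℝ) (E := fun x : M => TangentSpace I x →L[ℝ] ℝ) x (α x))

/-- `σ ∈ Ω²(M)`: alternating and smooth. -/
structure IsSmoothTwoForm (σ : BilinField I M) : Prop where
  alternating : ∀ x u, σ x u u = 0
  smooth : ContMDiff I (I.prod 𝓘(ℝ, E →L[ℝ] E →L[ℝ] ℝ)) ∞
    (fun x : M => TotalSpace.mk' (E →L[ℝ] E →L[ℝ] ℝ)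
      (E := fun x : M => TangentSpace I x →L[ℝ] TangentSpace I x →L[ℝ] ℝ) x (σ x))

end Forms

/-! ### The universal cover, primitives, Mañé's critical value, the isoperimetric constant -/

section Cover

variable {n : ℕ}
  {N : Type*} [MetricSpace N] [ChartedSpace (EuclideanSpace ℝ (Fin n)) N]
  [IsManifold (𝓡 n) ∞ N] [RiemannianBundle (fun q : N => TangentSpace (𝓡 n) q)]
  {N' : Type*} [TopologicalSpace N'] [ChartedSpace (EuclideanSpace ℝ (Fin n)) N']
  [IsManifold (𝓡 n) ∞ N'] [RiemannianBundle (fun z : N' => TangentSpace (𝓡 n) z)]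

/-- `p : N' → N` is the universal cover of the Riemannian manifold `N`, and `N'` carries the lifted
metric. -/
structure IsUniversalRiemannianCover (n : ℕ)
    {N : Type*} [MetricSpace N] [ChartedSpace (EuclideanSpace ℝ (Fin n)) N]
    [IsManifold (𝓡 n) ∞ N] [RiemannianBundle (fun q : N => TangentSpace (𝓡 n) q)]
    {N' : Type*} [TopologicalSpace N'] [ChartedSpace (EuclideanSpace ℝ (Fin n)) N']
    [IsManifold (𝓡 n) ∞ N'] [RiemannianBundle (fun z : N' => TangentSpace (𝓡 n) z)]
    (p : N' → N) : Prop where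
  simplyConnected : SimplyConnectedSpace N'
  covering : IsCoveringMap p
  localDiffeo : IsLocalDiffeomorph (𝓡 n) (𝓡 n) ∞ p
  isometric : ∀ (z : N') (u : TangentSpace (𝓡 n) z), ‖mfderiv (𝓡 n) (𝓡 n) p z u‖ = ‖u‖

/-- The set `L_σ` of smooth 1-forms `θ` on the cover with `dθ = p^*σ`. -/
def primitives (p : N' → N) (σ : BilinField (𝓡 n) N) : Set (OneForm (𝓡 n) N') :=
  {θ | IsSmoothOneForm (𝓡 n) θ ∧ ∀ (z : N') (u v : TangentSpace (𝓡 n) z),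
    extDerivOne (𝓡 n) θ z u v =
      σ (p z) (mfderiv (𝓡 n) (𝓡 n) p z u) (mfderiv (𝓡 n) (𝓡 n) p z v)}

/-- Mañé's critical value `c(g, σ, U) = inf_θ sup_z (½|θ_z|² + U(p z))`, an extended real; it is
`⊤` if `σ` has no bounded primitive on the cover. -/
def maneCriticalValue (p : N' → N) (U : N → ℝ) (σ : BilinField (𝓡 n) N) : EReal :=
  ⨅ θ ∈ primitives p σ, ⨆ z : N', (((1 / 2 : ℝ) * ‖θ z‖ ^ 2 + U (p z) : ℝ) : EReal)

/-- The constant `C(N, g, σ, q)` of the linear isoperimetric inequality relative to the reference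
loop `q`: the infimum over the primitives `θ` of
`max {‖θ‖_∞, 2 ‖θ‖_∞ length(q), 4 ‖θ‖_∞ diam N}`. It is `∞` if there is no bounded primitive. -/
def isoperimetricConstant (p : N' → N) (σ : BilinField (𝓡 n) N) (q : ℝ → N) : ℝ≥0∞ :=
  ⨅ θ ∈ primitives p σ,
    max (⨆ z : N', ‖θ z‖ₑ)
      (max (2 * (⨆ z : N', ‖θ z‖ₑ) * Manifold.pathELength (𝓡 n) q 0 1)
        (4 * (⨆ z : N', ‖θ z‖ₑ) * Metric.ediam (Set.univ : Set N)))

end Cover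

/-! ### The twisted cotangent bundle -/

section Cotangent

/-- The cotangent bundle `T^*N`; its points are `x = (q, p)` with `q = x.proj`, `p = x.2`. -/
abbrev Cotangent (n : ℕ) (N : Type*) [TopologicalSpace N]
    [ChartedSpace (EuclideanSpace ℝ (Fin n)) N] [IsManifold (𝓡 n) ∞ N] : Type _ :=
  TotalSpace (EuclideanSpace ℝ (Fin n) →L[ℝ] ℝ) (fun q : N => TangentSpace (𝓡 n) q →L[ℝ] ℝ)

/-- Model vector space of the manifold `T^*N`. -/
abbrev CotModelSpace (n : ℕ) : Type :=
  EuclideanSpace ℝ (Fin n) × (EuclideanSpace ℝ (Fin n) →L[ℝ] ℝ)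

/-- Model with corners of the manifold `T^*N`. -/
abbrev cotModel (n : ℕ) := (𝓡 n).prod 𝓘(ℝ, EuclideanSpace ℝ (Fin n) →L[ℝ] ℝ)

variable {n : ℕ}

section

variable {N : Type*} [TopologicalSpace N] [ChartedSpace (EuclideanSpace ℝ (Fin n)) N]
  [IsManifold (𝓡 n) ∞ N]

/-- Differential of the footpoint projection `τ : T^*N → N`. -/
def dProj (x : Cotangent n N) : TangentSpace (cotModel n) x →L[ℝ] TangentSpace (𝓡 n) x.proj :=
  mfderiv (cotModel n) (𝓡 n) (fun y : Cotangent n N => y.proj) x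

/-- The Liouville form `λ = p dq`. -/
def liouville : OneForm (cotModel n) (Cotangent n N) := fun x => x.2.comp (dProj x)

/-- The twisted form `ω_σ = dp ∧ dq + τ^*σ = dλ + τ^*σ`. -/
def twistedForm (σ : BilinField (𝓡 n) N) (x : Cotangent n N)
    (u v : TangentSpace (cotModel n) x) : ℝ :=
  extDerivOne (cotModel n) liouville x u v + σ x.proj (dProj x u) (dProj x v)

/-- `X` is the Hamiltonian vector field of `H` for `ω_σ`, that is `dH = - ι_X ω_σ`. -/
def IsHamiltonianVectorField (σ : BilinField (𝓡 n) N) (H : Cotangent n N → ℝ)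
    (X : ∀ x : Cotangent n N, TangentSpace (cotModel n) x) : Prop :=
  ∀ (x : Cotangent n N) (u : TangentSpace (cotModel n) x),
    mfderiv (cotModel n) 𝓘(ℝ, ℝ) H x u = - twistedForm σ x (X x) u

/-- `J = (J_{s,t})` is a smooth family of almost complex structures on `T^*N`, 1-periodic in `t`,
such that `J_{s,t}` is compatible with `ω_{σ(s)}`: the bilinear form `ω_{σ(s)}(·, J_{s,t} ·)` is
symmetric and positive definite. -/
structure IsCompatibleFamily (σ : ℝ → BilinField (𝓡 n) N)
    (J : ℝ → ℝ → ∀ x : Cotangent n N,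
      TangentSpace (cotModel n) x →L[ℝ] TangentSpace (cotModel n) x) : Prop where
  smooth : ContMDiff (𝓘(ℝ, ℝ × ℝ).prod (cotModel n))
    ((cotModel n).prod 𝓘(ℝ, CotModelSpace n →L[ℝ] CotModelSpace n)) ∞
    (fun z : (ℝ × ℝ) × Cotangent n N =>
      TotalSpace.mk' (CotModelSpace n →L[ℝ] CotModelSpace n)
        (E := fun x : Cotangent n N =>
          TangentSpace (cotModel n) x →L[ℝ] TangentSpace (cotModel n) x)
        z.2 (J z.1.1 z.1.2 z.2))
  periodic : ∀ s t, J s (t + 1) = J s t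
  sq : ∀ s t x u, J s t x (J s t x u) = -u
  symm : ∀ s t x u v, twistedForm (σ s) x u (J s t x v) = twistedForm (σ s) x v (J s t x u)
  pos : ∀ s t x u, u ≠ 0 → 0 < twistedForm (σ s) x u (J s t x u)

/-- A smooth free loop in `T^*N`, as a 1-periodic map on the line. -/
structure IsLoop (x : ℝ → Cotangent n N) : Prop where
  smooth : ContMDiff 𝓘(ℝ, ℝ) (cotModel n) ∞ x
  periodic : ∀ t, x (t + 1) = x t

/-- `A_{ω_σ}(x, η) = a`, where `A_{ω_σ}(x, η) = ∫_D x̄^*ω_σ - η ∫₀¹ H(x(t)) dt` is the Rabinowitz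
action functional on the component of the reference loop `x₀`: the filling cylinder `x̄ = h(r, t)`
goes from `x₀` (at `r = 0`) to `x` (at `r = 1`); the boundary component `x` has the boundary
orientation and `x₀` the opposite one. -/
def HasAction (σ : BilinField (𝓡 n) N) (H : Cotangent n N → ℝ) (x₀ x : ℝ → Cotangent n N)
    (η a : ℝ) : Prop :=
  ∃ h : ℝ → ℝ → Cotangent n N,
    ContMDiff (𝓘(ℝ, ℝ).prod 𝓘(ℝ, ℝ)) (cotModel n) ∞ (fun z : ℝ × ℝ => h z.1 z.2) ∧
    (∀ r t, h r (t + 1) = h r t) ∧ h 0 = x₀ ∧ h 1 = x ∧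
    a = (∫ r in (0 : ℝ)..1, ∫ t in (0 : ℝ)..1,
          twistedForm σ (h r t)
            (velocity (cotModel n) (fun r' => h r' t) r)
            (velocity (cotModel n) (fun t' => h r t') t))
        - η * ∫ t in (0 : ℝ)..1, H (x t)

/-- `(x, η)` is a critical point of the Rabinowitz action functional, where `X` is the Hamiltonian
vector field of `H`. -/
structure IsCriticalPoint (H : Cotangent n N → ℝ)
    (X : ∀ x : Cotangent n N, TangentSpace (cotModel n) x)
    (x : ℝ → Cotangent n N) (η : ℝ) : Prop where
  loop : IsLoop x
  orbit : ∀ t, velocity (cotModel n) x t = η • X (x t)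
  mean : ∫ t in (0 : ℝ)..1, H (x t) = 0

/-- `w = (v, η)` is a positive gradient flow line of the time dependent Rabinowitz action
functional, where `X s` is the Hamiltonian vector field of `H` at time `s`:
`∂_s v + J_{s,t}(v)(∂_t v - η X_s(v)) = 0` and `∂_s η + ∫₀¹ H(v(s,t)) dt = 0`. -/
structure IsGradientFlowLine (H : Cotangent n N → ℝ)
    (X : ℝ → ∀ x : Cotangent n N, TangentSpace (cotModel n) x)
    (J : ℝ → ℝ → ∀ x : Cotangent n N,
      TangentSpace (cotModel n) x →L[ℝ] TangentSpace (cotModel n) x)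
    (v : ℝ → ℝ → Cotangent n N) (η : ℝ → ℝ) : Prop where
  smooth_v : ContMDiff (𝓘(ℝ, ℝ).prod 𝓘(ℝ, ℝ)) (cotModel n) ∞ (fun z : ℝ × ℝ => v z.1 z.2)
  smooth_η : ContDiff ℝ ∞ η
  periodic : ∀ s t, v s (t + 1) = v s t
  floer : ∀ s t,
    (velocity (cotModel n) (fun s' => v s' t) s : TangentSpace (cotModel n) (v s t)) +
      J s t (v s t) (velocity (cotModel n) (fun t' => v s t') t - η s • X s (v s t)) = 0
  multiplier : ∀ s, deriv η s + ∫ t in (0 : ℝ)..1, H (v s t) = 0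

/-- Convergence of the loops `v s` to the loop `x` along the filter `l` in the `C^∞`-topology,
tested against all smooth functions on `T^*N`. -/
def LoopTendsto (v : ℝ → ℝ → Cotangent n N) (l : Filter ℝ) (x : ℝ → Cotangent n N) : Prop :=
  ∀ F : Cotangent n N → ℝ, ContMDiff (cotModel n) 𝓘(ℝ, ℝ) ∞ F → ∀ m : ℕ,
    TendstoUniformly (fun s t => iteratedDeriv m (fun t' => F (v s t')) t)
      (fun t => iteratedDeriv m (fun t' => F (x t')) t) l

end

variable {N : Type*} [MetricSpace N] [ChartedSpace (EuclideanSpace ℝ (Fin n)) N]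
  [IsManifold (𝓡 n) ∞ N] [RiemannianBundle (fun q : N => TangentSpace (𝓡 n) q)]

/-- `χ = β_ξ` is a smooth truncation of the identity at height `ξ`. -/
structure IsTruncation (ξ : ℝ) (χ : ℝ → ℝ) : Prop where
  smooth : ContDiff ℝ ∞ χ
  deriv_mem : ∀ t, 0 ≤ deriv χ t ∧ deriv χ t ≤ 1
  eq_id : ∀ t, |t| ≤ ξ - min (1 / 3) (ξ / 3) → χ t = t
  eq_top : ∀ t, ξ + min (1 / 3) (ξ / 3) ≤ t → χ t = ξ
  eq_bot : ∀ t, ξ + min (1 / 3) (ξ / 3) ≤ -t → χ t = -ξ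

/-- The defining Hamiltonian `H = χ ∘ (H_U - k)`, `H_U(q, p) = ½|p|² + U(q)`, of the energy
hypersurface `H_U = k`; here `|p|` is the dual norm. -/
def definingHamiltonian (U : N → ℝ) (k : ℝ) (χ : ℝ → ℝ) (x : Cotangent n N) : ℝ :=
  χ ((1 / 2) * ‖x.2‖ ^ 2 + U x.proj - k)

/-- The cut-off functions used for the homotopy `ω_s = ω_μ + β(s) τ^*σ`. -/
structure IsCutoff (β : ℝ → ℝ) : Prop where
  smooth : ContDiff ℝ ∞ β
  mem : ∀ s, 0 ≤ β s ∧ β s ≤ 1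
  eq_zero : ∀ s, s ≤ 0 → β s = 0
  eq_one : ∀ s, 1 ≤ s → β s = 1
  deriv_mem : ∀ s, 0 ≤ deriv β s ∧ deriv β s ≤ 2

/-- The metrics `|u|²_{s,t} = ω_{σ(s)}(u, J_{s,t} u)` on `T^*N` have geometry bounded by `Λ`: the
projection to `(N, g)` satisfies `|dτ u|² ≤ Λ |u|²_{s,t}`, and `|X_s|²_{s,t} ≤ Λ`. -/
def GeometryBound (Λ : ℝ) (σ : ℝ → BilinField (𝓡 n) N)
    (X : ℝ → ∀ x : Cotangent n N, TangentSpace (cotModel n) x)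
    (J : ℝ → ℝ → ∀ x : Cotangent n N,
      TangentSpace (cotModel n) x →L[ℝ] TangentSpace (cotModel n) x) : Prop :=
  ∀ (s t : ℝ) (x : Cotangent n N),
    (∀ u : TangentSpace (cotModel n) x,
      ‖dProj x u‖ ^ 2 ≤ Λ * twistedForm (σ s) x u (J s t x u)) ∧
    twistedForm (σ s) x (X s x) (J s t x (X s x)) ≤ Λ

end Cotangent

end RFH

end

open scoped Manifold ContDiff Bundle ENNReal
open Bundle Filter Topology

noncomputable section

set_option linter.unusedSectionVars false

/-! Along a flow line the action S(s) satisfies S' = e + β'F, where e ≥ 0 is the energy density and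
F(s) is the flux of σ through a cylinder from the reference loop to v(s). Without the term β'F the
action would be monotone, so the task is to show that a small ‖θ'‖, for a primitive θ' of the lift
of σ, makes ∫β'F small compared with the action.

Flux. A loop need not lift to a loop, and a primitive on the cover need not be invariant under deck
transformations, so the integral of a primitive over one lifted period does not compute the flux.
Its average over R periods does in the limit: Stokes' theorem on the R-fold cylinder leaves two side
edges whose contribution stays bounded in R. Hence `asymptoticMean`, the supremum of the cluster
values of these averages, changes along a cylinder exactly by the flux (`asymptoticMean_cylinder`),
and it is at most ‖θ‖ times the length of the loop. This gives |F| ≤ ‖θ'‖ (length of v(s) + length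
of the reference loop), where the length of v(s) grows at most linearly in |η| + e. It also writes
the action without a filling (`meanAction`).

Multiplier. Below k there is a primitive θ of the lift of μ with ½|θ|² + U ≤ k - d. Where e is
small, the loop is nearly an orbit close to H = 0, and there (λ + θ)(X_H) ≥ d/2. Integrating along a
lift bounds |η| by the action (`abs_multiplier_le`).

Bootstrap (`exists_action_comparison_constant`). If a ≥ 1/9 but b < a/2, then K = 2∫₀¹|F| dominates
a, |b|, the constant 1 and the total energy. Before each s in [0,1], within time K/ε + 1, there is a
moment of small energy density; there |η| is at most a multiple of K, and up to s it drifts by at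
most a multiple of K. So K ≤ const · ‖θ'‖ · K, which is absurd for small ‖θ'‖. The second claim is
symmetric.

Ends. S must tend to a and b although the curves s ↦ v(s,0) may have infinite length. This rests on
`exists_nhds_integral_sub_le`: two lifts of one curve in a small set have integrals that differ by a
bounded amount (`tendsto_asymptoticMean_atBot`). -/

namespace RFH

/-! ### Pullback of 1-forms and naturality of the exterior derivative. -/

section Pullback

variable {E : Type*} [NormedAddCommGroup E] [NormedSpace ℝ E]
  {H : Type*} [TopologicalSpace H] {I : ModelWithCorners ℝ E H} [I.Boundaryless]
  {M : Type*} [TopologicalSpace M] [ChartedSpace H M] [IsManifold I ∞ M]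
  {V : Type*} [NormedAddCommGroup V] [NormedSpace ℝ V]

/-- The representation of a 1-form in the preferred chart at `x`. -/
def oneFormInChart (α : OneForm I M) (x : M) (y : E) : E →L[ℝ] ℝ :=
  (α ((extChartAt I x).symm y)).comp (mfderiv 𝓘(ℝ, E) I (extChartAt I x).symm y)

/-- Smoothness of a 1-form at `x`, tested in the preferred chart at `x`. -/
def IsChartSmoothAt (α : OneForm I M) (x : M) : Prop :=
  ContDiffAt ℝ ∞ (oneFormInChart α x) (extChartAt I x x)

/-- Pullback of a 1-form to a vector space. -/
def pullbackForm (α : OneForm I M) (g : V → M) (y : V) : V →L[ℝ] ℝ :=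
  (α (g y)).comp (mfderiv 𝓘(ℝ, V) I g y)

theorem oneFormInChart_extChartAt (α : OneForm I M) {x z : M} (hz : z ∈ (extChartAt I x).source) :
    oneFormInChart α x (extChartAt I x z) =
      ContinuousLinearMap.comp (α z : E →L[ℝ] ℝ)
        (mfderiv 𝓘(ℝ, E) I (extChartAt I x).symm (extChartAt I x z) : E →L[ℝ] E) := by
  have h := congrArg (fun w : M => (show E →L[ℝ] ℝ from α w)) ((extChartAt I x).left_inv hz)
  exact congrArg (fun l : E →L[ℝ] ℝ => l.comp
    (mfderiv 𝓘(ℝ, E) I (extChartAt I x).symm (extChartAt I x z) : E →L[ℝ] E)) h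

theorem extDerivOne_eq (α : OneForm I M) (x : M) (u v : TangentSpace I x) :
    extDerivOne I α x u v =
      fderiv ℝ (oneFormInChart α x) (extChartAt I x x)
        (mfderiv I 𝓘(ℝ, E) (extChartAt I x) x u) (mfderiv I 𝓘(ℝ, E) (extChartAt I x) x v) -
      fderiv ℝ (oneFormInChart α x) (extChartAt I x x)
        (mfderiv I 𝓘(ℝ, E) (extChartAt I x) x v) (mfderiv I 𝓘(ℝ, E) (extChartAt I x) x u) :=
  rfl

theorem extDerivOne_self (α : OneForm I M) (x : M) (u : TangentSpace I x) :
    extDerivOne I α x u u = 0 := by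
  rw [extDerivOne_eq]; ring

theorem contDiffAt_chart_comp {g : V → M} {y : V} (hg : ContMDiffAt 𝓘(ℝ, V) I ∞ g y) :
    ContDiffAt ℝ ∞ (extChartAt I (g y) ∘ g) y := by
  rw [← contMDiffAt_iff_contDiffAt]
  exact (contMDiffAt_extChartAt (I := I) (x := g y)).comp y hg

theorem mdifferentiableAt_extChartAt_symm {x : M} {y : E} (hy : y ∈ (extChartAt I x).target) :
    MDifferentiableAt 𝓘(ℝ, E) I (extChartAt I x).symm y := by
  have := (contMDiffOn_extChartAt_symm (I := I) (n := ∞) x).contMDiffAt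
    ((isOpen_extChartAt_target x).mem_nhds hy)
  exact this.mdifferentiableAt (by simp)

theorem mfderiv_eq_chart_comp {g : V → M} {x : M} {y : V} (hg : MDifferentiableAt 𝓘(ℝ, V) I g y)
    (hx : ∀ᶠ z in 𝓝 y, g z ∈ (extChartAt I x).source) :
    mfderiv 𝓘(ℝ, V) I g y =
      (mfderiv 𝓘(ℝ, E) I (extChartAt I x).symm (extChartAt I x (g y))).comp
        (fderiv ℝ (extChartAt I x ∘ g) y) := by
  have hs : g y ∈ (extChartAt I x).source := hx.self_of_nhds
  have h1 : MDifferentiableAt I 𝓘(ℝ, E) (extChartAt I x) (g y) :=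
    (contMDiffAt_extChartAt' (I := I) (n := ∞) (by simpa using hs)).mdifferentiableAt (by simp)
  have h2 : MDifferentiableAt 𝓘(ℝ, V) 𝓘(ℝ, E) (extChartAt I x ∘ g) y := h1.comp y hg
  have h3 := mdifferentiableAt_extChartAt_symm (I := I) ((extChartAt I x).map_source hs)
  have h4 : g =ᶠ[𝓝 y] (extChartAt I x).symm ∘ (extChartAt I x ∘ g) := by
    filter_upwards [hx] with z hz
    exact ((extChartAt I x).left_inv hz).symm
  rw [h4.mfderiv_eq, mfderiv_comp y h3 h2, mfderiv_eq_fderiv]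
  rfl

/-- The chart stays at `g y` while `z` moves, so the pullback becomes a composition of maps between
vector spaces, open to ordinary calculus. -/
theorem pullbackForm_eventuallyEq (α : OneForm I M) {g : V → M} {y : V}
    (hg : ContMDiffAt 𝓘(ℝ, V) I ∞ g y) :
    pullbackForm α g =ᶠ[𝓝 y] fun z =>
      (oneFormInChart α (g y) ((extChartAt I (g y) ∘ g) z)).comp
        (fderiv ℝ (extChartAt I (g y) ∘ g) z) := by
  have h1 : ∀ᶠ z in 𝓝 y, ContMDiffAt 𝓘(ℝ, V) I 1 g z :=
    (contMDiffAt_iff_contMDiffAt_nhds (by simp)).1 (hg.of_le (by norm_cast))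
  have h2 : ∀ᶠ z in 𝓝 y, g z ∈ (extChartAt I (g y)).source :=
    hg.continuousAt (extChartAt_source_mem_nhds (I := I) (g y))
  filter_upwards [h1, h2.eventually_nhds] with z hz hz'
  have hz0 := hz'.self_of_nhds
  rw [pullbackForm, mfderiv_eq_chart_comp (hz.mdifferentiableAt (by simp)) hz', Function.comp_apply,
    oneFormInChart_extChartAt α hz0]
  rfl

theorem contDiffAt_pullbackForm {α : OneForm I M} {g : V → M} {y : V}
    (hα : IsChartSmoothAt α (g y)) (hg : ContMDiffAt 𝓘(ℝ, V) I ∞ g y) :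
    ContDiffAt ℝ ∞ (pullbackForm α g) y := by
  refine ContDiffAt.congr_of_eventuallyEq ?_ (pullbackForm_eventuallyEq α hg)
  have hu := contDiffAt_chart_comp hg
  have h1 : ContDiffAt ℝ ∞ (fun z => oneFormInChart α (g y) ((extChartAt I (g y) ∘ g) z)) y :=
    ContDiffAt.comp (g := oneFormInChart α (g y)) y hα hu
  exact h1.clm_comp (hu.fderiv_right (by simp))

/-- The exterior derivative commutes with pullback. -/
theorem fderiv_pullbackForm_sub {α : OneForm I M} {g : V → M} {y : V}
    (hα : IsChartSmoothAt α (g y)) (hg : ContMDiffAt 𝓘(ℝ, V) I ∞ g y) (a b : V) :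
    fderiv ℝ (pullbackForm α g) y a b - fderiv ℝ (pullbackForm α g) y b a =
      extDerivOne I α (g y) (mfderiv 𝓘(ℝ, V) I g y a) (mfderiv 𝓘(ℝ, V) I g y b) := by
  have hu := contDiffAt_chart_comp hg
  set u := extChartAt I (g y) ∘ g with hu_def
  have hud : DifferentiableAt ℝ u y := hu.differentiableAt (by simp)
  have hA : HasFDerivAt (oneFormInChart α (g y)) (fderiv ℝ (oneFormInChart α (g y)) (u y)) (u y) :=
    (ContDiffAt.differentiableAt hα (by simp)).hasFDerivAt
  have h1 := hA.comp y hud.hasFDerivAt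
  have h2 : HasFDerivAt (fderiv ℝ u) (fderiv ℝ (fderiv ℝ u) y) y :=
    ((hu.fderiv_right (m := ∞) (by simp)).differentiableAt (by simp)).hasFDerivAt
  -- The second derivatives of the chart expression are symmetric, so they cancel in the
  -- antisymmetrization.
  have hsymm : fderiv ℝ (fderiv ℝ u) y a b = fderiv ℝ (fderiv ℝ u) y b a :=
    (hu.isSymmSndFDerivAt (by simp; norm_cast)) a b
  have h3 : fderiv ℝ (pullbackForm α g) y = _ :=
    (pullbackForm_eventuallyEq α hg).fderiv_eq.trans (h1.clm_comp h2).fderiv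
  have hmf : mfderiv I 𝓘(ℝ, E) (extChartAt I (g y)) (g y) ∘L mfderiv 𝓘(ℝ, V) I g y =
      fderiv ℝ u y := by
    rw [← mfderiv_eq_fderiv, hu_def, mfderiv_comp y
      ((contMDiffAt_extChartAt (I := I) (n := ∞)).mdifferentiableAt (by simp))
      (hg.mdifferentiableAt (by simp))]
  have ha : mfderiv I 𝓘(ℝ, E) (extChartAt I (g y)) (g y) (mfderiv 𝓘(ℝ, V) I g y a) =
    fderiv ℝ u y a := congr($hmf a)
  have hb : mfderiv I 𝓘(ℝ, E) (extChartAt I (g y)) (g y) (mfderiv 𝓘(ℝ, V) I g y b) =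
    fderiv ℝ u y b := congr($hmf b)
  rw [h3, extDerivOne_eq, ha, hb]
  have hu0 : extChartAt I (g y) (g y) = u y := rfl
  rw [hu0]
  clear_value u
  simp [hsymm]

/-- The trivialization of the tangent bundle at `x` is the derivative of the inverse chart, so the
two notions of smoothness match. The calculus below only uses the chart condition, which is verified
directly for the Liouville form. -/
theorem IsSmoothOneForm.isChartSmoothAt {α : OneForm I M} (hα : IsSmoothOneForm I α) (x : M) :
    IsChartSmoothAt α x := by
  have h1 := ((contMDiffAt_hom_bundle _).1 (hα x)).2
  have h2 : ContMDiffAt 𝓘(ℝ, E) I ∞ (extChartAt I x).symm (extChartAt I x x) :=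
    (contMDiffOn_extChartAt_symm (I := I) (n := ∞) x).contMDiffAt
      ((isOpen_extChartAt_target x).mem_nhds (mem_extChartAt_target x))
  have h3 := ContMDiffAt.comp_of_eq h1 h2 (by simp)
  rw [contMDiffAt_iff_contDiffAt] at h3
  refine ContDiffAt.congr_of_eventuallyEq h3 ?_
  filter_upwards [(isOpen_extChartAt_target (I := I) x).mem_nhds (mem_extChartAt_target x)]
    with y hy
  have hy' : (extChartAt I x).symm y ∈ (chartAt H x).source := by
    simpa using (extChartAt I x).map_target hy
  ext a
  simp only [Function.comp_apply, ContinuousLinearMap.inCoordinates, oneFormInChart]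
  rw [TangentBundle.symmL_trivializationAt hy', (extChartAt I x).right_inv hy]
  simp [mfderivWithin_univ, ModelWithCorners.range_eq_univ]

end Pullback

end RFH

namespace RFH

/-! ### Stokes' theorem on rectangles. -/

section Plane

/-- Stokes' theorem on a rectangle for a `C¹` 1-form on the plane. -/
theorem integral_curl_rectangle {A : ℝ × ℝ → ℝ × ℝ →L[ℝ] ℝ} (hA : ContDiff ℝ 1 A)
    (r₀ r₁ t₀ t₁ : ℝ) :
    (∫ r in r₀..r₁, ∫ t in t₀..t₁,
        (fderiv ℝ A (r, t) (1, 0) (0, 1) - fderiv ℝ A (r, t) (0, 1) (1, 0))) =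
      (∫ t in t₀..t₁, A (r₁, t) (0, 1)) - (∫ t in t₀..t₁, A (r₀, t) (0, 1)) -
        (∫ r in r₀..r₁, A (r, t₁) (1, 0)) + ∫ r in r₀..r₁, A (r, t₀) (1, 0) := by
  have hd : ∀ z, HasFDerivAt A (fderiv ℝ A z) z := fun z =>
    (hA.differentiable (by simp) z).hasFDerivAt
  have hc : Continuous (fderiv ℝ A) := hA.continuous_fderiv (by simp)
  have h := MeasureTheory.integral2_divergence_prod_of_hasFDerivAt
    (fun z => A z (0, 1)) (fun z => - A z (1, 0))
    (fun z => (fderiv ℝ A z).flip (0, 1)) (fun z => -(fderiv ℝ A z).flip (1, 0)) r₀ t₀ r₁ t₁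
    (by have := hA.continuous; fun_prop) (by have := hA.continuous; fun_prop)
    (fun z _ => by
      have := (hd z).clm_apply (hasFDerivAt_const ((0 : ℝ), (1 : ℝ)) z)
      simpa using this)
    (fun z _ => by
      have := ((hd z).clm_apply (hasFDerivAt_const ((1 : ℝ), (0 : ℝ)) z)).neg
      simp only [ContinuousLinearMap.comp_zero, zero_add] at this
      exact this)
    (by
      refine ContinuousOn.integrableOn_compact (isCompact_uIcc.prod isCompact_uIcc) ?_
      have h1 : Continuous fun z : ℝ × ℝ => fderiv ℝ A z (1, 0) (0, 1) := by fun_prop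
      have h2 : Continuous fun z : ℝ × ℝ => fderiv ℝ A z (0, 1) (1, 0) := by fun_prop
      exact (h1.add h2.neg).continuousOn)
  simp only [ContinuousLinearMap.flip_apply, neg_apply, ← sub_eq_add_neg,
    intervalIntegral.integral_neg] at h
  rw [h]
  ring

variable {E : Type*} [NormedAddCommGroup E] [NormedSpace ℝ E]
  {H : Type*} [TopologicalSpace H] {I : ModelWithCorners ℝ E H} [I.Boundaryless]
  {M : Type*} [TopologicalSpace M] [ChartedSpace H M] [IsManifold I ∞ M]
  {E' : Type*} [NormedAddCommGroup E'] [NormedSpace ℝ E']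
  {H' : Type*} [TopologicalSpace H'] {I' : ModelWithCorners ℝ E' H'}
  {M' : Type*} [TopologicalSpace M'] [ChartedSpace H' M']

theorem contMDiff_prod_self_iff {g : ℝ × ℝ → M} :
    ContMDiff (𝓘(ℝ, ℝ).prod 𝓘(ℝ, ℝ)) I ∞ g ↔ ContMDiff 𝓘(ℝ, ℝ × ℝ) I ∞ g := by
  rw [modelWithCornersSelf_prod, ← chartedSpaceSelf_prod]

theorem velocity_left {g : ℝ × ℝ → M} {r t : ℝ} (hg : MDifferentiableAt 𝓘(ℝ, ℝ × ℝ) I g (r, t)) :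
    velocity I (fun r' => g (r', t)) r = mfderiv 𝓘(ℝ, ℝ × ℝ) I g (r, t) ((1, 0) : ℝ × ℝ) := by
  have h1 : HasFDerivAt (fun r' : ℝ => (r', t)) (ContinuousLinearMap.inl ℝ ℝ ℝ) r :=
    (hasFDerivAt_id r).prodMk (hasFDerivAt_const t r)
  have h2 := HasMFDerivAt.comp (f := fun r' : ℝ => (r', t)) r hg.hasMFDerivAt h1.hasMFDerivAt
  rw [velocity]
  erw [h2.mfderiv]
  rfl

theorem velocity_right {g : ℝ × ℝ → M} {r t : ℝ} (hg : MDifferentiableAt 𝓘(ℝ, ℝ × ℝ) I g (r, t)) :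
    velocity I (fun t' => g (r, t')) t = mfderiv 𝓘(ℝ, ℝ × ℝ) I g (r, t) ((0, 1) : ℝ × ℝ) := by
  have h1 : HasFDerivAt (fun t' : ℝ => (r, t')) (ContinuousLinearMap.inr ℝ ℝ ℝ) t :=
    (hasFDerivAt_const r t).prodMk (hasFDerivAt_id t)
  have h2 := HasMFDerivAt.comp (f := fun t' : ℝ => (r, t')) t hg.hasMFDerivAt h1.hasMFDerivAt
  rw [velocity]
  erw [h2.mfderiv]
  rfl

theorem velocity_comp {f : M → M'} {γ : ℝ → M} {t : ℝ} (hf : MDifferentiableAt I I' f (γ t))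
    (hγ : MDifferentiableAt 𝓘(ℝ, ℝ) I γ t) :
    velocity I' (fun t => f (γ t)) t = mfderiv I I' f (γ t) (velocity I γ t) := by
  have := mfderiv_comp t hf hγ
  exact congr($this (1 : ℝ))

theorem velocity_eq_deriv {V : Type*} [NormedAddCommGroup V] [NormedSpace ℝ V] (γ : ℝ → V) (t : ℝ) :
    velocity 𝓘(ℝ, V) γ t = deriv γ t := by
  rw [velocity, mfderiv_eq_fderiv]
  rfl

variable {α : OneForm I M} {g : ℝ × ℝ → M}

theorem contDiff_pullbackForm {V : Type*} [NormedAddCommGroup V] [NormedSpace ℝ V] {g : V → M}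
    (hα : ∀ x, IsChartSmoothAt α x) (hg : ContMDiff 𝓘(ℝ, V) I ∞ g) :
    ContDiff ℝ ∞ (pullbackForm α g) :=
  contDiff_iff_contDiffAt.2 fun z => contDiffAt_pullbackForm (hα _) (hg z)

theorem pullbackForm_left (hg : ContMDiff 𝓘(ℝ, ℝ × ℝ) I ∞ g) (r t : ℝ) :
    pullbackForm α g (r, t) (1, 0) = α (g (r, t)) (velocity I (fun r' => g (r', t)) r) := by
  rw [velocity_left ((hg _).mdifferentiableAt (by simp))]
  rfl

theorem pullbackForm_right (hg : ContMDiff 𝓘(ℝ, ℝ × ℝ) I ∞ g) (r t : ℝ) :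
    pullbackForm α g (r, t) (0, 1) = α (g (r, t)) (velocity I (fun t' => g (r, t')) t) := by
  rw [velocity_right ((hg _).mdifferentiableAt (by simp))]
  rfl

theorem extDerivOne_velocity (hα : ∀ x, IsChartSmoothAt α x) (hg : ContMDiff 𝓘(ℝ, ℝ × ℝ) I ∞ g)
    (r t : ℝ) :
    extDerivOne I α (g (r, t)) (velocity I (fun r' => g (r', t)) r)
        (velocity I (fun t' => g (r, t')) t) =
      fderiv ℝ (pullbackForm α g) (r, t) (1, 0) (0, 1) -
        fderiv ℝ (pullbackForm α g) (r, t) (0, 1) (1, 0) := by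
  rw [velocity_left ((hg _).mdifferentiableAt (by simp)),
    velocity_right ((hg _).mdifferentiableAt (by simp)), fderiv_pullbackForm_sub (hα _) (hg _)]

theorem continuous_extDerivOne_velocity (hα : ∀ x, IsChartSmoothAt α x)
    (hg : ContMDiff 𝓘(ℝ, ℝ × ℝ) I ∞ g) :
    Continuous fun z : ℝ × ℝ => extDerivOne I α (g z) (velocity I (fun r' => g (r', z.2)) z.1)
        (velocity I (fun t' => g (z.1, t')) z.2) := by
  have h : ∀ z : ℝ × ℝ, extDerivOne I α (g z) (velocity I (fun r' => g (r', z.2)) z.1)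
        (velocity I (fun t' => g (z.1, t')) z.2) = _ :=
    fun z => extDerivOne_velocity hα hg z.1 z.2
  simp_rw [h]
  have := (contDiff_pullbackForm hα hg).continuous_fderiv (by simp)
  fun_prop

/-- Stokes' theorem for the pullback of a 1-form to a rectangle. -/
theorem integral_extDerivOne_rectangle (hα : ∀ x, IsChartSmoothAt α x)
    (hg : ContMDiff 𝓘(ℝ, ℝ × ℝ) I ∞ g) (r₀ r₁ t₀ t₁ : ℝ) :
    (∫ r in r₀..r₁, ∫ t in t₀..t₁, extDerivOne I α (g (r, t)) (velocity I (fun r' => g (r', t)) r)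
        (velocity I (fun t' => g (r, t')) t)) =
      (∫ t in t₀..t₁, α (g (r₁, t)) (velocity I (fun t' => g (r₁, t')) t)) -
        (∫ t in t₀..t₁, α (g (r₀, t)) (velocity I (fun t' => g (r₀, t')) t)) -
        (∫ r in r₀..r₁, α (g (r, t₁)) (velocity I (fun r' => g (r', t₁)) r)) +
        ∫ r in r₀..r₁, α (g (r, t₀)) (velocity I (fun r' => g (r', t₀)) r) := by
  simp_rw [extDerivOne_velocity hα hg, ← pullbackForm_left hg, ← pullbackForm_right hg]
  exact integral_curl_rectangle ((contDiff_pullbackForm hα hg).of_le (by norm_cast))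
    r₀ r₁ t₀ t₁

end Plane

end RFH

namespace RFH

/-! ### The Liouville form in bundle charts. -/

section Liouville

variable {n : ℕ} {N : Type*} [TopologicalSpace N] [ChartedSpace (EuclideanSpace ℝ (Fin n)) N]
  [IsManifold (𝓡 n) ∞ N]

theorem mem_cot_source_iff {x y : Cotangent n N} :
    y ∈ (extChartAt (cotModel n) x).source ↔ y.proj ∈ (extChartAt (𝓡 n) x.proj).source := by
  rw [FiberBundle.extChartAt]
  have h : (trivializationAt (EuclideanSpace ℝ (Fin n) →L[ℝ] ℝ)
      (fun q : N => TangentSpace (𝓡 n) q →L[ℝ] ℝ) x.proj y).1 = y.proj := rfl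
  simp [PartialEquiv.trans_source, h]

theorem cot_extChartAt_apply (x y : Cotangent n N) :
    extChartAt (cotModel n) x y = (extChartAt (𝓡 n) x.proj y.proj,
      (trivializationAt (EuclideanSpace ℝ (Fin n) →L[ℝ] ℝ)
        (fun q : N => TangentSpace (𝓡 n) q →L[ℝ] ℝ) x.proj y).2) := by
  rw [FiberBundle.extChartAt]
  rfl

theorem cot_extChartAt_apply_snd {x y : Cotangent n N}
    (hy : y.proj ∈ (extChartAt (𝓡 n) x.proj).source) :
    (extChartAt (cotModel n) x y).2 = ContinuousLinearMap.comp
      (y.2 : EuclideanSpace ℝ (Fin n) →L[ℝ] ℝ)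
      (mfderiv 𝓘(ℝ, EuclideanSpace ℝ (Fin n)) (𝓡 n) (extChartAt (𝓡 n) x.proj).symm
        (extChartAt (𝓡 n) x.proj y.proj) :
          EuclideanSpace ℝ (Fin n) →L[ℝ] EuclideanSpace ℝ (Fin n)) := by
  have hy' : y.proj ∈ (chartAt (EuclideanSpace ℝ (Fin n)) x.proj).source := by simpa using hy
  rw [cot_extChartAt_apply, hom_trivializationAt_apply]
  ext a
  simp only [ContinuousLinearMap.inCoordinates]
  rw [TangentBundle.symmL_trivializationAt hy']
  simp [mfderivWithin_univ]
  rfl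

theorem contMDiff_cotProj : ContMDiff (cotModel n) (𝓡 n) ∞ (fun y : Cotangent n N => y.proj) :=
  contMDiff_proj _

/-- The fibre coordinate of a covector is its composition with the derivative of the inverse base
chart, and dτ in these charts is the first projection. So λ takes the canonical form p dq on the
whole chart. -/
theorem oneFormInChart_liouville {x : Cotangent n N} {y : CotModelSpace n}
    (hy : y ∈ (extChartAt (cotModel n) x).target) :
    oneFormInChart (liouville (n := n) (N := N)) x y =
      y.2.comp (ContinuousLinearMap.fst ℝ (EuclideanSpace ℝ (Fin n))
        (EuclideanSpace ℝ (Fin n) →L[ℝ] ℝ)) := by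
  set ψ := extChartAt (cotModel n) x with hψ
  set φ := extChartAt (𝓡 n) x.proj with hφ
  have hz : ψ.symm y ∈ ψ.source := ψ.map_target hy
  have hzp : (ψ.symm y).proj ∈ φ.source := mem_cot_source_iff.1 hz
  have hy1 : φ (ψ.symm y).proj = y.1 := by
    have := congrArg Prod.fst (ψ.right_inv hy)
    rwa [cot_extChartAt_apply] at this
  have hy2 := cot_extChartAt_apply_snd hzp
  rw [← hψ, ψ.right_inv hy, ← hφ, hy1] at hy2
  have hy1t : y.1 ∈ φ.target := hy1 ▸ φ.map_source hzp
  have hev : (fun z => (ψ.symm z).proj) =ᶠ[𝓝 y] fun z => φ.symm z.1 := by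
    filter_upwards [(isOpen_extChartAt_target x).mem_nhds hy] with z hz
    have h1 : φ (ψ.symm z).proj = z.1 := by
      have := congrArg Prod.fst (ψ.right_inv hz)
      rwa [cot_extChartAt_apply] at this
    rw [← h1, φ.left_inv (mem_cot_source_iff.1 (ψ.map_target hz))]
  have hd : MDifferentiableAt 𝓘(ℝ, CotModelSpace n) (cotModel n) ψ.symm y :=
    mdifferentiableAt_extChartAt_symm hy
  have hφd := mdifferentiableAt_extChartAt_symm hy1t
  have h1 : (dProj (ψ.symm y)).comp (mfderiv 𝓘(ℝ, CotModelSpace n) (cotModel n) ψ.symm y) =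
      mfderiv 𝓘(ℝ, CotModelSpace n) (𝓡 n) (fun z => (ψ.symm z).proj) y :=
    (mfderiv_comp y (contMDiff_cotProj.mdifferentiable (by simp) _) hd).symm
  have h2 : mfderiv 𝓘(ℝ, CotModelSpace n) (𝓡 n) (fun z : CotModelSpace n => φ.symm z.1) y =
      ContinuousLinearMap.comp (mfderiv 𝓘(ℝ, EuclideanSpace ℝ (Fin n)) (𝓡 n) φ.symm y.1)
        (ContinuousLinearMap.fst ℝ (EuclideanSpace ℝ (Fin n))
          (EuclideanSpace ℝ (Fin n) →L[ℝ] ℝ)) := by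
    have hf : HasFDerivAt (Prod.fst : CotModelSpace n → _) (ContinuousLinearMap.fst ℝ _ _) y :=
      hasFDerivAt_fst
    exact (HasMFDerivAt.comp (f := (Prod.fst : CotModelSpace n → _)) y hφd.hasMFDerivAt
      hf.hasMFDerivAt).mfderiv
  refine ContinuousLinearMap.ext fun a => ?_
  have h3 : oneFormInChart (liouville (n := n) (N := N)) x y a =
    (ψ.symm y).2 (((dProj (ψ.symm y)).comp
      (mfderiv 𝓘(ℝ, CotModelSpace n) (cotModel n) ψ.symm y)) a) := rfl
  rw [h3, h1, hev.mfderiv_eq, h2, hy2]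
  rfl

theorem liouville_isChartSmoothAt (x : Cotangent n N) :
    IsChartSmoothAt (liouville (n := n) (N := N)) x := by
  have : ContDiffAt ℝ ∞ (fun y : CotModelSpace n => y.2.comp
      (ContinuousLinearMap.fst ℝ (EuclideanSpace ℝ (Fin n)) (EuclideanSpace ℝ (Fin n) →L[ℝ] ℝ)))
      (extChartAt (cotModel n) x x) := contDiffAt_snd.clm_comp contDiffAt_const
  refine this.congr_of_eventuallyEq ?_
  filter_upwards [(isOpen_extChartAt_target x).mem_nhds (mem_extChartAt_target x)] with y hy
  exact oneFormInChart_liouville hy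

/-- In the preferred chart, `dλ = dp ∧ dq`. -/
theorem extDerivOne_liouville (x : Cotangent n N) (u v : TangentSpace (cotModel n) x) :
    extDerivOne (cotModel n) liouville x u v =
      (mfderiv (cotModel n) 𝓘(ℝ, CotModelSpace n) (extChartAt (cotModel n) x) x u).2
        (mfderiv (cotModel n) 𝓘(ℝ, CotModelSpace n) (extChartAt (cotModel n) x) x v).1 -
      (mfderiv (cotModel n) 𝓘(ℝ, CotModelSpace n) (extChartAt (cotModel n) x) x v).2
        (mfderiv (cotModel n) 𝓘(ℝ, CotModelSpace n) (extChartAt (cotModel n) x) x u).1 := by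
  have h : oneFormInChart (liouville (n := n) (N := N)) x =ᶠ[𝓝 (extChartAt (cotModel n) x x)]
      fun y : CotModelSpace n => ((ContinuousLinearMap.compL ℝ (CotModelSpace n) (EuclideanSpace ℝ (Fin n)) ℝ).flip
      (ContinuousLinearMap.fst ℝ (EuclideanSpace ℝ (Fin n)) (EuclideanSpace ℝ (Fin n) →L[ℝ] ℝ))
      ∘L ContinuousLinearMap.snd ℝ _ _) y := by
    filter_upwards [(isOpen_extChartAt_target x).mem_nhds (mem_extChartAt_target x)] with y hy
    exact oneFormInChart_liouville hy
  rw [extDerivOne_eq, h.fderiv_eq, ContinuousLinearMap.fderiv]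
  rfl

theorem mfderiv_cot_extChartAt_fst (x : Cotangent n N) (u : TangentSpace (cotModel n) x) :
    (mfderiv (cotModel n) 𝓘(ℝ, CotModelSpace n) (extChartAt (cotModel n) x) x u).1 =
      mfderiv (𝓡 n) 𝓘(ℝ, EuclideanSpace ℝ (Fin n)) (extChartAt (𝓡 n) x.proj) x.proj
        (dProj x u) := by
  have h1 : MDifferentiableAt (cotModel n) 𝓘(ℝ, CotModelSpace n) (extChartAt (cotModel n) x) x :=
    (contMDiffAt_extChartAt (n := ∞)).mdifferentiableAt (by simp)
  have h2 : MDifferentiableAt (𝓡 n) 𝓘(ℝ, EuclideanSpace ℝ (Fin n))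
      (extChartAt (𝓡 n) x.proj) x.proj :=
    (contMDiffAt_extChartAt (n := ∞)).mdifferentiableAt (by simp)
  have hf : HasFDerivAt (Prod.fst : CotModelSpace n → _) (ContinuousLinearMap.fst ℝ _ _)
    (extChartAt (cotModel n) x x) := hasFDerivAt_fst
  have e1 := (HasMFDerivAt.comp x hf.hasMFDerivAt h1.hasMFDerivAt).mfderiv
  have e2 := mfderiv_comp x (f := fun y : Cotangent n N => y.proj) h2
    (contMDiff_cotProj.mdifferentiable (by simp) _)
  have e3 : (Prod.fst ∘ (extChartAt (cotModel n) x) : Cotangent n N → _) =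
      extChartAt (𝓡 n) x.proj ∘ fun y : Cotangent n N => y.proj := by
    ext1 y
    simp only [Function.comp_apply, cot_extChartAt_apply]
  rw [e3] at e1
  exact congr($(e1.symm.trans e2) u)

end Liouville

end RFH

namespace RFH

/-! ### Linear algebra of the twisted form and of compatible complex structures. -/

section Bilinear

/-- Cauchy-Schwarz for the metric `B(·, J·)` of a compatible complex structure. -/
theorem sq_le_of_compatible {V : Type*} [AddCommGroup V] [Module ℝ V] {B : V →ₗ[ℝ] V →ₗ[ℝ] ℝ}
    {J : V →ₗ[ℝ] V} (halt : ∀ u, B u u = 0) (hsq : ∀ u, J (J u) = -u)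
    (hsymm : ∀ u v, B u (J v) = B v (J u)) (hpos : ∀ u, u ≠ 0 → 0 < B u (J u)) (u v : V) :
    B u v ^ 2 ≤ B u (J u) * B v (J v) := by
  have hnn : ∀ w, 0 ≤ B w (J w) := by
    intro w
    rcases eq_or_ne w 0 with rfl | hw
    · simp
    · exact (hpos w hw).le
  have hswap : B (J v) v = - B v (J v) := (LinearMap.IsAlt.neg halt v (J v)).symm ▸ rfl
  -- This is the square norm of `u + r • J v`. The shift is along `J v`, because the metric pairs
  -- `u` with `J v` to `-B u v`. The claim is its discriminant inequality.
  have h : ∀ r : ℝ, 0 ≤ B v (J v) * (r * r) + (-2 * B u v) * r + B u (J u) := by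
    intro r
    have h1 := hnn (u + r • J v)
    have h3 : B (J v) (J u) = - B u v := by rw [hsymm, hsq, map_neg]
    simp only [map_add, map_smul, LinearMap.add_apply, LinearMap.smul_apply, smul_eq_mul, hsq,
      map_neg, h3, hswap] at h1
    linarith
  have := discrim_le_zero h
  rw [discrim] at this
  nlinarith

end Bilinear

section ExtDeriv

variable {E : Type*} [NormedAddCommGroup E] [NormedSpace ℝ E]
  {H : Type*} [TopologicalSpace H] {I : ModelWithCorners ℝ E H} [I.Boundaryless]
  {M : Type*} [TopologicalSpace M] [ChartedSpace H M] [IsManifold I ∞ M]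

/-- The antisymmetrization of a bilinear form. -/
def antisymm (D : E →L[ℝ] E →L[ℝ] ℝ) : E →ₗ[ℝ] E →ₗ[ℝ] ℝ :=
  LinearMap.mk₂ ℝ (fun a b => D a b - D b a)
    (fun u u' v => by simp only [map_add, add_apply]; ring)
    (fun c u v => by simp only [map_smul, smul_apply, smul_eq_mul]; ring)
    (fun u v v' => by simp only [map_add, add_apply]; ring)
    (fun c u v => by simp only [map_smul, smul_apply, smul_eq_mul]; ring)

/-- The exterior derivative of a 1-form at a point, as a bilinear map. -/
def extDerivOneLin (α : OneForm I M) (x : M) :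
    TangentSpace I x →ₗ[ℝ] TangentSpace I x →ₗ[ℝ] ℝ :=
  (antisymm (fderiv ℝ (oneFormInChart α x) (extChartAt I x x))).compl₁₂
    (show TangentSpace I x →L[ℝ] E from mfderiv I 𝓘(ℝ, E) (extChartAt I x) x).toLinearMap
    (show TangentSpace I x →L[ℝ] E from mfderiv I 𝓘(ℝ, E) (extChartAt I x) x).toLinearMap

end ExtDeriv

section TwistedForm

variable {n : ℕ} {N : Type*} [TopologicalSpace N] [ChartedSpace (EuclideanSpace ℝ (Fin n)) N]
  [IsManifold (𝓡 n) ∞ N] {σ : BilinField (𝓡 n) N} {x : Cotangent n N}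

/-- The twisted form at a point, as a bilinear map. -/
def twistedFormLin (σ : BilinField (𝓡 n) N) (x : Cotangent n N) :
    TangentSpace (cotModel n) x →ₗ[ℝ] TangentSpace (cotModel n) x →ₗ[ℝ] ℝ :=
  extDerivOneLin liouville x + LinearMap.mk₂ ℝ (fun u v => σ x.proj (dProj x u) (dProj x v))
    (fun u u' v => by simp only [ContinuousLinearMap.map_add, add_apply])
    (fun c u v => by simp only [ContinuousLinearMap.map_smul, smul_apply])
    (fun u v v' => by simp only [ContinuousLinearMap.map_add])
    (fun c u v => by simp only [ContinuousLinearMap.map_smul])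

theorem twistedFormLin_apply (u v : TangentSpace (cotModel n) x) :
    twistedFormLin σ x u v = twistedForm σ x u v := rfl

theorem twistedForm_self (hσ : ∀ x u, σ x u u = 0) (u : TangentSpace (cotModel n) x) :
    twistedForm σ x u u = 0 := by
  rw [twistedForm, extDerivOne_self, hσ, zero_add]

theorem twistedForm_swap (hσ : ∀ x u, σ x u u = 0) (u v : TangentSpace (cotModel n) x) :
    twistedForm σ x u v = - twistedForm σ x v u := by
  have h : (twistedFormLin σ x).IsAlt := fun u => twistedForm_self hσ u
  exact (h.neg v u).symm

theorem twistedForm_add_right (u v v' : TangentSpace (cotModel n) x) :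
    twistedForm σ x u (v + v') = twistedForm σ x u v + twistedForm σ x u v' :=
  (twistedFormLin σ x u).map_add v v'

theorem twistedForm_smul_right (c : ℝ) (u v : TangentSpace (cotModel n) x) :
    twistedForm σ x u (c • v) = c * twistedForm σ x u v :=
  (twistedFormLin σ x u).map_smul c v

theorem twistedForm_neg_right (u v : TangentSpace (cotModel n) x) :
    twistedForm σ x u (-v) = - twistedForm σ x u v :=
  (twistedFormLin σ x u).map_neg v

variable {J : TangentSpace (cotModel n) x →L[ℝ] TangentSpace (cotModel n) x}

theorem twistedForm_sq_le (hσ : ∀ x u, σ x u u = 0) (hsq : ∀ u, J (J u) = -u)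
    (hsymm : ∀ u v, twistedForm σ x u (J v) = twistedForm σ x v (J u))
    (hpos : ∀ u, u ≠ 0 → 0 < twistedForm σ x u (J u)) (u v : TangentSpace (cotModel n) x) :
    twistedForm σ x u v ^ 2 ≤ twistedForm σ x u (J u) * twistedForm σ x v (J v) :=
  sq_le_of_compatible (B := twistedFormLin σ x)
    (J := (J : TangentSpace (cotModel n) x →ₗ[ℝ] TangentSpace (cotModel n) x))
    (fun u => twistedForm_self hσ u) hsq hsymm hpos u v

end TwistedForm

/-! ### Smoothness of the defining Hamiltonian and the horizontal part of its vector field. -/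

section Hamiltonian

variable {n : ℕ} {N : Type*} [MetricSpace N] [ChartedSpace (EuclideanSpace ℝ (Fin n)) N]
  [IsManifold (𝓡 n) ∞ N] [RiemannianBundle (fun q : N => TangentSpace (𝓡 n) q)]

instance (q : N) : FiniteDimensional ℝ (TangentSpace (𝓡 n) q) :=
  inferInstanceAs (FiniteDimensional ℝ (EuclideanSpace ℝ (Fin n)))

instance (q : N) : CompleteSpace (TangentSpace (𝓡 n) q) :=
  FiniteDimensional.complete ℝ _

/-- The vector dual to a covector. -/
def sharp {q : N} (p : TangentSpace (𝓡 n) q →L[ℝ] ℝ) : TangentSpace (𝓡 n) q :=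
  (InnerProductSpace.toDual ℝ (TangentSpace (𝓡 n) q)).symm p

theorem inner_sharp {q : N} (p : TangentSpace (𝓡 n) q →L[ℝ] ℝ) (u : TangentSpace (𝓡 n) q) :
    inner ℝ (sharp p) u = p u :=
  InnerProductSpace.toDual_symm_apply

theorem norm_sharp {q : N} (p : TangentSpace (𝓡 n) q →L[ℝ] ℝ) : ‖sharp p‖ = ‖p‖ :=
  LinearIsometryEquiv.norm_map _ _

theorem sharp_add_smul {q : N} (p w : TangentSpace (𝓡 n) q →L[ℝ] ℝ) (c : ℝ) :
    sharp (p + c • w) = sharp p + c • sharp w := by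
  simp [sharp, map_add]

variable [IsContMDiffRiemannianBundle (𝓡 n) ∞ (EuclideanSpace ℝ (Fin n))
      (fun q : N => TangentSpace (𝓡 n) q)]

/-- In a trivialization the metric is a smooth family G of positive definite matrices, and the dual
square norm is P(G⁻¹P) for the covector coordinates P. Smoothness follows from that of inversion;
G⁻¹P are the coordinates of the Riesz dual. -/
theorem contMDiff_norm_sq :
    ContMDiff (cotModel n) 𝓘(ℝ, ℝ) ∞ (fun x : Cotangent n N => ‖x.2‖ ^ 2) := by
  obtain ⟨g, hg, hgi⟩ := IsContMDiffRiemannianBundle.exists_contMDiff (IB := 𝓡 n) (n := ∞)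
    (F := EuclideanSpace ℝ (Fin n)) (E := fun q : N => TangentSpace (𝓡 n) q)
  intro x₀
  have hG := ((contMDiffAt_hom_bundle _).1 (hg x₀.proj)).2
  set q₀ := x₀.proj with hq₀
  set G : N → EuclideanSpace ℝ (Fin n) →L[ℝ] EuclideanSpace ℝ (Fin n) →L[ℝ] ℝ := fun q =>
    ContinuousLinearMap.inCoordinates (EuclideanSpace ℝ (Fin n))
      (fun q : N => TangentSpace (𝓡 n) q) (EuclideanSpace ℝ (Fin n) →L[ℝ] ℝ)
      (fun q : N => TangentSpace (𝓡 n) q →L[ℝ] ℝ) q₀ q q₀ q (g q) with hGdef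
  set T := trivializationAt (EuclideanSpace ℝ (Fin n)) (fun q : N => TangentSpace (𝓡 n) q) q₀
  have hGapply : ∀ q ∈ T.baseSet, ∀ a b, G q a b = inner ℝ (T.symm q a) (T.symm q b) := by
    intro q hq a b
    rw [hgi, hGdef]
    have := inCoordinates_apply_eq₂ (𝕜 := ℝ) (x₀ := q₀) (x := q) (ϕ := g q) (v := a) (w := b)
      (F₃ := ℝ) (E₃ := Bundle.Trivial N ℝ) hq hq (by simp)
    simpa using this
  have hGinv : ∀ q ∈ T.baseSet, (G q).IsInvertible := by
    intro q hq
    have hinj : Function.Injective (G q).toLinearMap := by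
      refine (injective_iff_map_eq_zero _).2 fun a ha => ?_
      have h1 : G q a a = 0 := congr($ha a)
      rw [hGapply q hq, inner_self_eq_zero] at h1
      have h2 := T.continuousLinearMapAt_symmL (R := ℝ) hq a
      rw [T.symmL_apply (R := ℝ) hq, h1, map_zero] at h2
      exact h2.symm
    have hdim : Module.finrank ℝ (EuclideanSpace ℝ (Fin n)) =
        Module.finrank ℝ (EuclideanSpace ℝ (Fin n) →L[ℝ] ℝ) :=
      (Subspace.dual_finrank_eq.symm).trans
        (LinearEquiv.finrank_eq LinearMap.toContinuousLinearMap)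
    refine ⟨(LinearMap.linearEquivOfInjective _ hinj hdim).toContinuousLinearEquiv, ?_⟩
    ext a b
    simp
  set P : Cotangent n N → EuclideanSpace ℝ (Fin n) →L[ℝ] ℝ := fun y =>
    (trivializationAt (EuclideanSpace ℝ (Fin n) →L[ℝ] ℝ)
        (fun q : N => TangentSpace (𝓡 n) q →L[ℝ] ℝ) q₀ y).2
  have hP : ContMDiffAt (cotModel n) 𝓘(ℝ, EuclideanSpace ℝ (Fin n) →L[ℝ] ℝ) ∞ P x₀ :=
    (contMDiffAt_totalSpace.1 contMDiffAt_id).2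
  have hPapply : ∀ y : Cotangent n N, y.proj ∈ T.baseSet → ∀ a, P y a = y.2 (T.symm y.proj a) := by
    intro y hy a
    have : P y = ContinuousLinearMap.inCoordinates _ _ ℝ (Bundle.Trivial N ℝ) q₀ y.proj q₀ y.proj
      y.2 := by
      simp only [P]; rw [hom_trivializationAt_apply]
    rw [this]
    simp [ContinuousLinearMap.inCoordinates, T.symmL_apply (R := ℝ) hy, T]
  have hGi : ContMDiffAt (cotModel n) 𝓘(ℝ, (EuclideanSpace ℝ (Fin n) →L[ℝ] ℝ) →L[ℝ]
      EuclideanSpace ℝ (Fin n)) ∞ (fun y : Cotangent n N => (G y.proj).inverse) x₀ := by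
    have h1 : ContMDiffAt (cotModel n) _ ∞ (fun y : Cotangent n N => G y.proj) x₀ :=
      ContMDiffAt.comp x₀ hG (contMDiff_cotProj x₀)
    have h2 := (hGinv q₀ (mem_baseSet_trivializationAt _ _ _)).contDiffAt_map_inverse (n := ∞)
    exact ContMDiffAt.comp x₀ h2.contMDiffAt h1
  have hfin : ContMDiffAt (cotModel n) 𝓘(ℝ, ℝ) ∞
      (fun y : Cotangent n N => P y ((G y.proj).inverse (P y))) x₀ :=
    hP.clm_apply (hGi.clm_apply hP)
  refine hfin.congr_of_eventuallyEq ?_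
  have hnear : ∀ᶠ y : Cotangent n N in 𝓝 x₀, y.proj ∈ T.baseSet :=
    (contMDiff_cotProj (n := n) (N := N)).continuous.continuousAt
      (T.open_baseSet.mem_nhds (mem_baseSet_trivializationAt _ _ _))
  filter_upwards [hnear] with y hy
  obtain ⟨e, he⟩ := hGinv _ hy
  set a := (G y.proj).inverse (P y) with ha
  have hGa : G y.proj a = P y := by
    rw [ha, ← he, ContinuousLinearMap.inverse_equiv]
    simp
  have hsh : sharp y.2 = T.symm y.proj a := by
    refine ext_inner_right ℝ fun u => ?_
    obtain ⟨b, rfl⟩ : ∃ b, T.symm y.proj b = u :=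
      ⟨T.continuousLinearMapAt ℝ y.proj u, by
        rw [← T.symmL_apply (R := ℝ) hy]; exact T.symmL_continuousLinearMapAt hy u⟩
    rw [inner_sharp, ← hGapply _ hy, hGa, hPapply _ hy]
  rw [hPapply _ hy, ← hsh, ← inner_sharp, real_inner_self_eq_norm_sq, norm_sharp]

variable {U : N → ℝ} {k ξ : ℝ} {χ : ℝ → ℝ}

theorem contMDiff_definingHamiltonian (hU : ContMDiff (𝓡 n) 𝓘(ℝ, ℝ) ∞ U) (hχ : ContDiff ℝ ∞ χ) :
    ContMDiff (cotModel n) 𝓘(ℝ, ℝ) ∞ (definingHamiltonian (n := n) U k χ) := by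
  have h1 : ContMDiff (cotModel n) 𝓘(ℝ, ℝ) ∞ (fun x : Cotangent n N =>
      (1 / 2) * ‖x.2‖ ^ 2 + U x.proj - k) :=
    ((contMDiff_const.mul contMDiff_norm_sq).add (hU.comp contMDiff_cotProj)).sub contMDiff_const
  exact hχ.contMDiff.comp h1

end Hamiltonian

end RFH

namespace RFH

section Velocity

variable {E : Type*} [NormedAddCommGroup E] [NormedSpace ℝ E]
  {H : Type*} [TopologicalSpace H] {I : ModelWithCorners ℝ E H}
  {M : Type*} [TopologicalSpace M] [ChartedSpace H M]
  {V : Type*} [NormedAddCommGroup V] [NormedSpace ℝ V]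

theorem hasDerivAt_comp_velocity {F : M → V} {γ : ℝ → M} {t : ℝ}
    (hF : MDifferentiableAt I 𝓘(ℝ, V) F (γ t)) (hγ : MDifferentiableAt 𝓘(ℝ, ℝ) I γ t) :
    HasDerivAt (fun t => F (γ t)) (mfderiv I 𝓘(ℝ, V) F (γ t) (velocity I γ t)) t := by
  have h : HasFDerivAt (fun t => F (γ t))
      (ContinuousLinearMap.comp (mfderiv I 𝓘(ℝ, V) F (γ t)) (mfderiv 𝓘(ℝ, ℝ) I γ t) : ℝ →L[ℝ] V) t :=
    (HasMFDerivAt.comp t hF.hasMFDerivAt hγ.hasMFDerivAt).hasFDerivAt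
  exact h.hasDerivAt

/-- The chain rule with the tangent vector placed at `x` instead of `γ 0`; the two base points are
equal only propositionally. -/
theorem exists_velocity {γ : ℝ → M} {x : M} (hx : γ 0 = x) (hγ : MDifferentiableAt 𝓘(ℝ, ℝ) I γ 0) :
    ∃ u : TangentSpace I x, ∀ (V : Type) [NormedAddCommGroup V] [NormedSpace ℝ V] (F : M → V),
      MDifferentiableAt I 𝓘(ℝ, V) F x →
        HasDerivAt (fun t => F (γ t)) (mfderiv I 𝓘(ℝ, V) F x u) 0 := by
  subst hx
  exact ⟨velocity I γ 0, fun V _ _ F hF => hasDerivAt_comp_velocity hF hγ⟩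

end Velocity

section ChartDeriv

variable {E : Type*} [NormedAddCommGroup E] [NormedSpace ℝ E]
  {H : Type*} [TopologicalSpace H] {I : ModelWithCorners ℝ E H} [I.Boundaryless]
  {M : Type*} [TopologicalSpace M] [ChartedSpace H M] [IsManifold I ∞ M]

theorem mfderiv_extChartAt_injective {x z : M} (hz : z ∈ (extChartAt I x).source)
    {a : TangentSpace I z} (ha : mfderiv I 𝓘(ℝ, E) (extChartAt I x) z a = (0 : E)) : a = 0 := by
  have : IsManifold I 1 M := IsManifold.of_le (n := ∞) (by norm_cast)
  obtain ⟨e, he⟩ := isInvertible_mfderiv_extChartAt (I := I) hz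
  rw [← he] at ha
  exact e.map_eq_zero_iff.1 ha

theorem mfderiv_extChartAt_symm_apply (x : M) (a : TangentSpace I x) :
    (mfderiv 𝓘(ℝ, E) I (extChartAt I x).symm (extChartAt I x x) : E →L[ℝ] E)
      (mfderiv I 𝓘(ℝ, E) (extChartAt I x) x a) = a := by
  have : IsManifold I 1 M := IsManifold.of_le (n := ∞) (by norm_cast)
  have h := mfderivWithin_extChartAt_symm_comp_mfderiv_extChartAt' (I := I)
    (mem_extChartAt_source (I := I) x)
  rw [ModelWithCorners.range_eq_univ, mfderivWithin_univ] at h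
  exact congr($h a)

end ChartDeriv

section Vertical

variable {n : ℕ} {N : Type*} [MetricSpace N] [ChartedSpace (EuclideanSpace ℝ (Fin n)) N]
  [IsManifold (𝓡 n) ∞ N] [RiemannianBundle (fun q : N => TangentSpace (𝓡 n) q)]
  [IsContMDiffRiemannianBundle (𝓡 n) ∞ (EuclideanSpace ℝ (Fin n))
      (fun q : N => TangentSpace (𝓡 n) q)]

variable {U : N → ℝ} {k ξ : ℝ} {χ : ℝ → ℝ}

/-- The vertical line through a covector. -/
def verticalLine (x : Cotangent n N) (w : TangentSpace (𝓡 n) x.proj →L[ℝ] ℝ) (ε : ℝ) :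
    Cotangent n N :=
  ⟨x.proj, x.2 + ε • w⟩

/-- Coordinates of a covector at `q` in the preferred chart at `q`. -/
def covectorCoord {q : N} (w : TangentSpace (𝓡 n) q →L[ℝ] ℝ) : EuclideanSpace ℝ (Fin n) →L[ℝ] ℝ :=
  ContinuousLinearMap.comp (w : EuclideanSpace ℝ (Fin n) →L[ℝ] ℝ)
      (mfderiv 𝓘(ℝ, EuclideanSpace ℝ (Fin n)) (𝓡 n) (extChartAt (𝓡 n) q).symm
        (extChartAt (𝓡 n) q q) : EuclideanSpace ℝ (Fin n) →L[ℝ] EuclideanSpace ℝ (Fin n))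

theorem covectorCoord_add_smul {q : N} (p w : TangentSpace (𝓡 n) q →L[ℝ] ℝ) (ε : ℝ) :
    covectorCoord (p + ε • w) = covectorCoord p + ε • covectorCoord w := rfl

theorem covectorCoord_apply {q : N} (w : TangentSpace (𝓡 n) q →L[ℝ] ℝ) (a : TangentSpace (𝓡 n) q) :
    covectorCoord w (mfderiv (𝓡 n) 𝓘(ℝ, EuclideanSpace ℝ (Fin n)) (extChartAt (𝓡 n) q) q a) = w a :=
  congrArg w (mfderiv_extChartAt_symm_apply q a)

theorem extChartAt_verticalLine (x : Cotangent n N) (w : TangentSpace (𝓡 n) x.proj →L[ℝ] ℝ)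
    (ε : ℝ) :
    extChartAt (cotModel n) x (verticalLine x w ε) =
      ((extChartAt (𝓡 n) x.proj x.proj, covectorCoord x.2) : CotModelSpace n) +
      ε • ((0, covectorCoord w) : CotModelSpace n) := by
  refine Prod.ext ?_ ?_
  · rw [cot_extChartAt_apply]
    simp [verticalLine]
  · refine (cot_extChartAt_apply_snd (x := x) (y := verticalLine x w ε)
      (mem_extChartAt_source _)).trans ?_
    exact covectorCoord_add_smul x.2 w ε

theorem mdifferentiableAt_verticalLine (x : Cotangent n N)
    (w : TangentSpace (𝓡 n) x.proj →L[ℝ] ℝ) :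
    MDifferentiableAt 𝓘(ℝ, ℝ) (cotModel n) (verticalLine x w) 0 := by
  have h0 : verticalLine x w 0 = x := by simp [verticalLine]
  have h1 : verticalLine x w = (extChartAt (cotModel n) x).symm ∘
      fun ε => extChartAt (cotModel n) x (verticalLine x w ε) := by
    ext1 ε
    have hm : verticalLine x w ε ∈ (extChartAt (cotModel n) x).source :=
      mem_cot_source_iff.2 (mem_extChartAt_source x.proj)
    exact ((extChartAt (cotModel n) x).left_inv hm).symm
  rw [h1]
  have hd : DifferentiableAt ℝ (fun ε => extChartAt (cotModel n) x (verticalLine x w ε)) 0 := by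
    simp_rw [extChartAt_verticalLine]
    fun_prop
  refine MDifferentiableAt.comp 0 ?_ hd.mdifferentiableAt
  rw [h0]
  exact mdifferentiableAt_extChartAt_symm (mem_extChartAt_target x)

theorem hasDerivAt_norm_sq_verticalLine (x : Cotangent n N)
    (w : TangentSpace (𝓡 n) x.proj →L[ℝ] ℝ) :
    HasDerivAt (fun ε => ‖(verticalLine x w ε).2‖ ^ 2) (2 * inner ℝ (sharp x.2) (sharp w)) 0 := by
  have h : ∀ ε, ‖(verticalLine x w ε).2‖ ^ 2 =
      ‖sharp x.2‖ ^ 2 + 2 * (ε * inner ℝ (sharp x.2) (sharp w)) + ε ^ 2 * ‖sharp w‖ ^ 2 := by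
    intro ε
    have : ‖(verticalLine x w ε).2‖ = ‖sharp x.2 + ε • sharp w‖ := by
      rw [← sharp_add_smul, norm_sharp]; rfl
    rw [this, norm_add_sq_real, inner_smul_right, norm_smul, mul_pow, Real.norm_eq_abs, sq_abs]
  simp_rw [h]
  have h1 := (((hasDerivAt_id (0 : ℝ)).mul_const (inner ℝ (sharp x.2) (sharp w))).const_mul
    2).const_add (‖sharp x.2‖ ^ 2)
  have h2 := ((hasDerivAt_id (0 : ℝ)).pow 2).mul_const (‖sharp w‖ ^ 2)
  have h3 := h1.add h2
  simp only [id, one_mul, Nat.cast_ofNat, mul_zero, zero_mul, add_zero, Nat.add_one_sub_one,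
    pow_one] at h3
  exact h3

/-- The horizontal part of the Hamiltonian vector field is `χ' p^♯`. -/
theorem apply_dProj_hamiltonianVectorField (hU : ContMDiff (𝓡 n) 𝓘(ℝ, ℝ) ∞ U)
    (hχ : ContDiff ℝ ∞ χ) {σ : BilinField (𝓡 n) N}
    {X : ∀ x : Cotangent n N, TangentSpace (cotModel n) x}
    (hX : IsHamiltonianVectorField σ (definingHamiltonian U k χ) X) (x : Cotangent n N)
    (w : TangentSpace (𝓡 n) x.proj →L[ℝ] ℝ) :
    w (dProj x (X x)) =
      deriv χ ((1 / 2) * ‖x.2‖ ^ 2 + U x.proj - k) * inner ℝ (sharp x.2) (sharp w) := by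
  have h0 : verticalLine x w 0 = x := by simp [verticalLine]
  obtain ⟨u, hu⟩ := exists_velocity h0 (mdifferentiableAt_verticalLine x w)
  have e1 : mfderiv (cotModel n) 𝓘(ℝ, ℝ) (definingHamiltonian U k χ) x u =
      deriv χ ((1 / 2) * ‖x.2‖ ^ 2 + U x.proj - k) * inner ℝ (sharp x.2) (sharp w) := by
    have h2 := hu ℝ (definingHamiltonian U k χ)
      ((contMDiff_definingHamiltonian (n := n) (k := k) hU hχ).mdifferentiable (by simp) x)
    have h3 : HasDerivAt (fun ε => (1 / 2) * ‖(verticalLine x w ε).2‖ ^ 2 + U x.proj - k)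
        (inner ℝ (sharp x.2) (sharp w)) 0 := by
      have := (((hasDerivAt_norm_sq_verticalLine x w).const_mul (1 / 2)).add_const
        (U x.proj)).sub_const k
      rwa [← mul_assoc, one_div_mul_cancel two_ne_zero, one_mul] at this
    have h4 : HasDerivAt χ (deriv χ ((1 / 2) * ‖x.2‖ ^ 2 + U x.proj - k))
        ((1 / 2) * ‖(verticalLine x w 0).2‖ ^ 2 + U x.proj - k) := by
      rw [h0]
      exact (hχ.differentiable (by simp) _).hasDerivAt
    exact h2.unique (h4.comp 0 h3)
  have e3 : mfderiv (cotModel n) 𝓘(ℝ, CotModelSpace n) (extChartAt (cotModel n) x) x u =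
      ((0, covectorCoord w) : CotModelSpace n) := by
    have h2 := hu (CotModelSpace n) (extChartAt (cotModel n) x)
      ((contMDiffAt_extChartAt (n := ∞)).mdifferentiableAt (by simp))
    simp_rw [extChartAt_verticalLine] at h2
    have h3 := ((hasDerivAt_id (0 : ℝ)).smul_const
      ((0, covectorCoord w) : CotModelSpace n)).const_add
      ((extChartAt (𝓡 n) x.proj x.proj, covectorCoord x.2) : CotModelSpace n)
    rw [one_smul] at h3
    exact h2.unique h3
  have e2 : dProj x u = 0 := by
    refine mfderiv_extChartAt_injective (mem_extChartAt_source (I := 𝓡 n) x.proj) ?_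
    rw [← mfderiv_cot_extChartAt_fst, e3]
  -- On a vertical vector the magnetic term vanishes, since dτ u = 0, and dp ∧ dq pairs `u` only
  -- with the horizontal part of `X`. So the formula does not depend on `σ`.
  have e4 : twistedForm σ x (X x) u = - w (dProj x (X x)) := by
    rw [twistedForm, e2, ContinuousLinearMap.map_zero, add_zero, extDerivOne_liouville, e3,
      mfderiv_cot_extChartAt_fst]
    simp only [covectorCoord_apply, ContinuousLinearMap.map_zero, zero_sub]
  have := hX x u
  rw [e1, e4, neg_neg] at this
  exact this.symm

end Vertical

end RFH

/-! ### Consequences of convergence of loops. -/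

namespace RFH

theorem tendsto_prod_of_tendstoUniformly {ι : Type*} {l : Filter ι} {f : ι → ℝ → ℝ} {g : ℝ → ℝ}
    (h : TendstoUniformly f g l) {t₀ : ℝ} (hg : ContinuousAt g t₀) :
    Tendsto (fun z : ι × ℝ => f z.1 z.2) (l ×ˢ 𝓝 t₀) (𝓝 (g t₀)) := by
  rw [Metric.tendsto_nhds]
  intro ε hε
  have h1 := Metric.tendstoUniformly_iff.1 h (ε / 2) (half_pos hε)
  have h2 : ∀ᶠ t in 𝓝 t₀, dist (g t) (g t₀) < ε / 2 := Metric.tendsto_nhds.1 hg _ (half_pos hε)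
  filter_upwards [h1.prod_mk h2] with z hz
  have := dist_triangle (f z.1 z.2) (g z.2) (g t₀)
  have h3 := hz.1 z.2
  rw [dist_comm] at h3
  linarith [hz.2]

theorem tendsto_functional_apply {ι V : Type*} [NormedAddCommGroup V] [NormedSpace ℝ V]
    {l : Filter ι} {L : ι → V →L[ℝ] ℝ} {L₀ : V →L[ℝ] ℝ} {a : ι → V} {a₀ : V}
    (hL : Tendsto L l (𝓝 L₀)) (ha : Tendsto a l (𝓝 a₀)) :
    Tendsto (fun i => L i (a i)) l (𝓝 (L₀ a₀)) :=
  ((isBoundedBilinearMap_apply (𝕜 := ℝ) (E := V) (F := ℝ)).continuous.tendsto (L₀, a₀)).comp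
    (hL.prodMk_nhds ha)

section Velocity

variable {E : Type*} [NormedAddCommGroup E] [NormedSpace ℝ E]
  {H : Type*} [TopologicalSpace H] {I : ModelWithCorners ℝ E H} [I.Boundaryless]
  {M : Type*} [TopologicalSpace M] [ChartedSpace H M] [IsManifold I ∞ M]
  {V : Type*} [NormedAddCommGroup V] [NormedSpace ℝ V]

theorem form_velocity_comp (α : OneForm I M) {g : V → M} {γ : ℝ → V} {t : ℝ}
    (hg : MDifferentiableAt 𝓘(ℝ, V) I g (γ t)) (hγ : DifferentiableAt ℝ γ t) :
    α (g (γ t)) (velocity I (fun t => g (γ t)) t) = pullbackForm α g (γ t) (deriv γ t) := by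
  rw [velocity_comp hg hγ.mdifferentiableAt, velocity_eq_deriv]
  rfl

theorem Filter.EventuallyEq.form_velocity_eq (α : OneForm I M) {γ γ' : ℝ → M} {t : ℝ}
    (h : γ =ᶠ[𝓝 t] γ') : α (γ t) (velocity I γ t) = α (γ' t) (velocity I γ' t) := by
  have h1 : γ t = γ' t := h.self_of_nhds
  rw [velocity, velocity, h.mfderiv_eq]
  exact congrArg (fun z : M => (show E →L[ℝ] ℝ from α z)
    ((show ℝ →L[ℝ] E from mfderiv 𝓘(ℝ, ℝ) I γ' t) 1)) h1

end Velocity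

section Convergence

variable {n : ℕ} {N : Type*} [MetricSpace N] [ChartedSpace (EuclideanSpace ℝ (Fin n)) N]
  [IsManifold (𝓡 n) ∞ N]

/-- Makes bump functions on T^*N smooth when extended by zero. -/
instance : T2Space (Cotangent n N) := by
  refine ⟨fun x y hxy => ?_⟩
  by_cases h : x.proj = y.proj
  · set e := trivializationAt (EuclideanSpace ℝ (Fin n) →L[ℝ] ℝ)
      (fun q : N => TangentSpace (𝓡 n) q →L[ℝ] ℝ) x.proj
    have hx : x ∈ e.source := e.mem_source.2 (mem_baseSet_trivializationAt _ _ _)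
    have hy : y ∈ e.source := e.mem_source.2 (h ▸ mem_baseSet_trivializationAt _ _ x.proj)
    have hne : e x ≠ e y := fun he => hxy (e.injOn hx hy he)
    obtain ⟨u, v, hu, hv, hxu, hyv, huv⟩ := t2_separation hne
    refine ⟨e.source ∩ e ⁻¹' u, e.source ∩ e ⁻¹' v,
      e.toOpenPartialHomeomorph.isOpen_inter_preimage hu,
      e.toOpenPartialHomeomorph.isOpen_inter_preimage hv, ⟨hx, hxu⟩, ⟨hy, hyv⟩, ?_⟩
    exact Set.disjoint_left.2 fun z hz hz' => Set.disjoint_left.1 huv hz.2 hz'.2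
  · obtain ⟨u, v, hu, hv, hxu, hyv, huv⟩ := t2_separation h
    have hc : Continuous fun y : Cotangent n N => y.proj := contMDiff_cotProj.continuous
    exact ⟨_, _, hu.preimage hc, hv.preimage hc, hxu, hyv, huv.preimage _⟩

variable {v : ℝ → ℝ → Cotangent n N} {l : Filter ℝ} {x : ℝ → Cotangent n N}

theorem LoopTendsto.tendsto_comp (h : LoopTendsto v l x)
    (hx : ContMDiff 𝓘(ℝ, ℝ) (cotModel n) ∞ x) {F : Cotangent n N → ℝ}
    (hF : ContMDiff (cotModel n) 𝓘(ℝ, ℝ) ∞ F) (t₀ : ℝ) :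
    Tendsto (fun z : ℝ × ℝ => F (v z.1 z.2)) (l ×ˢ 𝓝 t₀) (𝓝 (F (x t₀))) := by
  have h1 := h F hF 0
  simp only [iteratedDeriv_zero] at h1
  exact tendsto_prod_of_tendstoUniformly h1 (hF.continuous.comp hx.continuous).continuousAt

theorem LoopTendsto.tendsto_deriv_comp (h : LoopTendsto v l x)
    (hx : ContMDiff 𝓘(ℝ, ℝ) (cotModel n) ∞ x) {F : Cotangent n N → ℝ}
    (hF : ContMDiff (cotModel n) 𝓘(ℝ, ℝ) ∞ F) (t₀ : ℝ) :
    Tendsto (fun z : ℝ × ℝ => deriv (fun t => F (v z.1 t)) z.2) (l ×ˢ 𝓝 t₀)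
      (𝓝 (deriv (fun t => F (x t)) t₀)) := by
  have h1 := h F hF 1
  simp only [iteratedDeriv_one] at h1
  have h2 : ContDiff ℝ ∞ (fun t => F (x t)) := (hF.comp hx).contDiff
  exact tendsto_prod_of_tendstoUniformly h1 (h2.continuous_deriv (by norm_cast)).continuousAt

/-- Convergence is tested only on globally defined functions, so the chart at `x t₀` is multiplied
by a bump function and tested coordinate by coordinate. Dividing by the bump function, which tends
to 1 along the loops, recovers the chart. -/
theorem LoopTendsto.tendsto_chart (h : LoopTendsto v l x)
    (hx : ContMDiff 𝓘(ℝ, ℝ) (cotModel n) ∞ x)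
    (hv : ∀ s, ContMDiff 𝓘(ℝ, ℝ) (cotModel n) ∞ (v s)) (t₀ : ℝ) :
    Tendsto (fun z : ℝ × ℝ => v z.1 z.2) (l ×ˢ 𝓝 t₀) (𝓝 (x t₀)) ∧
    Tendsto (fun z : ℝ × ℝ => deriv (fun t => extChartAt (cotModel n) (x t₀) (v z.1 t)) z.2)
      (l ×ˢ 𝓝 t₀) (𝓝 (deriv (fun t => extChartAt (cotModel n) (x t₀) (x t)) t₀)) := by
  set ψ := extChartAt (cotModel n) (x t₀) with hψ
  let f : SmoothBumpFunction (cotModel n) (x t₀) := Nonempty.some inferInstance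
  set m := Module.finrank ℝ (CotModelSpace n)
  let e : CotModelSpace n ≃L[ℝ] (Fin m → ℝ) :=
    (Module.finBasis ℝ (CotModelSpace n)).equivFun.toContinuousLinearEquiv
  set G : Cotangent n N → Fin m → ℝ := fun y => f y • e (ψ y) with hG
  have hGs : ContMDiff (cotModel n) 𝓘(ℝ, Fin m → ℝ) ∞ G := by
    refine f.contMDiff_smul (g := fun y => e (ψ y)) ?_
    refine e.contDiff.contMDiff.comp_contMDiffOn ?_
    exact contMDiffOn_extChartAt
  have hGi : ∀ i, ContMDiff (cotModel n) 𝓘(ℝ, ℝ) ∞ fun y => G y i := fun i =>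
    (ContinuousLinearMap.proj (R := ℝ) (φ := fun _ : Fin m => ℝ) i).contDiff.contMDiff.comp hGs
  have hf1 : f (x t₀) = 1 := f.eq_one
  have h1 : Tendsto (fun z : ℝ × ℝ => f (v z.1 z.2)) (l ×ˢ 𝓝 t₀) (𝓝 1) :=
    hf1 ▸ h.tendsto_comp hx f.contMDiff t₀
  have h2 : Tendsto (fun z : ℝ × ℝ => G (v z.1 z.2)) (l ×ˢ 𝓝 t₀) (𝓝 (G (x t₀))) :=
    tendsto_pi_nhds.2 fun i => h.tendsto_comp hx (hGi i) t₀
  have h3 : ∀ᶠ z : ℝ × ℝ in l ×ˢ 𝓝 t₀, f (v z.1 z.2) ≠ 0 :=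
    h1.eventually_ne one_ne_zero
  have hsupp : ∀ y, f y ≠ 0 → y ∈ ψ.source := fun y hy => by
    have := f.support_subset_source hy
    simpa [hψ] using this
  have h4 : Tendsto (fun z : ℝ × ℝ => ψ (v z.1 z.2)) (l ×ˢ 𝓝 t₀) (𝓝 (ψ (x t₀))) := by
    have h5 := (h1.inv₀ one_ne_zero).smul h2
    have h6 := (e.symm.continuous.tendsto _).comp h5
    have h7 : e.symm ((1 : ℝ)⁻¹ • G (x t₀)) = ψ (x t₀) := by simp [hG]
    rw [h7] at h6
    refine h6.congr' ?_
    filter_upwards [h3] with z hz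
    simp [hG, smul_smul, inv_mul_cancel₀ hz]
  have h5 : Tendsto (fun z : ℝ × ℝ => v z.1 z.2) (l ×ˢ 𝓝 t₀) (𝓝 (x t₀)) := by
    have h6 := (continuousAt_extChartAt_symm (I := cotModel n) (x t₀)).tendsto.comp h4
    rw [extChartAt_to_inv] at h6
    refine h6.congr' ?_
    filter_upwards [h3] with z hz
    exact ψ.left_inv (hsupp _ hz)
  refine ⟨h5, ?_⟩
  -- For the derivatives the bump function must equal 1 on a neighbourhood, so that its own
  -- derivative does not enter.
  have hone : ∀ᶠ y in 𝓝 (x t₀), ∀ᶠ y' in 𝓝 y, e.symm (G y') = ψ y' := by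
    filter_upwards [f.eventuallyEq_one.eventually_nhds] with y hy
    filter_upwards [hy] with y' hy'
    simp [hG, hy']
  have hderiv : ∀ γ : ℝ → Cotangent n N, ContMDiff 𝓘(ℝ, ℝ) (cotModel n) ∞ γ → ∀ t,
      (∀ᶠ y' in 𝓝 (γ t), e.symm (G y') = ψ y') →
      deriv (fun t => ψ (γ t)) t = e.symm fun i => deriv (fun t => G (γ t) i) t := by
    intro γ hγ t ht
    have e1 : (fun t => ψ (γ t)) =ᶠ[𝓝 t] fun t => e.symm (G (γ t)) := by
      filter_upwards [hγ.continuous.continuousAt.eventually ht] with t' ht'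
      exact ht'.symm
    rw [e1.deriv_eq]
    have hd : HasDerivAt (fun t => G (γ t)) (fun i => deriv (fun t => G (γ t) i) t) t :=
      hasDerivAt_pi.2 fun i =>
        ((((hGi i).comp hγ).contDiff.differentiable (by simp)) t).hasDerivAt
    exact (e.symm.hasFDerivAt.comp_hasDerivAt t hd).deriv
  rw [hderiv x hx t₀ hone.self_of_nhds]
  have h6 : Tendsto (fun z : ℝ × ℝ => e.symm fun i => deriv (fun t => G (v z.1 t) i) z.2)
      (l ×ˢ 𝓝 t₀) (𝓝 (e.symm fun i => deriv (fun t => G (x t) i) t₀)) :=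
    (e.symm.continuous.tendsto _).comp
      (tendsto_pi_nhds.2 fun i => h.tendsto_deriv_comp hx (hGi i) t₀)
  refine h6.congr' ?_
  filter_upwards [h5.eventually hone] with z hz
  exact (hderiv _ (hv z.1) z.2 hz).symm

variable {E' : Type*} [NormedAddCommGroup E'] [NormedSpace ℝ E']
  {H' : Type*} [TopologicalSpace H'] {I' : ModelWithCorners ℝ E' H'} [I'.Boundaryless]
  {M' : Type*} [TopologicalSpace M'] [ChartedSpace H' M'] [IsManifold I' ∞ M']

/-- Values of a 1-form on the velocities of converging loops converge. -/
theorem LoopTendsto.tendsto_form (h : LoopTendsto v l x)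
    (hx : ContMDiff 𝓘(ℝ, ℝ) (cotModel n) ∞ x)
    (hv : ∀ s, ContMDiff 𝓘(ℝ, ℝ) (cotModel n) ∞ (v s)) (t₀ : ℝ)
    {f : Cotangent n N → M'} (hf : ContMDiffAt (cotModel n) I' ∞ f (x t₀))
    {α : OneForm I' M'} (hα : IsChartSmoothAt α (f (x t₀))) :
    Tendsto (fun z : ℝ × ℝ => α (f (v z.1 z.2)) (velocity I' (fun t => f (v z.1 t)) z.2))
      (l ×ˢ 𝓝 t₀) (𝓝 (α (f (x t₀)) (velocity I' (fun t => f (x t)) t₀))) := by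
  set ψ := extChartAt (cotModel n) (x t₀) with hψ
  obtain ⟨h1, h2⟩ := h.tendsto_chart hx hv t₀
  set g : CotModelSpace n → M' := f ∘ ψ.symm with hg
  have hψs : ContMDiffAt 𝓘(ℝ, CotModelSpace n) (cotModel n) ∞ ψ.symm (ψ (x t₀)) :=
    (contMDiffOn_extChartAt_symm (x t₀)).contMDiffAt
      ((isOpen_extChartAt_target _).mem_nhds (mem_extChartAt_target _))
  have hgs : ContMDiffAt 𝓘(ℝ, CotModelSpace n) I' ∞ g (ψ (x t₀)) :=
    ContMDiffAt.comp_of_eq hf hψs (extChartAt_to_inv _)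
  have hg0 : g (ψ (x t₀)) = f (x t₀) := congrArg f (extChartAt_to_inv _)
  have hpb : ContinuousAt (pullbackForm α g) (ψ (x t₀)) :=
    (contDiffAt_pullbackForm (hg0.symm ▸ hα) hgs).continuousAt
  have hgd : ∀ᶠ y in 𝓝 (ψ (x t₀)), MDifferentiableAt 𝓘(ℝ, CotModelSpace n) I' g y := by
    have : ContMDiffAt 𝓘(ℝ, CotModelSpace n) I' 1 g (ψ (x t₀)) := hgs.of_le (by norm_cast)
    filter_upwards [(contMDiffAt_iff_contMDiffAt_nhds (by simp)).1 this] with y hy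
    exact hy.mdifferentiableAt (by simp)
  have hψc : ContinuousAt ψ (x t₀) := continuousAt_extChartAt _
  have hsrc : ∀ᶠ y in 𝓝 (x t₀), y ∈ ψ.source := extChartAt_source_mem_nhds _
  have hkey : ∀ γ : ℝ → Cotangent n N, ContMDiff 𝓘(ℝ, ℝ) (cotModel n) ∞ γ → ∀ t,
      γ t ∈ ψ.source → MDifferentiableAt 𝓘(ℝ, CotModelSpace n) I' g (ψ (γ t)) →
      α (f (γ t)) (velocity I' (fun t => f (γ t)) t) =
        pullbackForm α g (ψ (γ t)) (deriv (fun t => ψ (γ t)) t) := by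
    intro γ hγ t ht hgt
    have hev : (fun t => f (γ t)) =ᶠ[𝓝 t] fun t => g (ψ (γ t)) := by
      filter_upwards [hγ.continuous.continuousAt.eventually
        ((isOpen_extChartAt_source (I := cotModel n) (x t₀)).mem_nhds ht)] with t' ht'
      exact (congrArg f (ψ.left_inv ht')).symm
    rw [Filter.EventuallyEq.form_velocity_eq α hev]
    refine form_velocity_comp α (γ := fun t => ψ (γ t)) hgt ?_
    have : ContMDiffAt 𝓘(ℝ, ℝ) 𝓘(ℝ, CotModelSpace n) ∞ (fun t => ψ (γ t)) t :=
      ContMDiffAt.comp t (contMDiffAt_extChartAt' (by simpa [hψ] using ht)) (hγ t)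
    exact this.contDiffAt.differentiableAt (by simp)
  rw [hkey x hx t₀ hsrc.self_of_nhds hgd.self_of_nhds]
  have h3 : Tendsto (fun z : ℝ × ℝ => pullbackForm α g (ψ (v z.1 z.2))
      (deriv (fun t => ψ (v z.1 t)) z.2)) (l ×ˢ 𝓝 t₀)
      (𝓝 (pullbackForm α g (ψ (x t₀)) (deriv (fun t => ψ (x t)) t₀))) :=
    tendsto_functional_apply (hpb.tendsto.comp (hψc.tendsto.comp h1)) h2
  refine h3.congr' ?_
  filter_upwards [h1.eventually hsrc, (hψc.tendsto.comp h1).eventually hgd] with z hz1 hz2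
  exact (hkey _ (hv z.1) z.2 hz1 hz2).symm

end Convergence

end RFH

namespace RFH

variable {n : ℕ}
  {N : Type*} [MetricSpace N] [ChartedSpace (EuclideanSpace ℝ (Fin n)) N]
  [IsManifold (𝓡 n) ∞ N] [RiemannianBundle (fun q : N => TangentSpace (𝓡 n) q)]
  {N' : Type*} [TopologicalSpace N'] [ChartedSpace (EuclideanSpace ℝ (Fin n)) N']
  [IsManifold (𝓡 n) ∞ N'] [RiemannianBundle (fun z : N' => TangentSpace (𝓡 n) z)]
  {V : Type*} [NormedAddCommGroup V] [NormedSpace ℝ V]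
  {p : N' → N}

/-! ### Lifting to the universal cover. -/

section Lift

theorem contMDiffAt_of_comp_localDiffeo (hp : IsLocalDiffeomorph (𝓡 n) (𝓡 n) ∞ p) {F : V → N'} {y : V}
    (hF : ContinuousAt F y) (h : ContMDiffAt 𝓘(ℝ, V) (𝓡 n) ∞ (fun z => p (F z)) y) :
    ContMDiffAt 𝓘(ℝ, V) (𝓡 n) ∞ F y := by
  have h1 := (hp (F y)).localInverse_contMDiffAt.comp y h
  refine h1.congr_of_eventuallyEq ?_
  filter_upwards [hF.eventually (hp (F y)).localInverse_eventuallyEq_left] with z hz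
  exact hz.symm

theorem contMDiff_of_comp_localDiffeo (hp : IsLocalDiffeomorph (𝓡 n) (𝓡 n) ∞ p) {F : V → N'}
    (hF : Continuous F) (h : ContMDiff 𝓘(ℝ, V) (𝓡 n) ∞ (fun z => p (F z))) :
    ContMDiff 𝓘(ℝ, V) (𝓡 n) ∞ F :=
  fun y => contMDiffAt_of_comp_localDiffeo hp hF.continuousAt (h y)

end Lift

namespace IsUniversalRiemannianCover

theorem exists_lift (hp : IsUniversalRiemannianCover n p) {q : V → N} (hq : Continuous q) {z : V}
    {e : N'} (he : p e = q z) : ∃ Q : V → N', Continuous Q ∧ Q z = e ∧ ∀ y, p (Q y) = q y := by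
  obtain ⟨F, ⟨h1, h2⟩, -⟩ := hp.covering.existsUnique_continuousMap_lifts ⟨q, hq⟩ z e he
  exact ⟨F, F.continuous, h1, fun y => congrFun h2 y⟩

theorem eq_of_lift (hp : IsUniversalRiemannianCover n p) {F G : V → N'} (hF : Continuous F)
    (hG : Continuous G) (h : ∀ y, p (F y) = p (G y)) {z : V} (hz : F z = G z) : F = G :=
  hp.covering.eq_of_comp_eq hF hG (funext h) z hz

/-- The range is open because a covering map is open. It is closed because over an evenly covered
set with one empty fibre all fibres are empty. -/
theorem surjective [ConnectedSpace N] (hp : IsUniversalRiemannianCover n p) :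
    Function.Surjective p := by
  have := hp.simplyConnected
  have hne : Nonempty N' := PathConnectedSpace.nonempty
  rw [← Set.range_eq_univ]
  refine IsClopen.eq_univ ⟨⟨?_⟩, hp.covering.isOpenMap.isOpen_range⟩ (Set.range_nonempty p)
  rw [isOpen_iff_mem_nhds]
  intro x hx
  obtain ⟨-, W, hxW, hW, -, H, hH⟩ := hp.covering x
  filter_upwards [hW.mem_nhds hxW]
  rintro y hy ⟨e, rfl⟩
  exact hx ⟨_, (H ⟨e, hy⟩).2.2⟩

theorem mdifferentiableAt (hp : IsUniversalRiemannianCover n p) (z : N') :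
    MDifferentiableAt (𝓡 n) (𝓡 n) p z :=
  (hp.localDiffeo z).mdifferentiableAt (by simp)

theorem norm_velocity (hp : IsUniversalRiemannianCover n p) {γ : ℝ → N'} {t : ℝ}
    (hγ : MDifferentiableAt 𝓘(ℝ, ℝ) (𝓡 n) γ t) :
    ‖velocity (𝓡 n) (fun t => p (γ t)) t‖ = ‖velocity (𝓡 n) γ t‖ := by
  rw [velocity_comp (hp.mdifferentiableAt _) hγ, hp.isometric]

end IsUniversalRiemannianCover

section Norm

variable {θ : OneForm (𝓡 n) N'} {c : ℝ}

theorem abs_form_le (hθ : ∀ z, ‖θ z‖ ≤ c) (z : N') (u : TangentSpace (𝓡 n) z) : |θ z u| ≤ c * ‖u‖ :=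
  (ContinuousLinearMap.le_opNorm (θ z) u).trans (by gcongr; exact hθ z)

variable [IsContMDiffRiemannianBundle (𝓡 n) ∞ (EuclideanSpace ℝ (Fin n))
      (fun q : N => TangentSpace (𝓡 n) q)]

instance : IsContinuousRiemannianBundle (EuclideanSpace ℝ (Fin n))
    (fun q : N => TangentSpace (𝓡 n) q) := by
  obtain ⟨g, hg, h⟩ := IsContMDiffRiemannianBundle.exists_contMDiff (IB := 𝓡 n) (n := ∞)
    (F := EuclideanSpace ℝ (Fin n)) (E := fun q : N => TangentSpace (𝓡 n) q)
  exact ⟨g, hg.continuous, h⟩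

theorem continuous_norm_velocity {γ : ℝ → N} (hγ : ContMDiff 𝓘(ℝ, ℝ) (𝓡 n) ∞ γ) :
    Continuous fun t => ‖velocity (𝓡 n) γ t‖ := by
  have h1 : Continuous fun t : ℝ => (TotalSpace.mk' (EuclideanSpace ℝ (Fin n)) (γ t)
      (velocity (𝓡 n) γ t) : TangentBundle (𝓡 n) N) := by
    have h2 : Continuous fun t : ℝ => (⟨t, (1 : ℝ)⟩ : TangentBundle 𝓘(ℝ, ℝ) ℝ) := by
      exact (tangentBundleModelSpaceHomeomorph 𝓘(ℝ, ℝ)).symm.continuous.comp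
        (continuous_id.prodMk continuous_const)
    exact (hγ.continuous_tangentMap (by simp)).comp h2
  have h3 := h1.inner_bundle h1
  simp only [real_inner_self_eq_norm_sq] at h3
  simpa using h3.sqrt

end Norm

end RFH

/-! ### Integrals of a primitive along two lifts of one curve. -/

namespace RFH

variable {n : ℕ}
  {N : Type*} [MetricSpace N] [ChartedSpace (EuclideanSpace ℝ (Fin n)) N]
  [IsManifold (𝓡 n) ∞ N] [RiemannianBundle (fun q : N => TangentSpace (𝓡 n) q)]
  {N' : Type*} [TopologicalSpace N'] [ChartedSpace (EuclideanSpace ℝ (Fin n)) N']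
  [IsManifold (𝓡 n) ∞ N'] [RiemannianBundle (fun z : N' => TangentSpace (𝓡 n) z)]
  {p : N' → N}

/-- `lab` names the sheet of a point over `W` and `sec` inverts `p` on each sheet. The last clause
holds because the set of sheets is discrete: a continuous curve over `W` cannot change its sheet. -/
theorem exists_local_sections (hp : IsCoveringMap p) {q₀ : N} (e₀ : p ⁻¹' {q₀}) :
    ∃ W : Set N, IsOpen W ∧ q₀ ∈ W ∧ ∃ (lab : N' → p ⁻¹' {q₀}) (sec : p ⁻¹' {q₀} → N → N'),
      (∀ i, ContinuousOn (sec i) W) ∧ (∀ i, ∀ x ∈ W, p (sec i x) = x) ∧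
      (∀ z, p z ∈ W → sec (lab z) (p z) = z) ∧
      ∀ (γ : ℝ → N') (S : Set ℝ), Continuous γ → IsPreconnected S → (∀ r ∈ S, p (γ r) ∈ W) →
        ∀ r ∈ S, ∀ r' ∈ S, lab (γ r) = lab (γ r') := by
  obtain ⟨hd, W, hxW, hW, hpW, H, hH⟩ := hp q₀
  classical
  refine ⟨W, hW, hxW, fun z => if h : p z ∈ W then (H ⟨z, h⟩).2 else e₀,
    fun i x => if h : x ∈ W then (H.symm (⟨x, h⟩, i)).1 else e₀.1, fun i => ?_, fun i x hx => ?_,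
    fun z hz => ?_, fun γ S hγ hS h r hr r' hr' => ?_⟩
  · rw [continuousOn_iff_continuous_domRestrict]
    have h1 : Continuous fun x : W => (H.symm (x, i)).1 := by fun_prop
    refine h1.congr fun x => ?_
    simp [Set.domRestrict, x.2]
  · have := hH (H.symm (⟨x, hx⟩, i))
    simp only [Homeomorph.apply_symm_apply] at this
    simp only [dif_pos hx]
    exact this.symm
  · simp only [dif_pos hz]
    have h1 : (H ⟨z, hz⟩) = (⟨p z, hz⟩, (H ⟨z, hz⟩).2) := Prod.ext (Subtype.ext (hH ⟨z, hz⟩)) rfl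
    rw [← h1, Homeomorph.symm_apply_apply]
  · have h1 : ContinuousOn (fun r => if h : p (γ r) ∈ W then (H ⟨γ r, h⟩).2 else e₀) S := by
      rw [continuousOn_iff_continuous_domRestrict]
      have h2 : Continuous fun r : S => (H ⟨γ r, h r r.2⟩).2 := by fun_prop
      refine h2.congr fun x => ?_
      simp [Set.domRestrict, h x x.2]
    exact hS.constant h1 hr hr'

/-- The inverse of the preferred chart has locally bounded differential. -/
theorem exists_bound_mfderiv_extChartAt_symm [IsContMDiffRiemannianBundle (𝓡 n) ∞
      (EuclideanSpace ℝ (Fin n)) (fun q : N => TangentSpace (𝓡 n) q)] (q₀ : N) :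
    ∃ K > 0, ∀ᶠ y in 𝓝 (extChartAt (𝓡 n) q₀ q₀), ∀ a : EuclideanSpace ℝ (Fin n),
      ‖(mfderiv 𝓘(ℝ, EuclideanSpace ℝ (Fin n)) (𝓡 n) (extChartAt (𝓡 n) q₀).symm y :
        EuclideanSpace ℝ (Fin n) →L[ℝ] TangentSpace (𝓡 n) ((extChartAt (𝓡 n) q₀).symm y)) a‖ ≤ K * ‖a‖ := by
  let _ := fun x : EuclideanSpace ℝ (Fin n) => normedAddCommGroupTangentSpaceVectorSpace x
  let _ := fun x : EuclideanSpace ℝ (Fin n) => normedSpaceTangentSpaceVectorSpace x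
  obtain ⟨K, hK, h⟩ := eventually_norm_mfderivWithin_symm_extChartAt_lt (𝓡 n) q₀
  refine ⟨K, hK, ?_⟩
  simp only [ModelWithCorners.range_eq_univ, nhdsWithin_univ, mfderivWithin_univ] at h
  filter_upwards [h] with y hy a
  exact (ContinuousLinearMap.le_opNorm _ a).trans (by gcongr; exact hy.le)

/-- As `p` is isometric, a derivative bound for the projection `f` holds for the lift `g` on every
sheet, with the same constant. -/
theorem IsUniversalRiemannianCover.norm_pullbackForm_le (hp : IsUniversalRiemannianCover n p)
    {V : Type*} [NormedAddCommGroup V] [NormedSpace ℝ V]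
    {θ : OneForm (𝓡 n) N'} {c K : ℝ} (hc : 0 ≤ c) (hK : 0 ≤ K) (hθ : ∀ z, ‖θ z‖ ≤ c) {g : V → N'} {f : V → N} {y : V}
    (hg : MDifferentiableAt 𝓘(ℝ, V) (𝓡 n) g y) (hf : (fun z => p (g z)) =ᶠ[𝓝 y] f)
    (h : ∀ a : V, ‖(mfderiv 𝓘(ℝ, V) (𝓡 n) f y : V →L[ℝ] TangentSpace (𝓡 n) (f y)) a‖ ≤ K * ‖a‖) :
    ‖pullbackForm θ g y‖ ≤ c * K := by
  refine ContinuousLinearMap.opNorm_le_bound _ (by positivity) fun a => ?_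
  have h1 : mfderiv 𝓘(ℝ, V) (𝓡 n) (fun z => p (g z)) y = (mfderiv (𝓡 n) (𝓡 n) p (g y)).comp
      (mfderiv 𝓘(ℝ, V) (𝓡 n) g y) := mfderiv_comp y (hp.mdifferentiableAt _) hg
  have h2 := hf.self_of_nhds
  have h3 := hf.mfderiv_eq (I := 𝓘(ℝ, V)) (I' := 𝓡 n)
  have h4 : ‖(mfderiv 𝓘(ℝ, V) (𝓡 n) (fun z => p (g z)) y : V →L[ℝ] TangentSpace (𝓡 n) (p (g y))) a‖ ≤
      K * ‖a‖ := by
    rw [h3]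
    have := h a
    rw [← h2] at this
    exact this
  rw [h1] at h4
  have h5 := hp.isometric (g y) ((mfderiv 𝓘(ℝ, V) (𝓡 n) g y : V →L[ℝ] _) a)
  have h6 := abs_form_le hθ (g y) ((mfderiv 𝓘(ℝ, V) (𝓡 n) g y : V →L[ℝ] _) a)
  rw [Real.norm_eq_abs, mul_assoc]
  refine h6.trans (mul_le_mul_of_nonneg_left (h5.symm.le.trans h4) hc)

variable [IsContMDiffRiemannianBundle (𝓡 n) ∞
      (EuclideanSpace ℝ (Fin n)) (fun q : N => TangentSpace (𝓡 n) q)]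

/-- Two lifts of a curve that stays in a small set have almost the same integral against a bounded
primitive, however long the curve is. -/
theorem IsUniversalRiemannianCover.exists_nhds_integral_sub_le (hp : IsUniversalRiemannianCover n p)
    {ρ : BilinField (𝓡 n) N} {θ : OneForm (𝓡 n) N'} (hθ : θ ∈ primitives p ρ) {c : ℝ} (hc : 0 ≤ c)
    (hθc : ∀ z, ‖θ z‖ ≤ c) (e₀ : N') :
    ∃ V ∈ 𝓝 (p e₀), ∃ C : ℝ, ∀ γ₁ γ₂ : ℝ → N', ContMDiff 𝓘(ℝ, ℝ) (𝓡 n) ∞ γ₁ →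
      ContMDiff 𝓘(ℝ, ℝ) (𝓡 n) ∞ γ₂ → (∀ r, p (γ₁ r) = p (γ₂ r)) → ∀ a b : ℝ, a ≤ b →
      (∀ r ∈ Set.Icc a b, p (γ₁ r) ∈ V) →
      |(∫ r in a..b, θ (γ₁ r) (velocity (𝓡 n) γ₁ r)) -
        ∫ r in a..b, θ (γ₂ r) (velocity (𝓡 n) γ₂ r)| ≤ C := by
  set q₀ := p e₀ with hq₀
  obtain ⟨W, hW, hqW, lab, sec, hsec, hpsec, hlab, hconst⟩ :=
    exists_local_sections hp.covering (q₀ := q₀) ⟨e₀, rfl⟩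
  obtain ⟨K, hK, hKb⟩ := exists_bound_mfderiv_extChartAt_symm (n := n) q₀
  set φ := extChartAt (𝓡 n) q₀ with hφ
  have hsymm : ContinuousAt φ.symm (φ q₀) := continuousAt_extChartAt_symm q₀
  have hW' : ∀ᶠ y in 𝓝 (φ q₀), φ.symm y ∈ W :=
    hsymm.eventually (by rw [hφ, extChartAt_to_inv]; exact hW.mem_nhds hqW)
  obtain ⟨δ, hδ, hball⟩ := Metric.eventually_nhds_iff_ball.1
    ((hKb.and hW').and ((isOpen_extChartAt_target q₀).mem_nhds (mem_extChartAt_target q₀)))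
  set B := Metric.ball (φ q₀) δ with hB
  set g : p ⁻¹' {q₀} → EuclideanSpace ℝ (Fin n) → N' := fun i y => sec i (φ.symm y) with hg
  have hpg : ∀ i, ∀ y ∈ B, (fun y => p (g i y)) =ᶠ[𝓝 y] φ.symm := fun i y hy => by
    filter_upwards [Metric.isOpen_ball.mem_nhds hy] with z hz
    exact hpsec i _ (hball z hz).1.2
  have hφs : ∀ y ∈ B, ContMDiffAt 𝓘(ℝ, EuclideanSpace ℝ (Fin n)) (𝓡 n) ∞ φ.symm y := fun y hy =>
    (contMDiffOn_extChartAt_symm q₀).contMDiffAt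
      ((isOpen_extChartAt_target q₀).mem_nhds (hball y hy).2)
  have hgs : ∀ i, ∀ y ∈ B, ContMDiffAt 𝓘(ℝ, EuclideanSpace ℝ (Fin n)) (𝓡 n) ∞ (g i) y :=
    fun i y hy => by
    refine contMDiffAt_of_comp_localDiffeo hp.localDiffeo ?_
      ((hφs y hy).congr_of_eventuallyEq (hpg i y hy))
    exact ContinuousAt.comp (f := φ.symm) (g := sec i)
      ((hsec i).continuousAt (hW.mem_nhds (hball y hy).1.2)) (hφs y hy).continuousAt
  have hθs : ∀ z, IsChartSmoothAt θ z := hθ.1.isChartSmoothAt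
  have hfs : ∀ i, ∀ y ∈ B, DifferentiableAt ℝ (pullbackForm θ (g i)) y := fun i y hy =>
    (contDiffAt_pullbackForm (hθs _) (hgs i y hy)).differentiableAt (by simp)
  have hd : ∀ i, ∀ y ∈ B, ∀ a b, fderiv ℝ (pullbackForm θ (g i)) y a b -
      fderiv ℝ (pullbackForm θ (g i)) y b a = ρ (φ.symm y)
        (mfderiv 𝓘(ℝ, EuclideanSpace ℝ (Fin n)) (𝓡 n) φ.symm y a)
        (mfderiv 𝓘(ℝ, EuclideanSpace ℝ (Fin n)) (𝓡 n) φ.symm y b) := by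
    intro i y hy a b
    rw [fderiv_pullbackForm_sub (hθs _) (hgs i y hy), hθ.2]
    have h1 : mfderiv 𝓘(ℝ, EuclideanSpace ℝ (Fin n)) (𝓡 n) (fun z => p (g i z)) y =
      (mfderiv (𝓡 n) (𝓡 n) p (g i y)).comp (mfderiv 𝓘(ℝ, EuclideanSpace ℝ (Fin n)) (𝓡 n) (g i) y) :=
      mfderiv_comp y (hp.mdifferentiableAt _) ((hgs i y hy).mdifferentiableAt (by simp))
    have h2 : ρ (p (g i y)) (mfderiv (𝓡 n) (𝓡 n) p (g i y)
          (mfderiv 𝓘(ℝ, EuclideanSpace ℝ (Fin n)) (𝓡 n) (g i) y a)) (mfderiv (𝓡 n) (𝓡 n) p (g i y)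
          (mfderiv 𝓘(ℝ, EuclideanSpace ℝ (Fin n)) (𝓡 n) (g i) y b)) = ρ (p (g i y))
        (mfderiv 𝓘(ℝ, EuclideanSpace ℝ (Fin n)) (𝓡 n) (fun z => p (g i z)) y a)
        (mfderiv 𝓘(ℝ, EuclideanSpace ℝ (Fin n)) (𝓡 n) (fun z => p (g i z)) y b) := by
      rw [h1]; rfl
    refine h2.trans ?_
    have h3 := (hpg i y hy).mfderiv_eq (I := 𝓘(ℝ, EuclideanSpace ℝ (Fin n))) (I' := 𝓡 n)
    have h4 := (hpg i y hy).self_of_nhds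
    simp only at h4
    rw [h3]
    exact congrArg (fun x : N => (show EuclideanSpace ℝ (Fin n) →L[ℝ] EuclideanSpace ℝ (Fin n) →L[ℝ] ℝ
      from ρ x) (mfderiv 𝓘(ℝ, EuclideanSpace ℝ (Fin n)) (𝓡 n) φ.symm y a)
      (mfderiv 𝓘(ℝ, EuclideanSpace ℝ (Fin n)) (𝓡 n) φ.symm y b)) h4
  have hnorm : ∀ i, ∀ y ∈ B, ‖pullbackForm θ (g i) y‖ ≤ c * K := fun i y hy =>
    hp.norm_pullbackForm_le hc hK.le hθc ((hgs i y hy).mdifferentiableAt (by simp)) (hpg i y hy)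
      (hball y hy).1.1
  have hV : {x | x ∈ φ.source ∧ φ x ∈ B} ∈ 𝓝 q₀ := by
    filter_upwards [extChartAt_source_mem_nhds (I := 𝓡 n) q₀, (continuousAt_extChartAt (I := 𝓡 n) q₀).eventually
      (Metric.isOpen_ball.mem_nhds (Metric.mem_ball_self hδ))] with x h1 h2
    exact ⟨h1, h2⟩
  refine ⟨_, hV, (c * K + c * K) * (δ + δ), fun γ₁ γ₂ h₁ h₂ h₁₂ a b hab hin => ?_⟩
  have hdiff : DifferentiableOn ℝ
      (pullbackForm θ (g (lab (γ₁ a))) - pullbackForm θ (g (lab (γ₂ a)))) B :=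
    fun y hy => ((hfs _ y hy).sub (hfs _ y hy)).differentiableWithinAt
  -- On each sheet the pulled-back primitive has the same exterior derivative, namely `ρ` in the
  -- chart. The difference of two sheets is therefore closed, and exact on the ball.
  obtain ⟨f, hf⟩ := (convex_ball (φ q₀) δ).exists_forall_hasFDerivAt_of_fderiv_symmetric
    Metric.isOpen_ball hdiff (fun y hy u w => by
      rw [fderiv_sub (hfs _ y hy) (hfs _ y hy)]
      simp only [sub_apply]
      have e1 := hd (lab (γ₁ a)) y hy u w
      have e2 := hd (lab (γ₂ a)) y hy u w
      linarith)
  set u : ℝ → EuclideanSpace ℝ (Fin n) := fun r => φ (p (γ₁ r)) with hu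
  have hpγ : ContMDiff 𝓘(ℝ, ℝ) (𝓡 n) ∞ fun r => p (γ₁ r) :=
    hp.localDiffeo.contMDiff.comp h₁
  have hus : ∀ r ∈ Set.Icc a b, DifferentiableAt ℝ u r := fun r hr =>
    (((contMDiffAt_extChartAt' (I := 𝓡 n) (n := ∞) (by
      have := (hin r hr).1; rwa [hφ, extChartAt_source] at this)).comp r (hpγ r)).mdifferentiableAt
        (by simp)).differentiableAt
  have hform : ∀ γ : ℝ → N', ContMDiff 𝓘(ℝ, ℝ) (𝓡 n) ∞ γ → (∀ r, p (γ r) = p (γ₁ r)) →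
      ∀ r ∈ Set.Ioo a b, θ (γ r) (velocity (𝓡 n) γ r) =
        pullbackForm θ (g (lab (γ a))) (u r) (deriv u r) := by
    intro γ hγ hγp r hr
    have hW1 : ∀ r ∈ Set.Icc a b, p (γ r) ∈ W := fun r hr => by
      rw [hγp, ← φ.left_inv (hin r hr).1]
      exact (hball _ (hin r hr).2).1.2
    -- The lift stays on the sheet where it starts, so it is one section applied to the chart
    -- expression of the base curve.
    have h3 : ∀ r ∈ Set.Icc a b, γ r = g (lab (γ a)) (u r) := fun r hr => by
      rw [hg, hu]
      simp only
      rw [φ.left_inv (hin r hr).1, ← hγp, hconst γ _ hγ.continuous isPreconnected_Icc hW1 a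
        (Set.left_mem_Icc.2 hab) r hr, hlab _ (hW1 r hr)]
    have h4 : γ =ᶠ[𝓝 r] fun r => g (lab (γ a)) (u r) := by
      filter_upwards [Icc_mem_nhds hr.1 hr.2] with r' hr' using h3 r' hr'
    have hr1 := Set.Ioo_subset_Icc_self hr
    rw [Filter.EventuallyEq.form_velocity_eq θ h4, form_velocity_comp θ
      ((hgs _ _ (hin r hr1).2).mdifferentiableAt (by simp)) (hus r hr1)]
  have hderiv : ∀ r ∈ Set.Ioo a b, HasDerivAt (fun r => f (u r))
      (θ (γ₁ r) (velocity (𝓡 n) γ₁ r) - θ (γ₂ r) (velocity (𝓡 n) γ₂ r)) r := by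
    intro r hr
    have hr1 := Set.Ioo_subset_Icc_self hr
    rw [hform γ₁ h₁ (fun _ => rfl) r hr, hform γ₂ h₂ (fun r => (h₁₂ r).symm) r hr]
    exact (hf (u r) (hin r hr1).2).comp_hasDerivAt r (hus r hr1).hasDerivAt
  have hcont : ∀ γ : ℝ → N', ContMDiff 𝓘(ℝ, ℝ) (𝓡 n) ∞ γ →
      Continuous fun r => θ (γ r) (velocity (𝓡 n) γ r) := fun γ hγ => by
    have h5 : ∀ r, θ (γ r) (velocity (𝓡 n) γ r) = pullbackForm θ γ r 1 := fun r => rfl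
    simp_rw [h5]
    exact (contDiff_pullbackForm hθs hγ).continuous.clm_apply continuous_const
  rw [← intervalIntegral.integral_sub ((hcont γ₁ h₁).intervalIntegrable _ _)
    ((hcont γ₂ h₂).intervalIntegrable _ _), intervalIntegral.integral_eq_sub_of_hasDerivAt_of_le hab
    (fun r hr => ((hf (u r) (hin r hr).2).continuousAt.comp (f := u)
      (hus r hr).continuousAt).continuousWithinAt) hderiv
    (((hcont γ₁ h₁).sub (hcont γ₂ h₂)).intervalIntegrable _ _)]
  have hub := (hin b (Set.right_mem_Icc.2 hab)).2
  have hua := (hin a (Set.left_mem_Icc.2 hab)).2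
  -- The difference of the integrals is an increment of the potential `f`, which is Lipschitz with
  -- constant 2cK on a ball of diameter at most 2δ. The length of the curve plays no role.
  have h6 := (convex_ball (φ q₀) δ).norm_image_sub_le_of_norm_hasFDerivWithin_le
    (fun y hy => (hf y hy).hasFDerivWithinAt) (fun y hy =>
      (norm_sub_le _ _).trans (add_le_add (hnorm (lab (γ₁ a)) y hy) (hnorm (lab (γ₂ a)) y hy))) hua hub
  rw [Real.norm_eq_abs] at h6
  refine h6.trans (mul_le_mul_of_nonneg_left ?_ (by positivity))
  rw [← dist_eq_norm]
  exact (dist_triangle_right _ _ (φ q₀)).trans (add_le_add (Metric.mem_ball.1 hub).le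
    (Metric.mem_ball.1 hua).le)

end RFH

namespace RFH

/-! ### Integrals over several periods of a loop or a cylinder. -/

section Velocity

variable {E : Type*} [NormedAddCommGroup E] [NormedSpace ℝ E]
  {H : Type*} [TopologicalSpace H] {I : ModelWithCorners ℝ E H}
  {M : Type*} [TopologicalSpace M] [ChartedSpace H M]

theorem velocity_add_const {γ : ℝ → M} {t : ℝ} (T : ℝ) (hγ : MDifferentiableAt 𝓘(ℝ, ℝ) I γ (t + T)) :
    velocity I (fun t => γ (t + T)) t = velocity I γ (t + T) := by
  have h1 : HasFDerivAt (fun t : ℝ => t + T) (ContinuousLinearMap.id ℝ ℝ) t :=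
    (hasFDerivAt_id t).add_const T
  have h2 := HasMFDerivAt.comp (f := fun t : ℝ => t + T) t hγ.hasMFDerivAt h1.hasMFDerivAt
  rw [velocity, velocity]
  erw [h2.mfderiv]
  rfl

/-- The integral of a 1-form over a curve, from time `0` to time `R`. -/
def lineIntegral (θ : OneForm I M) (γ : ℝ → M) (R : ℝ) : ℝ :=
  ∫ t in (0 : ℝ)..R, θ (γ t) (velocity I γ t)

/-- The integral of a bilinear field over the cylinder `[r₀, r₁] × [0, 1]`. -/
def cylinderIntegral (ρ : BilinField I M) (q : ℝ × ℝ → M) (r₀ r₁ : ℝ) : ℝ :=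
  ∫ r in r₀..r₁, ∫ t in (0 : ℝ)..1, ρ (q (r, t)) (velocity I (fun r' => q (r', t)) r)
    (velocity I (fun t' => q (r, t')) t)

theorem periodic_bilin_velocity (ρ : BilinField I M) {q : ℝ × ℝ → M} (hq : ContMDiff 𝓘(ℝ, ℝ × ℝ) I ∞ q)
    (hper : ∀ r t, q (r, t + 1) = q (r, t)) (r : ℝ) :
    Function.Periodic (fun t => ρ (q (r, t)) (velocity I (fun r' => q (r', t)) r)
      (velocity I (fun t' => q (r, t')) t)) 1 := by
  intro t
  have h1 : ContMDiff 𝓘(ℝ, ℝ) I ∞ (fun t => q (r, t)) :=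
    hq.comp (contMDiff_iff_contDiff.2 (by fun_prop))
  have h2 := velocity_add_const (γ := fun t => q (r, t)) (t := t) 1
    ((h1 _).mdifferentiableAt (by simp))
  -- The tangent spaces at `q (r, t + 1)` and `q (r, t)` are different types; replacing the whole
  -- map at once moves the point and both vectors together.
  have h3 : ∀ q' : ℝ × ℝ → M, q' = q → ρ (q' (r, t)) (velocity I (fun r' => q' (r', t)) r)
      (velocity I (fun t' => q' (r, t')) t) = ρ (q (r, t)) (velocity I (fun r' => q (r', t)) r)
      (velocity I (fun t' => q (r, t')) t) := by rintro q' rfl; rfl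
  beta_reduce
  rw [← h3 (fun z => q (z.1, z.2 + 1)) (funext fun z => hper z.1 z.2)]
  rw [h2]

end Velocity

variable {n : ℕ}
  {N : Type*} [MetricSpace N] [ChartedSpace (EuclideanSpace ℝ (Fin n)) N]
  [IsManifold (𝓡 n) ∞ N] [RiemannianBundle (fun q : N => TangentSpace (𝓡 n) q)]
  [IsContMDiffRiemannianBundle (𝓡 n) ∞
      (EuclideanSpace ℝ (Fin n)) (fun q : N => TangentSpace (𝓡 n) q)]
  {N' : Type*} [TopologicalSpace N'] [ChartedSpace (EuclideanSpace ℝ (Fin n)) N']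
  [IsManifold (𝓡 n) ∞ N'] [RiemannianBundle (fun z : N' => TangentSpace (𝓡 n) z)]
  {p : N' → N} {ρ : BilinField (𝓡 n) N} {θ : OneForm (𝓡 n) N'} {c : ℝ}

variable (n) in
/-- Length of a loop, one period. -/
def loopLength (x : ℝ → N) : ℝ := ∫ t in (0 : ℝ)..1, ‖velocity (𝓡 n) x t‖

theorem continuous_form_velocity (hθ : ∀ z, IsChartSmoothAt θ z) {γ : ℝ → N'}
    (hγ : ContMDiff 𝓘(ℝ, ℝ) (𝓡 n) ∞ γ) : Continuous fun r => θ (γ r) (velocity (𝓡 n) γ r) := by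
  have h : ∀ r, θ (γ r) (velocity (𝓡 n) γ r) = pullbackForm θ γ r 1 := fun r => rfl
  simp_rw [h]
  exact (contDiff_pullbackForm hθ hγ).continuous.clm_apply continuous_const

theorem IsUniversalRiemannianCover.abs_integral_form_le (hp : IsUniversalRiemannianCover n p)
    (hθc : ∀ z, ‖θ z‖ ≤ c) {γ : ℝ → N'} (hγ : ContMDiff 𝓘(ℝ, ℝ) (𝓡 n) ∞ γ) {x : ℝ → N}
    (hx : ContMDiff 𝓘(ℝ, ℝ) (𝓡 n) ∞ x) (h : ∀ t, p (γ t) = x t) (a b : ℝ) :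
    |∫ t in a..b, θ (γ t) (velocity (𝓡 n) γ t)| ≤ |∫ t in a..b, c * ‖velocity (𝓡 n) x t‖| := by
  obtain rfl : x = fun t => p (γ t) := funext fun t => (h t).symm
  have hint : IntervalIntegrable (fun t => c * ‖velocity (𝓡 n) (fun t => p (γ t)) t‖)
      MeasureTheory.volume a b :=
    (continuous_const.mul (continuous_norm_velocity hx)).intervalIntegrable _ _
  refine intervalIntegral.norm_integral_le_abs_of_norm_le (E := ℝ) (μ := MeasureTheory.volume)
    (Eventually.of_forall fun t => ?_) hint
  rw [hp.norm_velocity ((hγ t).mdifferentiableAt (by simp))]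
  exact abs_form_le hθc _ _

theorem periodic_norm_velocity {x : ℝ → N} (hx : ContMDiff 𝓘(ℝ, ℝ) (𝓡 n) ∞ x)
    (hper : ∀ t, x (t + 1) = x t) : Function.Periodic (fun t => ‖velocity (𝓡 n) x t‖) 1 := by
  intro t
  have h1 := velocity_add_const (γ := x) (t := t) 1 ((hx _).mdifferentiableAt (by simp))
  have h2 : ∀ y : ℝ → N, y = x → ‖velocity (𝓡 n) y t‖ = ‖velocity (𝓡 n) x t‖ := by rintro y rfl; rfl
  beta_reduce
  rw [← h2 _ (funext hper), h1]

theorem integral_nat_of_periodic {f : ℝ → ℝ} (hf : Continuous f) (hper : Function.Periodic f 1)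
    (R : ℕ) : ∫ t in (0 : ℝ)..R, f t = R * ∫ t in (0 : ℝ)..1, f t := by
  have := hper.intervalIntegral_add_zsmul_eq R 0 fun _ _ => hf.intervalIntegrable _ _
  simpa using this

theorem IsUniversalRiemannianCover.abs_lineIntegral_le (hp : IsUniversalRiemannianCover n p) (hc : 0 ≤ c)
    (hθc : ∀ z, ‖θ z‖ ≤ c) {γ : ℝ → N'} (hγ : ContMDiff 𝓘(ℝ, ℝ) (𝓡 n) ∞ γ) {x : ℝ → N}
    (hx : ContMDiff 𝓘(ℝ, ℝ) (𝓡 n) ∞ x) (hper : ∀ t, x (t + 1) = x t) (h : ∀ t, p (γ t) = x t) (R : ℕ) :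
    |lineIntegral θ γ R| ≤ R * (c * loopLength n x) := by
  refine (hp.abs_integral_form_le hθc hγ hx h 0 R).trans_eq ?_
  rw [abs_of_nonneg (intervalIntegral.integral_nonneg (by positivity) fun t _ => by positivity),
    intervalIntegral.integral_const_mul,
    integral_nat_of_periodic (continuous_norm_velocity hx) (periodic_norm_velocity hx hper), loopLength]
  ring

/-- Stokes' theorem on the `R`-fold cover of a cylinder. -/
theorem nat_mul_cylinderIntegral (hp : IsUniversalRiemannianCover n p) (hθ : θ ∈ primitives p ρ)
    {Q : ℝ × ℝ → N'} (hQ : ContMDiff 𝓘(ℝ, ℝ × ℝ) (𝓡 n) ∞ Q) {q : ℝ × ℝ → N} (hQq : ∀ z, p (Q z) = q z)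
    (hper : ∀ r t, q (r, t + 1) = q (r, t)) (r₀ r₁ : ℝ) (R : ℕ) :
    R * cylinderIntegral ρ q r₀ r₁ =
      lineIntegral θ (fun t => Q (r₁, t)) R - lineIntegral θ (fun t => Q (r₀, t)) R -
        (∫ r in r₀..r₁, θ (Q (r, R)) (velocity (𝓡 n) (fun r' => Q (r', R)) r)) +
        ∫ r in r₀..r₁, θ (Q (r, 0)) (velocity (𝓡 n) (fun r' => Q (r', 0)) r) := by
  obtain rfl : q = fun z => p (Q z) := funext fun z => (hQq z).symm
  have hθs : ∀ z, IsChartSmoothAt θ z := hθ.1.isChartSmoothAt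
  have hq : ContMDiff 𝓘(ℝ, ℝ × ℝ) (𝓡 n) ∞ (fun z => p (Q z)) := hp.localDiffeo.contMDiff.comp hQ
  have hl : ∀ t, ContMDiff 𝓘(ℝ, ℝ) (𝓡 n) ∞ (fun r => Q (r, t)) := fun t =>
    hQ.comp (contMDiff_iff_contDiff.2 (by fun_prop))
  have hr : ∀ r, ContMDiff 𝓘(ℝ, ℝ) (𝓡 n) ∞ (fun t => Q (r, t)) := fun r =>
    hQ.comp (contMDiff_iff_contDiff.2 (by fun_prop))
  have h1 : ∀ r t, extDerivOne (𝓡 n) θ (Q (r, t)) (velocity (𝓡 n) (fun r' => Q (r', t)) r)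
      (velocity (𝓡 n) (fun t' => Q (r, t')) t) = ρ (p (Q (r, t)))
        (velocity (𝓡 n) (fun r' => p (Q (r', t))) r) (velocity (𝓡 n) (fun t' => p (Q (r, t'))) t) := by
    intro r t
    rw [hθ.2, velocity_comp (hp.mdifferentiableAt _) ((hl t r).mdifferentiableAt (by simp)),
      velocity_comp (hp.mdifferentiableAt _) ((hr r t).mdifferentiableAt (by simp))]
  -- Only the projection of `Q` is periodic in t, so the edges t = 0 and t = R do not cancel here.
  have h2 := integral_extDerivOne_rectangle hθs hQ r₀ r₁ 0 R
  rw [lineIntegral, lineIntegral, ← h2, cylinderIntegral, ← intervalIntegral.integral_const_mul]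
  refine intervalIntegral.integral_congr fun r _ => ?_
  have h3 := continuous_extDerivOne_velocity hθs hQ
  rw [intervalIntegral.integral_congr fun t _ => h1 r t]
  refine (integral_nat_of_periodic ?_ (periodic_bilin_velocity ρ hq hper r) R).symm
  simp_rw [← h1]
  exact h3.comp (continuous_const.prodMk continuous_id)

/-! ### The asymptotic mean of a primitive along the lifts of a loop -/

/-- The cluster values of `(1/R) ∫₀ᴿ θ` along the lifts of a loop. -/
def meanSet (p : N' → N) (θ : OneForm (𝓡 n) N') (x : ℝ → N) : Set ℝ :=
  {m | ∃ γ : ℝ → N', ContMDiff 𝓘(ℝ, ℝ) (𝓡 n) ∞ γ ∧ (∀ t, p (γ t) = x t) ∧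
    MapClusterPt m atTop fun R : ℕ => lineIntegral θ γ R / R}

/-- The asymptotic mean of `θ` along the lifts of a loop, maximized over the lifts. -/
def asymptoticMean (p : N' → N) (θ : OneForm (𝓡 n) N') (x : ℝ → N) : ℝ := sSup (meanSet p θ x)

theorem IsUniversalRiemannianCover.exists_smooth_lift (hp : IsUniversalRiemannianCover n p)
    {V : Type*} [NormedAddCommGroup V] [NormedSpace ℝ V] {q : V → N}
    (hq : ContMDiff 𝓘(ℝ, V) (𝓡 n) ∞ q) {z : V} {e : N'} (he : p e = q z) :
    ∃ Q : V → N', ContMDiff 𝓘(ℝ, V) (𝓡 n) ∞ Q ∧ Q z = e ∧ ∀ y, p (Q y) = q y := by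
  obtain ⟨Q, h1, h2, h3⟩ := hp.exists_lift hq.continuous he
  exact ⟨Q, contMDiff_of_comp_localDiffeo hp.localDiffeo h1 (hq.congr h3), h2, h3⟩

variable [ConnectedSpace N]

/-- Averages in a compact interval have a cluster value, and all cluster values stay in that
interval. No limit is needed, and bounds for every lift and every `R` pass to the mean. -/
theorem asymptoticMean_mem_Icc (hp : IsUniversalRiemannianCover n p) {x : ℝ → N}
    (hx : ContMDiff 𝓘(ℝ, ℝ) (𝓡 n) ∞ x) {l u : ℝ}
    (h : ∀ γ : ℝ → N', ContMDiff 𝓘(ℝ, ℝ) (𝓡 n) ∞ γ → (∀ t, p (γ t) = x t) → ∀ R : ℕ, 1 ≤ R →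
      R * l ≤ lineIntegral θ γ R ∧ lineIntegral θ γ R ≤ R * u) :
    (meanSet p θ x).Nonempty ∧ (meanSet p θ x ⊆ Set.Icc l u) ∧ asymptoticMean p θ x ∈ Set.Icc l u := by
  have h1 : ∀ γ : ℝ → N', ContMDiff 𝓘(ℝ, ℝ) (𝓡 n) ∞ γ → (∀ t, p (γ t) = x t) →
      ∀ᶠ R : ℕ in atTop, lineIntegral θ γ R / R ∈ Set.Icc l u := fun γ hγ hγx => by
    filter_upwards [eventually_ge_atTop 1] with R hR
    have hR' : (0 : ℝ) < R := by exact_mod_cast hR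
    obtain ⟨h2, h3⟩ := h γ hγ hγx R hR
    exact ⟨(le_div_iff₀ hR').2 (by linarith), (div_le_iff₀ hR').2 (by linarith)⟩
  have h2 : meanSet p θ x ⊆ Set.Icc l u := by
    rintro m ⟨γ, hγ, hγx, hm⟩
    by_contra hmn
    obtain ⟨R, h3, h4⟩ := ((mapClusterPt_iff_frequently.1 hm _
      (isClosed_Icc.isOpen_compl.mem_nhds hmn)).and_eventually (h1 γ hγ hγx)).exists
    exact h3 h4
  have h3 : (meanSet p θ x).Nonempty := by
    obtain ⟨e, he⟩ := hp.surjective (x 0)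
    obtain ⟨γ, hγ, -, hγx⟩ := hp.exists_smooth_lift hx he
    obtain ⟨m, -, hm⟩ := isCompact_Icc.exists_mapClusterPt_of_frequently (h1 γ hγ hγx).frequently
    exact ⟨m, γ, hγ, hγx, hm⟩
  obtain ⟨m, hm⟩ := id h3
  exact ⟨h3, h2, (h2 hm).1.trans (le_csSup ⟨u, fun y hy => (h2 hy).2⟩ hm),
    csSup_le h3 fun y hy => (h2 hy).2⟩

theorem asymptoticMean_bounds (hp : IsUniversalRiemannianCover n p) (hc : 0 ≤ c)
    (hθc : ∀ z, ‖θ z‖ ≤ c) {x : ℝ → N} (hx : ContMDiff 𝓘(ℝ, ℝ) (𝓡 n) ∞ x) (hper : ∀ t, x (t + 1) = x t) :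
    (meanSet p θ x).Nonempty ∧ (meanSet p θ x ⊆ Set.Icc (-(c * loopLength n x)) (c * loopLength n x)) ∧
      asymptoticMean p θ x ∈ Set.Icc (-(c * loopLength n x)) (c * loopLength n x) :=
  asymptoticMean_mem_Icc hp hx fun γ hγ hγx R _ => by
    have := abs_le.1 (hp.abs_lineIntegral_le hc hθc hγ hx hper hγx R)
    constructor <;> linarith

/-- After division by R the error C/R vanishes, so cluster values are translated by `g`. -/
theorem add_mem_meanSet {x y : ℝ → N} {g : ℝ}
    (h : ∀ γ : ℝ → N', ContMDiff 𝓘(ℝ, ℝ) (𝓡 n) ∞ γ → (∀ t, p (γ t) = x t) →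
      ∃ γ' : ℝ → N', ContMDiff 𝓘(ℝ, ℝ) (𝓡 n) ∞ γ' ∧ (∀ t, p (γ' t) = y t) ∧ ∃ C, ∀ R : ℕ,
        |R * g - (lineIntegral θ γ' R - lineIntegral θ γ R)| ≤ C) {m : ℝ} (hm : m ∈ meanSet p θ x) :
    m + g ∈ meanSet p θ y := by
  obtain ⟨γ, hγ, hγx, hm⟩ := hm
  obtain ⟨γ', hγ', hγy, C, hC⟩ := h γ hγ hγx
  refine ⟨γ', hγ', hγy, ?_⟩
  have h1 : Tendsto (fun R : ℕ => lineIntegral θ γ' R / R - lineIntegral θ γ R / R) atTop (𝓝 g) := by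
    rw [tendsto_iff_dist_tendsto_zero]
    have h2 : Tendsto (fun R : ℕ => C / R) atTop (𝓝 0) := tendsto_const_div_atTop_nhds_zero_nat C
    refine squeeze_zero' (Eventually.of_forall fun R => dist_nonneg) ?_ h2
    filter_upwards [eventually_ge_atTop 1] with R hR
    have hR' : (0 : ℝ) < R := by exact_mod_cast hR
    rw [Real.dist_eq, abs_sub_comm, le_div_iff₀ hR', ← abs_of_pos hR', ← abs_mul, abs_of_pos hR']
    refine le_of_eq_of_le ?_ (hC R)
    congr 1
    field_simp
  have h3 : (fun R : ℕ => lineIntegral θ γ' R / R) = fun R : ℕ => lineIntegral θ γ R / R +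
      (lineIntegral θ γ' R / R - lineIntegral θ γ R / R) := by ext R; ring
  rw [h3]
  rw [mapClusterPt_iff_frequently]
  intro S hS
  have h4 : Tendsto (fun z : ℝ × ℝ => z.1 + z.2) (𝓝 m ×ˢ 𝓝 g) (𝓝 (m + g)) := by
    rw [← nhds_prod_eq]; exact tendsto_add
  obtain ⟨A, hA, B, hB, hAB⟩ := mem_prod_iff.1 (h4 hS)
  exact ((mapClusterPt_iff_frequently.1 hm A hA).and_eventually (h1 hB)).mono fun R hR =>
    hAB (Set.mk_mem_prod hR.1 hR.2)

/-- Since the mean is a supremum over all lifts, lifts have to be matched in both directions, one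
for each inequality. -/
theorem asymptoticMean_eq_add (hp : IsUniversalRiemannianCover n p) (hc : 0 ≤ c)
    (hθc : ∀ z, ‖θ z‖ ≤ c) {x y : ℝ → N} (hx : ContMDiff 𝓘(ℝ, ℝ) (𝓡 n) ∞ x)
    (hperx : ∀ t, x (t + 1) = x t) (hy : ContMDiff 𝓘(ℝ, ℝ) (𝓡 n) ∞ y)
    (hpery : ∀ t, y (t + 1) = y t) {g : ℝ}
    (h : ∀ γ : ℝ → N', ContMDiff 𝓘(ℝ, ℝ) (𝓡 n) ∞ γ → (∀ t, p (γ t) = x t) →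
      ∃ γ' : ℝ → N', ContMDiff 𝓘(ℝ, ℝ) (𝓡 n) ∞ γ' ∧ (∀ t, p (γ' t) = y t) ∧ ∃ C, ∀ R : ℕ,
        |R * g - (lineIntegral θ γ' R - lineIntegral θ γ R)| ≤ C)
    (h' : ∀ γ' : ℝ → N', ContMDiff 𝓘(ℝ, ℝ) (𝓡 n) ∞ γ' → (∀ t, p (γ' t) = y t) →
      ∃ γ : ℝ → N', ContMDiff 𝓘(ℝ, ℝ) (𝓡 n) ∞ γ ∧ (∀ t, p (γ t) = x t) ∧ ∃ C, ∀ R : ℕ,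
        |R * g - (lineIntegral θ γ' R - lineIntegral θ γ R)| ≤ C) :
    asymptoticMean p θ y = asymptoticMean p θ x + g := by
  obtain ⟨hnx, hbx, -⟩ := asymptoticMean_bounds hp hc hθc hx hperx
  obtain ⟨hny, hby, -⟩ := asymptoticMean_bounds hp hc hθc hy hpery
  have hbx' : BddAbove (meanSet p θ x) := ⟨_, fun m hm => (hbx hm).2⟩
  have hby' : BddAbove (meanSet p θ y) := ⟨_, fun m hm => (hby hm).2⟩
  refine le_antisymm (csSup_le hny fun m hm => ?_) ?_
  · have h1 := add_mem_meanSet (x := y) (y := x) (g := -g) (fun γ hγ hγy => by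
      obtain ⟨γ', h1, h2, C, hC⟩ := h' γ hγ hγy
      refine ⟨γ', h1, h2, C, fun R => le_of_eq_of_le ?_ (hC R)⟩
      rw [← abs_neg]; congr 1; ring) hm
    have := le_csSup hbx' h1
    rw [asymptoticMean]
    linarith
  · rw [← le_sub_iff_add_le]
    refine csSup_le hnx fun m hm => ?_
    have := le_csSup hby' (add_mem_meanSet h hm)
    rw [asymptoticMean]
    linarith

/-- Both side edges of the R-fold cylinder project to the curve r ↦ q(r,0), so the Stokes defect is
at most 2c times its length for every R. This turns the mean into a primitive of the flux on the
space of loops. -/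
theorem asymptoticMean_cylinder (hp : IsUniversalRiemannianCover n p) (hθ : θ ∈ primitives p ρ)
    (hc : 0 ≤ c) (hθc : ∀ z, ‖θ z‖ ≤ c) {q : ℝ × ℝ → N} (hq : ContMDiff 𝓘(ℝ, ℝ × ℝ) (𝓡 n) ∞ q)
    (hper : ∀ r t, q (r, t + 1) = q (r, t)) (r₀ r₁ : ℝ) :
    asymptoticMean p θ (fun t => q (r₁, t)) =
      asymptoticMean p θ (fun t => q (r₀, t)) + cylinderIntegral ρ q r₀ r₁ := by
  have hl : ∀ t, ContMDiff 𝓘(ℝ, ℝ) (𝓡 n) ∞ (fun r => q (r, t)) := fun t =>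
    hq.comp (contMDiff_iff_contDiff.2 (by fun_prop))
  have hr : ∀ r, ContMDiff 𝓘(ℝ, ℝ) (𝓡 n) ∞ (fun t => q (r, t)) := fun r =>
    hq.comp (contMDiff_iff_contDiff.2 (by fun_prop))
  have hperR : ∀ r, ∀ R : ℕ, q (r, R) = q (r, 0) := fun r R => by
    induction R with
    | zero => simp
    | succ k ih => push_cast; rw [hper, ih]
  have key : ∀ Q : ℝ × ℝ → N', ContMDiff 𝓘(ℝ, ℝ × ℝ) (𝓡 n) ∞ Q → (∀ z, p (Q z) = q z) →
      ∃ C, ∀ R : ℕ, |R * cylinderIntegral ρ q r₀ r₁ - (lineIntegral θ (fun t => Q (r₁, t)) R -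
        lineIntegral θ (fun t => Q (r₀, t)) R)| ≤ C := fun Q hQ hQq => by
    have hQl : ∀ t, ContMDiff 𝓘(ℝ, ℝ) (𝓡 n) ∞ (fun r => Q (r, t)) := fun t =>
      hQ.comp (contMDiff_iff_contDiff.2 (by fun_prop))
    refine ⟨|∫ t in r₀..r₁, c * ‖velocity (𝓡 n) (fun r => q (r, 0)) t‖| +
      |∫ t in r₀..r₁, c * ‖velocity (𝓡 n) (fun r => q (r, 0)) t‖|, fun R => ?_⟩
    rw [nat_mul_cylinderIntegral hp hθ hQ hQq hper r₀ r₁ R]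
    have h1 := hp.abs_integral_form_le hθc (hQl R) (hl 0) (fun r => (hQq _).trans (hperR r R)) r₀ r₁
    have h2 := hp.abs_integral_form_le hθc (hQl 0) (hl 0) (fun r => hQq _) r₀ r₁
    rw [show ∀ a b c d : ℝ, a - b - c + d - (a - b) = d - c by intros; ring]
    exact (abs_sub _ _).trans (add_le_add h2 h1)
  refine asymptoticMean_eq_add hp hc hθc (hr r₀) (hper r₀) (hr r₁) (hper r₁) (fun γ hγ hγx => ?_)
    fun γ hγ hγx => ?_
  · obtain ⟨Q, hQ, hQ0, hQq⟩ := hp.exists_smooth_lift hq (hγx 0)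
    have h1 : (fun t => Q (r₀, t)) = γ := hp.eq_of_lift (hQ.continuous.comp (by fun_prop))
      hγ.continuous (fun t => by rw [hQq, hγx]) (z := 0) hQ0
    obtain ⟨C, hC⟩ := key Q hQ hQq
    exact ⟨fun t => Q (r₁, t), hQ.comp (contMDiff_iff_contDiff.2 (by fun_prop)), fun t => hQq _, C,
      h1 ▸ hC⟩
  · obtain ⟨Q, hQ, hQ0, hQq⟩ := hp.exists_smooth_lift hq (hγx 0)
    have h1 : (fun t => Q (r₁, t)) = γ := hp.eq_of_lift (hQ.continuous.comp (by fun_prop))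
      hγ.continuous (fun t => by rw [hQq, hγx]) (z := 0) hQ0
    obtain ⟨C, hC⟩ := key Q hQ hQq
    exact ⟨fun t => Q (r₀, t), hQ.comp (contMDiff_iff_contDiff.2 (by fun_prop)), fun t => hQq _, C,
      h1 ▸ hC⟩

end RFH

/-! ### Continuity of the asymptotic mean at the ends of the flow line. -/

namespace RFH

variable {n : ℕ}
  {N : Type*} [MetricSpace N] [ChartedSpace (EuclideanSpace ℝ (Fin n)) N]
  [IsManifold (𝓡 n) ∞ N] [RiemannianBundle (fun q : N => TangentSpace (𝓡 n) q)]
  {N' : Type*} [TopologicalSpace N'] [ChartedSpace (EuclideanSpace ℝ (Fin n)) N']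
  [IsManifold (𝓡 n) ∞ N'] [RiemannianBundle (fun z : N' => TangentSpace (𝓡 n) z)]
  {p : N' → N} {ρ : BilinField (𝓡 n) N} {θ : OneForm (𝓡 n) N'} {c : ℝ}

/-- Joint convergence at each point is locally uniform convergence, hence uniform on the compact
interval of integration. -/
theorem tendsto_intervalIntegral_of_forall_tendsto {l : Filter ℝ} [l.IsCountablyGenerated]
    {F : ℝ → ℝ → ℝ} {f : ℝ → ℝ} (hF : ∀ s, Continuous (F s)) (hf : Continuous f)
    (h : ∀ t₀, Tendsto (fun z : ℝ × ℝ => F z.1 z.2) (l ×ˢ 𝓝 t₀) (𝓝 (f t₀))) (a b : ℝ) :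
    Tendsto (fun s => ∫ t in a..b, F s t) l (𝓝 (∫ t in a..b, f t)) := by
  refine TendstoUniformlyOn.tendsto_intervalIntegral_of_continuousOn
    (Eventually.of_forall fun s => (hF s).continuousOn) ?_
  rw [← tendstoLocallyUniformlyOn_iff_tendstoUniformlyOn_of_compact isCompact_uIcc,
    tendstoLocallyUniformlyOn_iff_forall_tendsto]
  intro t₀ _
  have h1 : Tendsto (fun y : ℝ × ℝ => (f y.2, F y.1 y.2)) (l ×ˢ 𝓝[Set.uIcc a b] t₀)
      (𝓝 (f t₀, f t₀)) :=
    ((hf.tendsto t₀).comp (tendsto_snd.mono_right nhdsWithin_le_nhds)).prodMk_nhds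
      ((h t₀).mono_left (Filter.prod_mono le_rfl nhdsWithin_le_nhds))
  exact h1.mono_right (nhds_le_uniformity _)

/-- The map that equals the loop `x` for `r ≤ 0` and the loop `v (log r)` for `r > 0`. -/
def extendLoops (v : ℝ → ℝ → Cotangent n N) (x : ℝ → Cotangent n N) (z : ℝ × ℝ) : N :=
  if z.1 ≤ 0 then (x z.2).proj else (v (Real.log z.1) z.2).proj

variable {v : ℝ → ℝ → Cotangent n N} {x : ℝ → Cotangent n N}

theorem contMDiff_slice (hv : ContMDiff 𝓘(ℝ, ℝ × ℝ) (cotModel n) ∞ (fun z : ℝ × ℝ => v z.1 z.2))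
    (s : ℝ) : ContMDiff 𝓘(ℝ, ℝ) (cotModel n) ∞ (v s) :=
  hv.comp (g := fun z : ℝ × ℝ => v z.1 z.2) (f := fun t => (s, t))
    (contMDiff_iff_contDiff.2 (by fun_prop))

/-- The logarithm places s = -∞ at r = 0. The cylinder together with its limit loop is then one
continuous map on the plane and can be lifted in one piece. -/
theorem continuous_extendLoops (hv : ContMDiff 𝓘(ℝ, ℝ × ℝ) (cotModel n) ∞ (fun z : ℝ × ℝ => v z.1 z.2))
    (hx : ContMDiff 𝓘(ℝ, ℝ) (cotModel n) ∞ x) (h : LoopTendsto v atBot x) :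
    Continuous (extendLoops v x) := by
  have hproj : Continuous (fun y : Cotangent n N => y.proj) := contMDiff_cotProj.continuous
  rw [continuous_iff_continuousAt]
  rintro ⟨r, t₀⟩
  rcases lt_trichotomy r 0 with hr | rfl | hr
  · have h1 : Continuous fun z : ℝ × ℝ => (x z.2).proj :=
      hproj.comp (hx.continuous.comp continuous_snd)
    refine h1.continuousAt.congr ?_
    filter_upwards [(isOpen_Iio.preimage continuous_fst).mem_nhds hr] with z hz
    exact (if_pos (le_of_lt hz)).symm
  · rw [ContinuousAt]
    have h0 : extendLoops v x (0, t₀) = (x t₀).proj := if_pos le_rfl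
    rw [h0]
    refine Tendsto.if ?_ ?_
    · exact (hproj.comp (hx.continuous.comp continuous_snd)).continuousAt.tendsto.mono_left inf_le_left
    · have h1 := (h.tendsto_chart hx (contMDiff_slice hv) t₀).1
      have h2 : Tendsto (fun z : ℝ × ℝ => (Real.log z.1, z.2))
          (𝓝 ((0 : ℝ), t₀) ⊓ 𝓟 {z | ¬ z.1 ≤ 0}) (atBot ×ˢ 𝓝 t₀) := by
        refine Tendsto.prodMk ?_ ((continuous_snd.tendsto _).mono_left inf_le_left)
        refine Real.tendsto_log_nhdsGT_zero.comp (tendsto_nhdsWithin_iff.2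
          ⟨(continuous_fst.tendsto _).mono_left inf_le_left, ?_⟩)
        filter_upwards [mem_inf_of_right (mem_principal_self _)] with z hz
        exact not_le.1 hz
      exact (hproj.tendsto _).comp (h1.comp h2)
  · have h1 : ContinuousAt (fun z : ℝ × ℝ => (v (Real.log z.1) z.2).proj) (r, t₀) :=
      hproj.continuousAt.comp (ContinuousAt.comp (g := fun z : ℝ × ℝ => v z.1 z.2)
        (f := fun z : ℝ × ℝ => (Real.log z.1, z.2)) (x := (r, t₀)) hv.continuous.continuousAt
        ((continuousAt_fst.log (ne_of_gt (a := (r, t₀).1) hr)).prodMk continuousAt_snd))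
    refine h1.congr ?_
    filter_upwards [(isOpen_Ioi.preimage continuous_fst).mem_nhds hr] with z hz
    exact (if_neg (not_le.2 hz)).symm

/-- A local inverse of `p` near `Q (0, t₀)` carries the convergence of the loops to their lifts. The
interval [0, R] stays fixed; convergence is not claimed to be uniform in R. -/
theorem tendsto_lineIntegral_of_lift (hp : IsUniversalRiemannianCover n p)
    (hθ : ∀ z, IsChartSmoothAt θ z)
    (hv : ContMDiff 𝓘(ℝ, ℝ × ℝ) (cotModel n) ∞ (fun z : ℝ × ℝ => v z.1 z.2))
    (hx : ContMDiff 𝓘(ℝ, ℝ) (cotModel n) ∞ x) (h : LoopTendsto v atBot x) {Q : ℝ × ℝ → N'}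
    (hQ : Continuous Q) (hQp : ∀ z, p (Q z) = extendLoops v x z) :
    ContMDiff 𝓘(ℝ, ℝ × ℝ) (𝓡 n) ∞ (fun z : ℝ × ℝ => Q (Real.exp z.1, z.2)) ∧
    ContMDiff 𝓘(ℝ, ℝ) (𝓡 n) ∞ (fun t => Q (0, t)) ∧
    (∀ z : ℝ × ℝ, p (Q (Real.exp z.1, z.2)) = (v z.1 z.2).proj) ∧
    (∀ t, p (Q (0, t)) = (x t).proj) ∧
    ∀ R : ℝ, Tendsto (fun s => lineIntegral θ (fun t => Q (Real.exp s, t)) R) atBot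
      (𝓝 (lineIntegral θ (fun t => Q (0, t)) R)) := by
  have h1 : ∀ z : ℝ × ℝ, p (Q (Real.exp z.1, z.2)) = (v z.1 z.2).proj := fun z => by
    rw [hQp, extendLoops, if_neg (not_le.2 (Real.exp_pos _)), Real.log_exp]
  have h2 : ∀ t, p (Q (0, t)) = (x t).proj := fun t => by rw [hQp, extendLoops, if_pos le_rfl]
  have h3 : ContMDiff 𝓘(ℝ, ℝ × ℝ) (𝓡 n) ∞ (fun z : ℝ × ℝ => Q (Real.exp z.1, z.2)) :=
    contMDiff_of_comp_localDiffeo hp.localDiffeo (by fun_prop)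
      ((contMDiff_cotProj.comp hv).congr h1)
  have h4 : ContMDiff 𝓘(ℝ, ℝ) (𝓡 n) ∞ (fun t => Q (0, t)) :=
    contMDiff_of_comp_localDiffeo hp.localDiffeo (by fun_prop)
      ((contMDiff_cotProj.comp hx).congr h2)
  refine ⟨h3, h4, h1, h2, fun R => ?_⟩
  refine tendsto_intervalIntegral_of_forall_tendsto (fun s => ?_) (continuous_form_velocity hθ h4)
    (fun t₀ => ?_) 0 R
  · exact continuous_form_velocity hθ (h3.comp (f := fun t => (s, t))
      (contMDiff_iff_contDiff.2 (by fun_prop)))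
  have hloc := hp.localDiffeo (Q (0, t₀))
  set f : Cotangent n N → N' := fun y => hloc.localInverse y.proj with hf
  have hfs : ContMDiffAt (cotModel n) (𝓡 n) ∞ f (x t₀) :=
    ContMDiffAt.comp (x t₀) (by rw [← h2]; exact hloc.localInverse_contMDiffAt)
      (contMDiff_cotProj (x t₀))
  have h5 := h.tendsto_form hx (contMDiff_slice hv) t₀ hfs (hθ _)
  have h6 : ∀ᶠ t in 𝓝 t₀, f (x t) = Q (0, t) := by
    have h7 : ContinuousAt (fun t => Q (0, t)) t₀ := h4.continuous.continuousAt
    filter_upwards [h7.eventually hloc.localInverse_eventuallyEq_left] with t ht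
    rw [hf]
    simp only
    rw [← h2]
    exact ht
  have h8 := Filter.EventuallyEq.form_velocity_eq θ h6
  rw [h8] at h5
  refine h5.congr' ?_
  have h9 : Tendsto (fun z : ℝ × ℝ => Q (Real.exp z.1, z.2)) (atBot ×ˢ 𝓝 t₀) (𝓝 (Q (0, t₀))) :=
    (hQ.tendsto (0, t₀)).comp ((Real.tendsto_exp_atBot.comp tendsto_fst).prodMk_nhds tendsto_snd)
  filter_upwards [h9.eventually hloc.localInverse_eventuallyEq_left.eventually_nhds] with z hz
  refine Filter.EventuallyEq.form_velocity_eq θ (γ := fun t => f (v z.1 t))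
    (γ' := fun t => Q (Real.exp z.1, t)) (t := z.2) ?_
  have h10 : ContinuousAt (fun t => Q (Real.exp z.1, t)) z.2 := by fun_prop
  filter_upwards [h10.eventually hz] with t ht
  have := h1 (z.1, t)
  simp only at this
  rw [hf]
  simp only
  rw [← this]
  exact ht

/-- The approximate value `y` may depend on `ε`: this is a Cauchy criterion, and no candidate for
the limit is needed. -/
theorem exists_tendsto_of_forall_eventually {l : Filter ℝ} [l.NeBot] {G : ℝ → ℝ}
    (h : ∀ ε > 0, ∃ y, ∀ᶠ s in l, |G s - y| ≤ ε) : ∃ g, Tendsto G l (𝓝 g) := by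
  refine CompleteSpace.complete (f := map G l) (Metric.cauchy_iff.2 ⟨inferInstance, fun ε hε => ?_⟩)
  obtain ⟨y, hy⟩ := h (ε / 3) (by positivity)
  refine ⟨Metric.closedBall y (ε / 3), hy, fun a ha b hb => ?_⟩
  have := dist_triangle_right a b y
  have := Metric.mem_closedBall.1 ha
  have := Metric.mem_closedBall.1 hb
  linarith

variable [IsContMDiffRiemannianBundle (𝓡 n) ∞
      (EuclideanSpace ℝ (Fin n)) (fun q : N => TangentSpace (𝓡 n) q)] [ConnectedSpace N]

/-- The asymptotic mean is continuous at the negative end of a cylinder of loops. -/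
theorem tendsto_asymptoticMean_atBot (hp : IsUniversalRiemannianCover n p) (hθ : θ ∈ primitives p ρ)
    (hc : 0 ≤ c) (hθc : ∀ z, ‖θ z‖ ≤ c)
    (hv : ContMDiff 𝓘(ℝ, ℝ × ℝ) (cotModel n) ∞ (fun z : ℝ × ℝ => v z.1 z.2))
    (hper : ∀ s t, v s (t + 1) = v s t)
    (hx : IsLoop x) (h : LoopTendsto v atBot x) :
    Tendsto (fun s => asymptoticMean p θ (fun t => (v s t).proj)) atBot
      (𝓝 (asymptoticMean p θ (fun t => (x t).proj))) := by
  have hθs : ∀ z, IsChartSmoothAt θ z := hθ.1.isChartSmoothAt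
  set q : ℝ × ℝ → N := fun z => (v z.1 z.2).proj with hq
  have hqs : ContMDiff 𝓘(ℝ, ℝ × ℝ) (𝓡 n) ∞ q := contMDiff_cotProj.comp hv
  have hxs : ContMDiff 𝓘(ℝ, ℝ) (𝓡 n) ∞ (fun t => (x t).proj) := contMDiff_cotProj.comp hx.smooth
  have hqr : ∀ s, ContMDiff 𝓘(ℝ, ℝ) (𝓡 n) ∞ (fun t => q (s, t)) := fun s =>
    hqs.comp (contMDiff_iff_contDiff.2 (by fun_prop))
  have hqper : ∀ s t, q (s, t + 1) = q (s, t) := fun s t => by simp only [hq, hper]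
  have hqR : ∀ s, ∀ R : ℕ, q (s, R) = q (s, 0) := fun r R => by
    induction R with
    | zero => simp
    | succ k ih => push_cast; rw [hqper, ih]
  set G : ℝ → ℝ := fun s => asymptoticMean p θ (fun t => q (s, t)) with hG
  obtain ⟨e₀, he₀⟩ := hp.surjective (x 0).proj
  -- The side edges may become infinitely long as s → -∞, so bounding each by its length fails. They
  -- are two lifts of the curve s ↦ q(s,0), which ends up in `V`, so only the bounded difference
  -- matters.
  obtain ⟨V, hV, C, hC⟩ := hp.exists_nhds_integral_sub_le hθ hc hθc e₀
  rw [he₀] at hV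
  obtain ⟨s₀, hs₀⟩ : ∃ s₀, ∀ s ≤ s₀, q (s, 0) ∈ V := by
    have h1 : Tendsto (fun s => v s 0) atBot (𝓝 (x 0)) :=
      (h.tendsto_chart hx.smooth (contMDiff_slice hv) 0).1.comp
        (f := fun s : ℝ => (s, (0 : ℝ))) (tendsto_id.prodMk tendsto_const_nhds)
    have h2 : Tendsto (fun s => q (s, 0)) atBot (𝓝 (x 0).proj) :=
      (contMDiff_cotProj.continuous.tendsto _).comp h1
    exact eventually_atBot.1 (h2 hV)
  have hcont := continuous_extendLoops hv hx.smooth h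
  -- The bound `C` is uniform in the lift, in `R` and in `s`; both limits below depend on this.
  have key : ∀ Q : ℝ × ℝ → N', Continuous Q → (∀ z, p (Q z) = extendLoops v x z) → ∀ R : ℕ,
      ∀ s ≤ s₀, |R * (G s₀ - G s) - (lineIntegral θ (fun t => Q (Real.exp s₀, t)) R -
        lineIntegral θ (fun t => Q (Real.exp s, t)) R)| ≤ C := by
    intro Q hQ hQp R s hs
    obtain ⟨hQs, -, hQq, -, -⟩ := tendsto_lineIntegral_of_lift hp hθs hv hx.smooth h hQ hQp
    have h1 : G s₀ = G s + cylinderIntegral ρ q s s₀ :=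
      asymptoticMean_cylinder hp hθ hc hθc hqs hqper s s₀
    have h2 := nat_mul_cylinderIntegral hp hθ hQs (q := q) hQq hqper s s₀ R
    simp only at h2
    rw [h1, add_sub_cancel_left, h2]
    have hl : ∀ t, ContMDiff 𝓘(ℝ, ℝ) (𝓡 n) ∞ (fun r => Q (Real.exp r, t)) := fun t =>
      hQs.comp (f := fun r => (r, t)) (contMDiff_iff_contDiff.2 (by fun_prop))
    have h3 := hC _ _ (hl 0) (hl R) (fun r => ((hQq (r, 0)).trans (hqR r R).symm).trans
      (hQq (r, R)).symm) s s₀ hs (fun r hr => by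
        rw [hQq (r, 0)]; exact hs₀ r hr.2)
    rw [show ∀ a b c d : ℝ, a - b - c + d - (a - b) = d - c by intros; ring]
    exact h3
  obtain ⟨g, hg⟩ : ∃ g, Tendsto G atBot (𝓝 g) := by
    refine exists_tendsto_of_forall_eventually fun ε hε => ?_
    obtain ⟨Q, hQ, -, hQp⟩ := hp.exists_lift hcont (z := ((0 : ℝ), (0 : ℝ))) (e := e₀)
      (by rw [he₀, extendLoops, if_pos le_rfl])
    obtain ⟨-, -, -, -, hlim⟩ := tendsto_lineIntegral_of_lift hp hθs hv hx.smooth h hQ hQp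
    obtain ⟨R, hR⟩ := exists_nat_gt ((C + 1) / ε)
    obtain ⟨R, hR, hR0⟩ : ∃ R : ℕ, (C + 1) / ε < R ∧ (0 : ℝ) < R :=
      ⟨R + 1, by push_cast; linarith, by positivity⟩
    -- The value that `key` predicts at s = -∞ for this fixed `R`. The error is at most (C + 1)/R <
    -- ε, where the 1 allows for the convergence of the line integral.
    refine ⟨G s₀ - (lineIntegral θ (fun t => Q (Real.exp s₀, t)) R -
      lineIntegral θ (fun t => Q (0, t)) R) / R, ?_⟩
    filter_upwards [eventually_le_atBot s₀, Metric.tendsto_nhds.1 (hlim R) 1 one_pos] with s hs hd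
    have h1 := key Q hQ hQp R s hs
    rw [Real.dist_eq] at hd
    rw [div_lt_iff₀ hε] at hR
    have h2 : |R * (G s - (G s₀ - (lineIntegral θ (fun t => Q (Real.exp s₀, t)) R -
      lineIntegral θ (fun t => Q (0, t)) R) / R))| ≤ C + 1 := by
      rw [show R * (G s - (G s₀ - (lineIntegral θ (fun t => Q (Real.exp s₀, t)) R -
        lineIntegral θ (fun t => Q (0, t)) R) / R)) = -(R * (G s₀ - G s) -
        (lineIntegral θ (fun t => Q (Real.exp s₀, t)) R -
        lineIntegral θ (fun t => Q (Real.exp s, t)) R)) +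
        (lineIntegral θ (fun t => Q (Real.exp s, t)) R - lineIntegral θ (fun t => Q (0, t)) R) by
          field_simp; ring]
      refine (abs_add_le _ _).trans ?_
      rw [abs_neg]
      linarith
    rw [abs_mul, abs_of_pos hR0] at h2
    nlinarith
  -- The limit s → -∞ of `key`, with `R` fixed. It compares the lifts of `x` with those of the loop
  -- at `s₀`, which identifies `g` as the mean of `x`.
  have key' : ∀ Q : ℝ × ℝ → N', Continuous Q → (∀ z, p (Q z) = extendLoops v x z) → ∀ R : ℕ,
      |R * (g - G s₀) - (lineIntegral θ (fun t => Q (0, t)) R -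
        lineIntegral θ (fun t => Q (Real.exp s₀, t)) R)| ≤ C := by
    intro Q hQ hQp R
    obtain ⟨-, -, -, -, hlim⟩ := tendsto_lineIntegral_of_lift hp hθs hv hx.smooth h hQ hQp
    have h1 := (((tendsto_const_nhds (x := G s₀)).sub hg).const_mul (R : ℝ)).sub
      ((tendsto_const_nhds (x := lineIntegral θ (fun t => Q (Real.exp s₀, t)) R)).sub (hlim R))
    have h2 := le_of_tendsto h1.abs ((eventually_le_atBot s₀).mono fun s hs => key Q hQ hQp R s hs)
    rw [← abs_neg]
    refine le_of_eq_of_le ?_ h2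
    congr 1
    ring
  have h1 : asymptoticMean p θ (fun t => (x t).proj) = G s₀ + (g - G s₀) := by
    refine asymptoticMean_eq_add hp hc hθc (hqr s₀) (hqper s₀) hxs (fun t => by rw [hx.periodic])
      (fun γ hγ hγx => ?_) fun γ hγ hγx => ?_
    · obtain ⟨Q, hQ, hQ0, hQp⟩ := hp.exists_lift hcont (z := (Real.exp s₀, (0 : ℝ))) (e := γ 0)
        (by rw [hγx, extendLoops, if_neg (not_le.2 (Real.exp_pos _)), Real.log_exp])
      obtain ⟨-, hX, hQq, hXx, -⟩ := tendsto_lineIntegral_of_lift hp hθs hv hx.smooth h hQ hQp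
      have h1 : (fun t => Q (Real.exp s₀, t)) = γ := hp.eq_of_lift (hQ.comp (by fun_prop))
        hγ.continuous (fun t => by rw [hQq (s₀, t), hγx]) (z := 0) hQ0
      exact ⟨_, hX, hXx, C, h1 ▸ key' Q hQ hQp⟩
    · obtain ⟨Q, hQ, hQ0, hQp⟩ := hp.exists_lift hcont (z := ((0 : ℝ), (0 : ℝ))) (e := γ 0)
        (by rw [hγx, extendLoops, if_pos le_rfl])
      obtain ⟨hQs, -, hQq, hXx, -⟩ := tendsto_lineIntegral_of_lift hp hθs hv hx.smooth h hQ hQp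
      have h1 : (fun t => Q (0, t)) = γ := hp.eq_of_lift (hQ.comp (by fun_prop))
        hγ.continuous (fun t => by rw [hXx, hγx]) (z := 0) hQ0
      exact ⟨fun t => Q (Real.exp s₀, t), hQs.comp (f := fun t => (s₀, t))
        (contMDiff_iff_contDiff.2 (by fun_prop)), fun t => hQq (s₀, t), C, h1 ▸ key' Q hQ hQp⟩
  rw [h1, add_sub_cancel]
  exact hg

theorem tendsto_asymptoticMean_atTop (hp : IsUniversalRiemannianCover n p) (hθ : θ ∈ primitives p ρ)
    (hc : 0 ≤ c) (hθc : ∀ z, ‖θ z‖ ≤ c)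
    (hv : ContMDiff 𝓘(ℝ, ℝ × ℝ) (cotModel n) ∞ (fun z : ℝ × ℝ => v z.1 z.2))
    (hper : ∀ s t, v s (t + 1) = v s t)
    (hx : IsLoop x) (h : LoopTendsto v atTop x) :
    Tendsto (fun s => asymptoticMean p θ (fun t => (v s t).proj)) atTop
      (𝓝 (asymptoticMean p θ (fun t => (x t).proj))) := by
  have h1 : LoopTendsto (fun s => v (-s)) atBot x := fun F hF m u hu =>
    tendsto_neg_atBot_atTop.eventually (h F hF m u hu)
  have h2 : ContMDiff 𝓘(ℝ, ℝ × ℝ) (cotModel n) ∞ (fun z : ℝ × ℝ => v (-z.1) z.2) :=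
    hv.comp (f := fun z : ℝ × ℝ => (-z.1, z.2)) (contMDiff_iff_contDiff.2 (by fun_prop))
  have h3 := tendsto_asymptoticMean_atBot hp hθ hc hθc (v := fun s => v (-s)) h2
    (fun s => hper (-s)) hx h1
  simpa [Function.comp_def] using h3.comp tendsto_neg_atTop_atBot

end RFH

/-! ### The bootstrap for real functions. -/

namespace RFH

/-- The bootstrap at the heart of the action comparison, for real functions: `S` is the action along
a flow line, `e` the energy density, `η` the multiplier and `F` the flux of the perturbation. -/
theorem exists_action_comparison_constant {A C ε : ℝ} (hA : 0 < A) (hC : 0 < C) (hε : 0 < ε) :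
    ∃ D : ℝ, 0 < D ∧ ∀ δ : ℝ, 0 ≤ δ → δ * D < 1 → ∀ (β S η e F : ℝ → ℝ) (a b : ℝ), IsCutoff β →
      (∀ s, HasDerivAt S (e s + deriv β s * F s) s) → Continuous e → Continuous F → (∀ s, 0 ≤ e s) →
      Tendsto S atBot (𝓝 a) → Tendsto S atTop (𝓝 b) → ContDiff ℝ 1 η →
      (∀ s, |deriv η s| ≤ 1 + e s) → (∀ s, e s ≤ ε → |η s| ≤ C * (|S s| + 1)) →
      (∀ s, |F s| ≤ δ * (A * (|η s| + e s + 1))) →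
      (1 / 9 ≤ a → a / 2 ≤ b) ∧ (b ≤ -(1 / 9) → a ≤ b / 2) := by
  -- In terms of K below: |S| + 1 ≤ 8K + 18K gives 26; energy, flux and the two constants 1, each at
  -- most 18K, give 1 + 18 + 1 + 18 = 38; the factor 2 is the bound on β'.
  refine ⟨2 * A * (26 * C + 1 / ε + 38), by positivity, ?_⟩
  intro δ hδ hδD β S η e F a b hβ hS he hF he0 hSa hSb hη hη' hηS hFb
  have hβc : Continuous (deriv β) := hβ.smooth.continuous_deriv (by simp)
  have hβF : Continuous fun s => deriv β s * F s := hβc.mul hF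
  set P : ℝ → ℝ := fun s => ∫ r in (0 : ℝ)..s, deriv β r * F r with hP
  have hPd : ∀ s, HasDerivAt P (deriv β s * F s) s := fun s =>
    intervalIntegral.integral_hasDerivAt_right (hβF.intervalIntegrable _ _)
      (hβF.stronglyMeasurableAtFilter _ _) hβF.continuousAt
  have hβ0 : ∀ s, s ≤ 0 → deriv β s = 0 := fun s hs => by
    refine IsLocalMin.deriv_eq_zero (Eventually.of_forall fun r => ?_)
    rw [hβ.eq_zero s hs]
    exact (hβ.mem r).1
  have hβ1 : ∀ s, 1 ≤ s → deriv β s = 0 := fun s hs => by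
    refine IsLocalMax.deriv_eq_zero (Eventually.of_forall fun r => ?_)
    rw [hβ.eq_one s hs]
    exact (hβ.mem r).2
  -- Since β' ≤ 2 and β' vanishes outside [0,1], `K` bounds every loss of action caused by the
  -- perturbation.
  set K : ℝ := 2 * ∫ s in (0 : ℝ)..1, |F s| with hK
  have hK0 : 0 ≤ K := by
    have := intervalIntegral.integral_nonneg (f := fun s => |F s|) (μ := MeasureTheory.volume)
      (zero_le_one' ℝ) fun s _ => abs_nonneg _
    positivity
  have hP0 : ∀ s, s ≤ 0 → P s = 0 := fun s hs => by
    rw [hP]; simp only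
    rw [intervalIntegral.integral_congr (g := fun _ => 0) fun r hr => ?_]
    · simp
    · rw [Set.uIcc_of_ge hs] at hr
      simp only
      rw [hβ0 r hr.2, zero_mul]
  have hP1 : ∀ s, 1 ≤ s → P s = P 1 := fun s hs => by
    rw [hP]; simp only
    rw [← intervalIntegral.integral_add_adjacent_intervals (b := 1) (hβF.intervalIntegrable _ _)
      (hβF.intervalIntegrable _ _), add_eq_left,
      intervalIntegral.integral_congr (g := fun _ => 0) fun r hr => ?_]
    · simp
    · rw [Set.uIcc_of_le hs] at hr
      simp only
      rw [hβ1 r hr.1, zero_mul]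
  have hPK' : ∀ s ∈ Set.Icc (0 : ℝ) 1, |P s| ≤ K := fun s hs => by
    have h0 : ∀ r, ‖deriv β r * F r‖ ≤ 2 * |F r| := fun r => by
      rw [Real.norm_eq_abs, abs_mul, abs_of_nonneg (hβ.deriv_mem r).1]
      exact mul_le_mul_of_nonneg_right (hβ.deriv_mem r).2 (abs_nonneg _)
    have hi : IntervalIntegrable (fun r => 2 * |F r|) MeasureTheory.volume 0 s :=
      (continuous_const.mul hF.abs).intervalIntegrable _ _
    have h1 : |P s| ≤ ∫ r in (0 : ℝ)..s, 2 * |F r| :=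
      intervalIntegral.norm_integral_le_of_norm_le hs.1 (Eventually.of_forall fun r _ => h0 r) hi
    refine h1.trans ?_
    rw [intervalIntegral.integral_const_mul]
    refine mul_le_mul_of_nonneg_left ?_ zero_le_two
    exact intervalIntegral.integral_mono_interval le_rfl hs.1 hs.2
      (Eventually.of_forall fun r => abs_nonneg _) (hF.abs.intervalIntegrable _ _)
  have hPK : ∀ s, |P s| ≤ K := fun s => by
    rcases le_total s 0 with h | h
    · rw [hP0 s h, abs_zero]; exact hK0
    rcases le_total s 1 with h' | h'
    · exact hPK' s ⟨h, h'⟩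
    · rw [hP1 s h']; exact hPK' 1 (by simp)
  -- Removing the perturbation leaves a monotone function with derivative `e`; its limits bound the
  -- total energy by b - a + K.
  set G : ℝ → ℝ := fun s => S s - P s with hG
  have hGd : ∀ s, HasDerivAt G (e s) s := fun s => by
    have := (hS s).sub (hPd s)
    rwa [add_sub_cancel_right] at this
  have hGmono : Monotone G := monotone_of_hasDerivAt_nonneg hGd he0
  have hGa : Tendsto G atBot (𝓝 a) := hSa.congr' (by
    filter_upwards [eventually_le_atBot 0] with s hs; rw [hG]; simp only; rw [hP0 s hs, sub_zero])
  have hGb : Tendsto G atTop (𝓝 (b - P 1)) := (hSb.sub_const (P 1)).congr' (by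
    filter_upwards [eventually_ge_atTop 1] with s hs; rw [hG]; simp only; rw [hP1 s hs])
  have hGa' : ∀ s, a ≤ G s := fun s => hGmono.le_of_tendsto hGa s
  have hGb' : ∀ s, G s ≤ b - P 1 := fun s => hGmono.ge_of_tendsto hGb s
  have hint : ∀ s₀ s₁, ∫ s in s₀..s₁, e s = G s₁ - G s₀ := fun s₀ s₁ =>
    intervalIntegral.integral_eq_sub_of_hasDerivAt (fun s _ => hGd s) (he.intervalIntegrable _ _)
  have hPK1 := abs_le.1 (hPK 1)
  have hen : ∀ s₀ s₁, ∫ s in s₀..s₁, e s ≤ b - a + K := fun s₀ s₁ => by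
    rw [hint]; linarith [hGa' s₀, hGb' s₁]
  have hab : a - b ≤ K := by linarith [hGa' 0, hGb' 0]
  have hSM : ∀ s, |S s| ≤ |a| + |b| + 2 * K := fun s => by
    have h1 := abs_le.1 (hPK s)
    have h2 := hGa' s
    have h3 := hGb' s
    simp only [hG] at h2 h3
    have := abs_le.1 (le_refl |a|)
    have := abs_le.1 (le_refl |b|)
    rw [abs_le]; constructor <;> linarith [abs_nonneg a, abs_nonneg b]
  -- Either claim, if false, leads here. In the first case a/2 < a - b ≤ K, so a < 2K and |b| ≤ a +
  -- K, while a ≥ 1/9 gives 1 ≤ 18K.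
  have main : b - a < 0 → |a| + |b| ≤ 6 * K → 1 ≤ 18 * K → False := by
    intro hba hKab hK18
    have hKpos : 0 < K := by linarith
    have hηb : ∀ s ∈ Set.Icc (0 : ℝ) 1, |η s| ≤ (26 * C + 1 / ε + 19) * K := by
      intro s hs
      -- Total energy is at most K, while e > ε on an interval of length T would give at least Tε =
      -- K + ε.
      set T : ℝ := K / ε + 1 with hT
      have hTpos : 0 < T := by positivity
      obtain ⟨s', hs', hes'⟩ : ∃ s' ∈ Set.Icc (s - T) s, e s' ≤ ε := by
        by_contra! hcon
        have h1 : ∫ r in (s - T)..s, ε ≤ ∫ r in (s - T)..s, e r :=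
          intervalIntegral.integral_mono_on (by linarith) (by simp) (he.intervalIntegrable _ _)
            fun r hr => (hcon r hr).le
        rw [intervalIntegral.integral_const, smul_eq_mul] at h1
        have h2 := hen (s - T) s
        have h3 : T * ε = K + ε := by rw [hT]; field_simp
        nlinarith
      have h1 := hηS s' hes'
      have h2 : |η s - η s'| ≤ ∫ r in s'..s, (1 + e r) := by
        rw [← intervalIntegral.integral_deriv_eq_sub' η rfl
          (fun r _ => hη.differentiable (by simp) r)
          (hη.continuous_deriv (by simp)).continuousOn]
        have hi : IntervalIntegrable (fun r => 1 + e r) MeasureTheory.volume s' s :=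
          (continuous_const.add he).intervalIntegrable _ _
        exact intervalIntegral.norm_integral_le_of_norm_le (f := deriv η) hs'.2
          (Eventually.of_forall fun r _ => hη' r) hi
      rw [intervalIntegral.integral_add (by simp) (he.intervalIntegrable _ _),
        intervalIntegral.integral_const, smul_eq_mul, mul_one] at h2
      have h3 := hen s' s
      have h4 := hSM s'
      have h5 : |η s| ≤ |η s'| + |η s - η s'| := by
        have := abs_add_le (η s') (η s - η s'); rwa [add_sub_cancel] at this
      have h6 : C * (|S s'| + 1) ≤ C * (26 * K) := by gcongr; linarith
      have h7 : K / ε = 1 / ε * K := by ring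
      have h8 := hs'.1
      rw [hT] at h8
      nlinarith
    have h1 : ∫ s in (0 : ℝ)..1, |F s| ≤
        ∫ s in (0 : ℝ)..1, δ * (A * ((26 * C + 1 / ε + 19) * K + e s + 1)) := by
      refine intervalIntegral.integral_mono_on zero_le_one (hF.abs.intervalIntegrable _ _)
        (Continuous.intervalIntegrable (by fun_prop) _ _) fun s hs => (hFb s).trans ?_
      gcongr
      exact hηb s hs
    rw [intervalIntegral.integral_const_mul, intervalIntegral.integral_const_mul,
      intervalIntegral.integral_add (Continuous.intervalIntegrable (by fun_prop) _ _) (by simp),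
      intervalIntegral.integral_add (by simp) (he.intervalIntegrable _ _)] at h1
    simp only [intervalIntegral.integral_const, smul_eq_mul, sub_zero, one_mul] at h1
    have h2 := hen 0 1
    have h3 : δ * (A * ((26 * C + 1 / ε + 19) * K + (∫ s in (0 : ℝ)..1, e s) + 1)) ≤
        δ * (A * ((26 * C + 1 / ε + 38) * K)) := by
      gcongr
      linarith
    -- `K` is bounded by itself times δD < 1, which contradicts K > 0.
    have h4 : K ≤ δ * (2 * A * (26 * C + 1 / ε + 38)) * K := by
      rw [hK] at *
      linarith
    nlinarith
  constructor
  · intro ha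
    by_contra! hb
    refine main (by linarith) ?_ (by linarith)
    rw [abs_of_nonneg (by linarith : (0 : ℝ) ≤ a)]
    have : |b| ≤ a + K := abs_le.2 ⟨by linarith, by linarith⟩
    linarith
  · intro hb
    by_contra! ha
    refine main (by linarith) ?_ (by linarith)
    rw [abs_of_nonpos (by linarith : b ≤ 0)]
    have : |a| ≤ -b + K := abs_le.2 ⟨by linarith, by linarith⟩
    linarith

end RFH

namespace RFH

/-! ### Derivatives of integrals along a family of loops. -/

section Calculus

/-- Stokes' theorem supplies increments over finite cylinders; this converts them into derivatives
without differentiating under an integral. -/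
theorem hasDerivAt_of_integral_eq_sub {D G : ℝ → ℝ} (hD : Continuous D)
    (h : ∀ a b, ∫ r in a..b, D r = G b - G a) (s : ℝ) : HasDerivAt G (D s) s := by
  have h1 : HasDerivAt (fun s => ∫ r in (0 : ℝ)..s, D r) (D s) s :=
    intervalIntegral.integral_hasDerivAt_right (hD.intervalIntegrable _ _)
      (hD.stronglyMeasurableAtFilter _ _) hD.continuousAt
  have h2 : G = fun s => G 0 + ∫ r in (0 : ℝ)..s, D r := by
    ext s; rw [h]; ring
  rw [h2]
  exact h1.const_add (G 0)

theorem continuous_integral_unit {f : ℝ × ℝ → ℝ} (hf : Continuous f) :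
    Continuous fun s => ∫ t in (0 : ℝ)..1, f (s, t) :=
  intervalIntegral.continuous_parametric_intervalIntegral_of_continuous'
    (f := fun s t => f (s, t)) (by simpa [Function.uncurry_def] using hf) 0 1

variable {E : Type*} [NormedAddCommGroup E] [NormedSpace ℝ E]
  {H : Type*} [TopologicalSpace H] {I : ModelWithCorners ℝ E H} [I.Boundaryless]
  {M : Type*} [TopologicalSpace M] [ChartedSpace H M] [IsManifold I ∞ M]
  {α : OneForm I M} {g : ℝ × ℝ → M}

theorem integral_extDerivOne_cylinder (hα : ∀ x, IsChartSmoothAt α x)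
    (hg : ContMDiff 𝓘(ℝ, ℝ × ℝ) I ∞ g) (hper : ∀ s t, g (s, t + 1) = g (s, t)) (a b : ℝ) :
    (∫ s in a..b, ∫ t in (0 : ℝ)..1, extDerivOne I α (g (s, t)) (velocity I (fun s' => g (s', t)) s)
        (velocity I (fun t' => g (s, t')) t)) =
      lineIntegral α (fun t => g (b, t)) 1 - lineIntegral α (fun t => g (a, t)) 1 := by
  rw [integral_extDerivOne_rectangle hα hg, lineIntegral, lineIntegral]
  have h0 : ∀ s, g (s, 1) = g (s, 0) := fun s => by rw [← hper s 0, zero_add]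
  have h1 : ∀ s, α (g (s, 1)) (velocity I (fun s' => g (s', 1)) s) =
      α (g (s, 0)) (velocity I (fun s' => g (s', 0)) s) := fun s =>
    Filter.EventuallyEq.form_velocity_eq α (γ := fun s => g (s, 1)) (γ' := fun s => g (s, 0))
      (Eventually.of_forall h0)
  simp_rw [h1]
  ring

theorem hasDerivAt_lineIntegral (hα : ∀ x, IsChartSmoothAt α x)
    (hg : ContMDiff 𝓘(ℝ, ℝ × ℝ) I ∞ g) (hper : ∀ s t, g (s, t + 1) = g (s, t)) (s : ℝ) :
    HasDerivAt (fun s => lineIntegral α (fun t => g (s, t)) 1)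
      (∫ t in (0 : ℝ)..1, extDerivOne I α (g (s, t)) (velocity I (fun s' => g (s', t)) s)
        (velocity I (fun t' => g (s, t')) t)) s :=
  hasDerivAt_of_integral_eq_sub (continuous_integral_unit (continuous_extDerivOne_velocity hα hg))
    (integral_extDerivOne_cylinder hα hg hper) s

theorem continuous_mfderiv_velocity {f : M → ℝ} (hf : ContMDiff I 𝓘(ℝ, ℝ) ∞ f)
    (hg : ContMDiff 𝓘(ℝ, ℝ × ℝ) I ∞ g) : Continuous fun z : ℝ × ℝ =>
      (mfderiv I 𝓘(ℝ, ℝ) f (g z) (velocity I (fun s' => g (s', z.2)) z.1) : ℝ) := by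
  have h1 : ContDiff ℝ ∞ fun z => f (g z) := (hf.comp hg).contDiff
  have h2 : ∀ z : ℝ × ℝ, (mfderiv I 𝓘(ℝ, ℝ) f (g z) (velocity I (fun s' => g (s', z.2)) z.1) : ℝ) =
      fderiv ℝ (fun z => f (g z)) z (1, 0) := by
    rintro ⟨s, t⟩
    have h3 := hasDerivAt_comp_velocity (F := f) (γ := fun s' => g (s', t)) (t := s)
      ((hf _).mdifferentiableAt (by simp)) (((hg.comp (f := fun s' => (s', t))
        (contMDiff_iff_contDiff.2 (by fun_prop))) s).mdifferentiableAt (by simp))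
    have h4 : HasDerivAt (fun s' => f (g (s', t))) (fderiv ℝ (fun z => f (g z)) (s, t) (1, 0)) s :=
      HasFDerivAt.comp_hasDerivAt (f := fun s' : ℝ => (s', t)) s
        (h1.differentiable (by simp) (s, t)).hasFDerivAt
        ((hasDerivAt_id s).prodMk (hasDerivAt_const s t))
    exact h3.unique h4
  simp_rw [h2]
  exact (h1.continuous_fderiv (by simp)).clm_apply continuous_const

theorem hasDerivAt_integral_comp {f : M → ℝ} (hf : ContMDiff I 𝓘(ℝ, ℝ) ∞ f)
    (hg : ContMDiff 𝓘(ℝ, ℝ × ℝ) I ∞ g) (s : ℝ) :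
    HasDerivAt (fun s => ∫ t in (0 : ℝ)..1, f (g (s, t)))
      (∫ t in (0 : ℝ)..1, (mfderiv I 𝓘(ℝ, ℝ) f (g (s, t)) (velocity I (fun s' => g (s', t)) s) : ℝ)) s := by
  have hc := continuous_mfderiv_velocity hf hg
  have h1 : ContDiff ℝ ∞ fun z => f (g z) := (hf.comp hg).contDiff
  have h3 : ∀ s t, HasDerivAt (fun s' => f (g (s', t)))
      (mfderiv I 𝓘(ℝ, ℝ) f (g (s, t)) (velocity I (fun s' => g (s', t)) s) : ℝ) s := fun s t =>
    hasDerivAt_comp_velocity (F := f) (γ := fun s' => g (s', t)) (t := s)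
      ((hf _).mdifferentiableAt (by simp)) (((hg.comp (f := fun s' => (s', t))
        (contMDiff_iff_contDiff.2 (by fun_prop))) s).mdifferentiableAt (by simp))
  refine hasDerivAt_of_integral_eq_sub (continuous_integral_unit hc) (fun a b => ?_) s
  have hint : MeasureTheory.IntegrableOn (Function.uncurry fun s t : ℝ =>
      (mfderiv I 𝓘(ℝ, ℝ) f (g (s, t)) (velocity I (fun s' => g (s', t)) s) : ℝ))
      (Set.uIoc a b ×ˢ Set.uIoc 0 1) :=
    (hc.continuousOn.integrableOn_compact (isCompact_uIcc.prod isCompact_uIcc)).mono_set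
      (Set.prod_mono Set.uIoc_subset_uIcc Set.uIoc_subset_uIcc)
  rw [MeasureTheory.intervalIntegral_intervalIntegral_swap hint, ← intervalIntegral.integral_sub]
  · refine intervalIntegral.integral_congr fun t _ => ?_
    exact intervalIntegral.integral_eq_sub_of_hasDerivAt (fun s _ => h3 s t)
      ((hc.comp (f := fun s => (s, t)) (by fun_prop)).intervalIntegrable _ _)
  · exact (h1.continuous.comp (f := fun t => (b, t)) (by fun_prop)).intervalIntegrable _ _
  · exact (h1.continuous.comp (f := fun t => (a, t)) (by fun_prop)).intervalIntegrable _ _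

end Calculus

section Cover

variable {n : ℕ}
  {N : Type*} [MetricSpace N] [ChartedSpace (EuclideanSpace ℝ (Fin n)) N]
  [IsManifold (𝓡 n) ∞ N] [RiemannianBundle (fun q : N => TangentSpace (𝓡 n) q)]
  [IsContMDiffRiemannianBundle (𝓡 n) ∞
      (EuclideanSpace ℝ (Fin n)) (fun q : N => TangentSpace (𝓡 n) q)] [ConnectedSpace N]
  {N' : Type*} [TopologicalSpace N'] [ChartedSpace (EuclideanSpace ℝ (Fin n)) N']
  [IsManifold (𝓡 n) ∞ N'] [RiemannianBundle (fun z : N' => TangentSpace (𝓡 n) z)]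
  {p : N' → N} {ρ : BilinField (𝓡 n) N} {θ : OneForm (𝓡 n) N'} {c : ℝ}

/-- On a lift the integrand is dθ on the two velocities, whose continuity is already known. -/
theorem continuous_bilin_velocity (hp : IsUniversalRiemannianCover n p) (hθ : θ ∈ primitives p ρ)
    {q : ℝ × ℝ → N} (hq : ContMDiff 𝓘(ℝ, ℝ × ℝ) (𝓡 n) ∞ q) : Continuous fun z : ℝ × ℝ =>
      ρ (q z) (velocity (𝓡 n) (fun s' => q (s', z.2)) z.1) (velocity (𝓡 n) (fun t' => q (z.1, t')) z.2) := by
  obtain ⟨e, he⟩ := hp.surjective (q (0, 0))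
  obtain ⟨Q, hQ, -, hQq⟩ := hp.exists_smooth_lift hq he
  obtain rfl : q = fun z => p (Q z) := funext fun z => (hQq z).symm
  have hl : ∀ t, ContMDiff 𝓘(ℝ, ℝ) (𝓡 n) ∞ (fun r => Q (r, t)) := fun t =>
    hQ.comp (contMDiff_iff_contDiff.2 (by fun_prop))
  have hr : ∀ r, ContMDiff 𝓘(ℝ, ℝ) (𝓡 n) ∞ (fun t => Q (r, t)) := fun r =>
    hQ.comp (contMDiff_iff_contDiff.2 (by fun_prop))
  refine (continuous_extDerivOne_velocity hθ.1.isChartSmoothAt hQ).congr fun z => ?_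
  rw [hθ.2, velocity_comp (hp.mdifferentiableAt _) ((hl z.2 z.1).mdifferentiableAt (by simp)),
    velocity_comp (hp.mdifferentiableAt _) ((hr z.1 z.2).mdifferentiableAt (by simp))]

theorem hasDerivAt_asymptoticMean (hp : IsUniversalRiemannianCover n p) (hθ : θ ∈ primitives p ρ)
    (hc : 0 ≤ c) (hθc : ∀ z, ‖θ z‖ ≤ c) {q : ℝ × ℝ → N} (hq : ContMDiff 𝓘(ℝ, ℝ × ℝ) (𝓡 n) ∞ q)
    (hper : ∀ r t, q (r, t + 1) = q (r, t)) (s : ℝ) :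
    HasDerivAt (fun s => asymptoticMean p θ (fun t => q (s, t)))
      (∫ t in (0 : ℝ)..1, ρ (q (s, t)) (velocity (𝓡 n) (fun s' => q (s', t)) s)
        (velocity (𝓡 n) (fun t' => q (s, t')) t)) s :=
  hasDerivAt_of_integral_eq_sub (continuous_integral_unit (continuous_bilin_velocity hp hθ hq))
    (fun a b => by
      rw [asymptoticMean_cylinder hp hθ hc hθc hq hper a b, add_sub_cancel_left, cylinderIntegral]) s

end Cover

end RFH

/-! ### The action in terms of asymptotic means. -/

namespace RFH

variable {n : ℕ}
  {N : Type*} [MetricSpace N] [ChartedSpace (EuclideanSpace ℝ (Fin n)) N]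
  [IsManifold (𝓡 n) ∞ N] [RiemannianBundle (fun q : N => TangentSpace (𝓡 n) q)]
  {N' : Type*} [TopologicalSpace N'] [ChartedSpace (EuclideanSpace ℝ (Fin n)) N']
  [IsManifold (𝓡 n) ∞ N'] [RiemannianBundle (fun z : N' => TangentSpace (𝓡 n) z)]

theorem twistedForm_add_smul (μ σ : BilinField (𝓡 n) N) (b : ℝ) (x : Cotangent n N)
    (u w : TangentSpace (cotModel n) x) :
    twistedForm (μ + b • σ) x u w = extDerivOne (cotModel n) liouville x u w +
      μ x.proj (dProj x u) (dProj x w) + b * σ x.proj (dProj x u) (dProj x w) := by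
  rw [twistedForm, add_assoc]
  rfl

theorem dProj_velocity {γ : ℝ → Cotangent n N} {t : ℝ}
    (hγ : MDifferentiableAt 𝓘(ℝ, ℝ) (cotModel n) γ t) :
    dProj (γ t) (velocity (cotModel n) γ t) = velocity (𝓡 n) (fun t => (γ t).proj) t :=
  (velocity_comp (contMDiff_cotProj.mdifferentiable (by simp) _) hγ).symm

theorem twistedForm_velocity (μ σ : BilinField (𝓡 n) N) (b : ℝ) {g : ℝ × ℝ → Cotangent n N}
    (hg : ContMDiff 𝓘(ℝ, ℝ × ℝ) (cotModel n) ∞ g) (s t : ℝ) :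
    twistedForm (μ + b • σ) (g (s, t)) (velocity (cotModel n) (fun s' => g (s', t)) s)
        (velocity (cotModel n) (fun t' => g (s, t')) t) =
      extDerivOne (cotModel n) liouville (g (s, t)) (velocity (cotModel n) (fun s' => g (s', t)) s)
        (velocity (cotModel n) (fun t' => g (s, t')) t) +
      μ (g (s, t)).proj (velocity (𝓡 n) (fun s' => (g (s', t)).proj) s)
        (velocity (𝓡 n) (fun t' => (g (s, t')).proj) t) +
      b * σ (g (s, t)).proj (velocity (𝓡 n) (fun s' => (g (s', t)).proj) s)
        (velocity (𝓡 n) (fun t' => (g (s, t')).proj) t) := by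
  have h1 : MDifferentiableAt 𝓘(ℝ, ℝ) (cotModel n) (fun s' => g (s', t)) s :=
    ((hg.comp (f := fun s' => (s', t)) (contMDiff_iff_contDiff.2 (by fun_prop))) s).mdifferentiableAt
      (by simp)
  have h2 : MDifferentiableAt 𝓘(ℝ, ℝ) (cotModel n) (fun t' => g (s, t')) t :=
    ((hg.comp (f := fun t' => (s, t')) (contMDiff_iff_contDiff.2 (by fun_prop))) t).mdifferentiableAt
      (by simp)
  rw [twistedForm_add_smul, ← dProj_velocity h1, ← dProj_velocity h2]

/-- The Rabinowitz action, relative to the reference loop `x₀`, in terms of the asymptotic means of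
primitives `θ`, `θ'` on the cover; `b` is the coefficient of the perturbation. -/
def meanAction (p : N' → N) (H : Cotangent n N → ℝ) (θ θ' : OneForm (𝓡 n) N')
    (x₀ : ℝ → Cotangent n N) (b : ℝ) (x : ℝ → Cotangent n N) (η : ℝ) : ℝ :=
  lineIntegral liouville x 1 + asymptoticMean p θ (fun t => (x t).proj) +
    b * (asymptoticMean p θ' (fun t => (x t).proj) - asymptoticMean p θ' (fun t => (x₀ t).proj)) -
    η * (∫ t in (0 : ℝ)..1, H (x t)) -
    (lineIntegral liouville x₀ 1 + asymptoticMean p θ (fun t => (x₀ t).proj))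

variable [IsContMDiffRiemannianBundle (𝓡 n) ∞
      (EuclideanSpace ℝ (Fin n)) (fun q : N => TangentSpace (𝓡 n) q)] [ConnectedSpace N]
  {p : N' → N} {μ σ : BilinField (𝓡 n) N} {θ θ' : OneForm (𝓡 n) N'} {c c' : ℝ}

/-- Serves both a filling cylinder, with constant coefficient, and the flow line, with coefficient
β(s). The constant `k₀` is the reference mean, so the product rule turns β' into a factor of the
flux from the reference loop. -/
theorem hasDerivAt_twisted (hp : IsUniversalRiemannianCover n p) (hθ : θ ∈ primitives p μ)
    (hθ' : θ' ∈ primitives p σ) (hc : 0 ≤ c) (hc' : 0 ≤ c') (hθc : ∀ z, ‖θ z‖ ≤ c)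
    (hθc' : ∀ z, ‖θ' z‖ ≤ c') {g : ℝ × ℝ → Cotangent n N}
    (hg : ContMDiff 𝓘(ℝ, ℝ × ℝ) (cotModel n) ∞ g) (hper : ∀ s t, g (s, t + 1) = g (s, t)) :
    (∀ b : ℝ, Continuous fun z : ℝ × ℝ => twistedForm (μ + b • σ) (g z)
      (velocity (cotModel n) (fun s' => g (s', z.2)) z.1)
        (velocity (cotModel n) (fun t' => g (z.1, t')) z.2)) ∧
    (∀ β : ℝ → ℝ, Continuous β → Continuous fun z : ℝ × ℝ => twistedForm (μ + β z.1 • σ) (g z)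
      (velocity (cotModel n) (fun s' => g (s', z.2)) z.1)
        (velocity (cotModel n) (fun t' => g (z.1, t')) z.2)) ∧
    ∀ (β : ℝ → ℝ) (β' s k₀ : ℝ), HasDerivAt β β' s → HasDerivAt (fun s =>
      lineIntegral liouville (fun t => g (s, t)) 1 + asymptoticMean p θ (fun t => (g (s, t)).proj) +
        β s * (asymptoticMean p θ' (fun t => (g (s, t)).proj) - k₀))
      ((∫ t in (0 : ℝ)..1, twistedForm (μ + β s • σ) (g (s, t))
        (velocity (cotModel n) (fun s' => g (s', t)) s)
        (velocity (cotModel n) (fun t' => g (s, t')) t)) +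
        β' * (asymptoticMean p θ' (fun t => (g (s, t)).proj) - k₀)) s := by
  have hq : ContMDiff 𝓘(ℝ, ℝ × ℝ) (𝓡 n) ∞ (fun z => (g z).proj) := contMDiff_cotProj.comp hg
  have hqper : ∀ s t, (g (s, t + 1)).proj = (g (s, t)).proj := fun s t => by rw [hper]
  have c1 := continuous_extDerivOne_velocity (liouville_isChartSmoothAt (n := n) (N := N)) hg
  have c2 := continuous_bilin_velocity hp hθ hq
  have c3 := continuous_bilin_velocity hp hθ' hq
  have hcβ : ∀ β : ℝ → ℝ, Continuous β → Continuous fun z : ℝ × ℝ => twistedForm (μ + β z.1 • σ) (g z)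
      (velocity (cotModel n) (fun s' => g (s', z.2)) z.1)
        (velocity (cotModel n) (fun t' => g (z.1, t')) z.2) := fun β hβ => by
    refine ((c1.add c2).add ((hβ.comp continuous_fst).mul c3)).congr fun z => ?_
    exact (twistedForm_velocity μ σ (β z.1) hg z.1 z.2).symm
  refine ⟨fun b => hcβ (fun _ => b) continuous_const, hcβ, fun β β' s k₀ hβ => ?_⟩
  have d1 := hasDerivAt_lineIntegral (liouville_isChartSmoothAt (n := n) (N := N)) hg hper s
  have d2 := hasDerivAt_asymptoticMean hp hθ hc hθc hq hqper s
  have d3 := hasDerivAt_asymptoticMean hp hθ' hc' hθc' hq hqper s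
  have := (d1.add d2).add (hβ.mul (d3.sub_const k₀))
  refine this.congr_deriv ?_
  have i1 := (c1.comp (f := fun t => (s, t)) (by fun_prop)).intervalIntegrable
    (μ := MeasureTheory.volume) 0 1
  have i2 := (c2.comp (f := fun t => (s, t)) (by fun_prop)).intervalIntegrable
    (μ := MeasureTheory.volume) 0 1
  have i3 := (c3.comp (f := fun t => (s, t)) (by fun_prop)).intervalIntegrable
    (μ := MeasureTheory.volume) 0 1
  simp_rw [twistedForm_velocity μ σ (β s) hg]
  have e1 := intervalIntegral.integral_add i1 i2
  have e2 := intervalIntegral.integral_add (i1.add i2) (i3.const_mul (β s))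
  have e3 := intervalIntegral.integral_const_mul (μ := MeasureTheory.volume) (a := 0) (b := 1) (β s)
    (fun t => σ (g (s, t)).proj (velocity (𝓡 n) (fun s' => (g (s', t)).proj) s)
        (velocity (𝓡 n) (fun t' => (g (s, t')).proj) t))
  refine Eq.trans ?_ (congrArg (· + _) (e2.trans (congrArg₂ (· + ·) e1 e3))).symm
  simp only [Function.comp_apply]
  ring

/-- Integrating the derivative over a filling shows that the action depends only on the two boundary
loops; in particular it is independent of the filling. -/
theorem HasAction.eq_meanAction (hp : IsUniversalRiemannianCover n p) (hθ : θ ∈ primitives p μ)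
    (hθ' : θ' ∈ primitives p σ) (hc : 0 ≤ c) (hc' : 0 ≤ c') (hθc : ∀ z, ‖θ z‖ ≤ c)
    (hθc' : ∀ z, ‖θ' z‖ ≤ c') {H : Cotangent n N → ℝ} {x₀ x : ℝ → Cotangent n N} {η a b : ℝ}
    (h : HasAction (μ + b • σ) H x₀ x η a) : a = meanAction p H θ θ' x₀ b x η := by
  obtain ⟨g, hg, hper, h0, h1, rfl⟩ := h
  rw [contMDiff_prod_self_iff] at hg
  obtain ⟨hc1, -, hd⟩ := hasDerivAt_twisted hp hθ hθ' hc hc' hθc hθc' hg hper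
  have h2 := intervalIntegral.integral_eq_sub_of_hasDerivAt (a := 0) (b := 1)
    (fun s _ => hd (fun _ => b) 0 s 0 (hasDerivAt_const s b))
    (Continuous.intervalIntegrable (by
      simp only [zero_mul, add_zero]
      exact continuous_integral_unit (hc1 b)) _ _)
  simp only [zero_mul, add_zero] at h2
  rw [h2, meanAction, ← h0, ← h1]
  ring

end RFH

namespace RFH

/-! ### The energy density of a gradient flow line. -/

section Defect

variable {n : ℕ} {N : Type*} [TopologicalSpace N] [ChartedSpace (EuclideanSpace ℝ (Fin n)) N]
  [IsManifold (𝓡 n) ∞ N]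

/-- The value of the differential of a function on a tangent vector. -/
def differential (H : Cotangent n N → ℝ) (x : Cotangent n N) (u : TangentSpace (cotModel n) x) : ℝ :=
  mfderiv (cotModel n) 𝓘(ℝ, ℝ) H x u

/-- The failure `∂ₜv - η X(v)` of the loop `v s` to be an orbit. -/
def orbitDefect (X : ℝ → ∀ x : Cotangent n N, TangentSpace (cotModel n) x)
    (v : ℝ → ℝ → Cotangent n N) (η : ℝ → ℝ) (s t : ℝ) : TangentSpace (cotModel n) (v s t) :=
  velocity (cotModel n) (fun t' => v s t') t - η s • X s (v s t)

/-- The square norm of the orbit defect. -/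
def defectEnergy (ρ : ℝ → BilinField (𝓡 n) N)
    (X : ℝ → ∀ x : Cotangent n N, TangentSpace (cotModel n) x)
    (J : ℝ → ℝ → ∀ x : Cotangent n N,
      TangentSpace (cotModel n) x →L[ℝ] TangentSpace (cotModel n) x)
    (v : ℝ → ℝ → Cotangent n N) (η : ℝ → ℝ) (s t : ℝ) : ℝ :=
  twistedForm (ρ s) (v s t) (orbitDefect X v η s t) (J s t (v s t) (orbitDefect X v η s t))

variable {ρ : ℝ → BilinField (𝓡 n) N} {H : Cotangent n N → ℝ}
  {X : ℝ → ∀ x : Cotangent n N, TangentSpace (cotModel n) x}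
  {J : ℝ → ℝ → ∀ x : Cotangent n N,
      TangentSpace (cotModel n) x →L[ℝ] TangentSpace (cotModel n) x}
  {v : ℝ → ℝ → Cotangent n N} {η : ℝ → ℝ}

theorem twistedForm_zero_left {σ : BilinField (𝓡 n) N} {x : Cotangent n N}
    (w : TangentSpace (cotModel n) x) : twistedForm σ x 0 w = 0 := by
  rw [← twistedFormLin_apply, map_zero]; rfl

theorem IsCompatibleFamily.nonneg (hJ : IsCompatibleFamily ρ J) (s t : ℝ) (x : Cotangent n N)
    (u : TangentSpace (cotModel n) x) : 0 ≤ twistedForm (ρ s) x u (J s t x u) := by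
  rcases eq_or_ne u 0 with rfl | hu
  · rw [twistedForm_zero_left]
  · exact (hJ.pos s t x u hu).le

theorem defectEnergy_nonneg (hJ : IsCompatibleFamily ρ J) (s t : ℝ) :
    0 ≤ defectEnergy ρ X J v η s t := hJ.nonneg s t _ _

/-- Along a gradient flow line the energy density is the pairing of the action differential with
`∂ₛv`. -/
theorem defectEnergy_eq (hρ : ∀ s x u, ρ s x u u = 0)
    (hX : ∀ s, IsHamiltonianVectorField (ρ s) H (X s))
    (hf : IsGradientFlowLine H X J v η) (s t : ℝ) :
    defectEnergy ρ X J v η s t =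
      twistedForm (ρ s) (v s t) (velocity (cotModel n) (fun s' => v s' t) s)
        (velocity (cotModel n) (fun t' => v s t') t) -
      η s * differential H (v s t)
        (velocity (cotModel n) (fun s' => v s' t) s) := by
  have h1 : (velocity (cotModel n) (fun s' => v s' t) s : TangentSpace (cotModel n) (v s t)) =
      - J s t (v s t) (orbitDefect X v η s t) := eq_neg_of_add_eq_zero_left (hf.floer s t)
  have h2 : (velocity (cotModel n) (fun t' => v s t') t : TangentSpace (cotModel n) (v s t)) =
      orbitDefect X v η s t + η s • X s (v s t) := (sub_add_cancel _ _).symm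
  rw [differential, hX s, h2, twistedForm_add_right, twistedForm_smul_right,
    twistedForm_swap (hρ s) (X s (v s t)) _, h1, twistedForm_swap (hρ s) _ (orbitDefect X v η s t),
    twistedForm_neg_right, defectEnergy]
  ring

/-- The Hamiltonian has derivative at most `√Λ` in the metrics of bounded geometry. -/
theorem sq_mfderiv_le {Λ : ℝ} (hρ : ∀ s x u, ρ s x u u = 0)
    (hX : ∀ s, IsHamiltonianVectorField (ρ s) H (X s)) (hJ : IsCompatibleFamily ρ J) {s t : ℝ}
    {x : Cotangent n N} (hΛ : twistedForm (ρ s) x (X s x) (J s t x (X s x)) ≤ Λ)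
    (u : TangentSpace (cotModel n) x) :
    differential H x u ^ 2 ≤ Λ * twistedForm (ρ s) x u (J s t x u) := by
  have h : differential H x u = - twistedForm (ρ s) x (X s x) u := hX s x u
  rw [h, neg_sq]
  exact (twistedForm_sq_le (hρ s) (hJ.sq s t x) (hJ.symm s t x) (hJ.pos s t x) _ _).trans
    (mul_le_mul_of_nonneg_right hΛ (hJ.nonneg s t x u))

/-- dH vanishes on its own Hamiltonian vector field, so along a loop H changes only through the
defect. -/
theorem mfderiv_velocity_eq (hρ : ∀ s x u, ρ s x u u = 0)
    (hX : ∀ s, IsHamiltonianVectorField (ρ s) H (X s)) (s t : ℝ) :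
    differential H (v s t) (velocity (cotModel n) (fun t' => v s t') t) =
      differential H (v s t) (orbitDefect X v η s t) := by
  have h2 : (velocity (cotModel n) (fun t' => v s t') t : TangentSpace (cotModel n) (v s t)) =
      orbitDefect X v η s t + η s • X s (v s t) := (sub_add_cancel _ _).symm
  rw [differential, differential, hX s, hX s, h2, twistedForm_add_right, twistedForm_smul_right, twistedForm_self (hρ s),
    mul_zero, add_zero]

end Defect

variable {n : ℕ}
  {N : Type*} [MetricSpace N] [ChartedSpace (EuclideanSpace ℝ (Fin n)) N]
  [IsManifold (𝓡 n) ∞ N] [RiemannianBundle (fun q : N => TangentSpace (𝓡 n) q)]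
  {N' : Type*} [TopologicalSpace N'] [ChartedSpace (EuclideanSpace ℝ (Fin n)) N']
  [IsManifold (𝓡 n) ∞ N'] [RiemannianBundle (fun z : N' => TangentSpace (𝓡 n) z)]

/-- A gradient flow line for the homotopy `μ + β(s)σ` of 2-forms that have bounded primitives on
the cover. -/
structure IsBoundedFlow (p : N' → N) (H : Cotangent n N → ℝ) (μ σ : BilinField (𝓡 n) N)
    (θ θ' : OneForm (𝓡 n) N') (c c' : ℝ) (β : ℝ → ℝ)
    (X : ℝ → ∀ x : Cotangent n N, TangentSpace (cotModel n) x)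
    (J : ℝ → ℝ → ∀ x : Cotangent n N,
      TangentSpace (cotModel n) x →L[ℝ] TangentSpace (cotModel n) x)
    (v : ℝ → ℝ → Cotangent n N) (η : ℝ → ℝ) : Prop where
  cover : IsUniversalRiemannianCover n p
  smooth_H : ContMDiff (cotModel n) 𝓘(ℝ, ℝ) ∞ H
  alt_left : ∀ x u, μ x u u = 0
  alt_right : ∀ x u, σ x u u = 0
  prim_left : θ ∈ primitives p μ
  prim_right : θ' ∈ primitives p σ
  nonneg_left : 0 ≤ c
  nonneg_right : 0 ≤ c'
  bound_left : ∀ z, ‖θ z‖ ≤ c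
  bound_right : ∀ z, ‖θ' z‖ ≤ c'
  smooth_β : ContDiff ℝ ∞ β
  hamiltonian : ∀ s, IsHamiltonianVectorField (μ + β s • σ) H (X s)
  compatible : IsCompatibleFamily (fun s => μ + β s • σ) J
  flow : IsGradientFlowLine H X J v η

namespace IsBoundedFlow

variable {p : N' → N} {H : Cotangent n N → ℝ} {μ σ : BilinField (𝓡 n) N}
  {θ θ' : OneForm (𝓡 n) N'} {c c' : ℝ} {β : ℝ → ℝ}
  {X : ℝ → ∀ x : Cotangent n N, TangentSpace (cotModel n) x}
  {J : ℝ → ℝ → ∀ x : Cotangent n N,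
    TangentSpace (cotModel n) x →L[ℝ] TangentSpace (cotModel n) x}
  {v : ℝ → ℝ → Cotangent n N} {η : ℝ → ℝ}

theorem alternating (h : IsBoundedFlow p H μ σ θ θ' c c' β X J v η) (s : ℝ) (x : N)
    (u : TangentSpace (𝓡 n) x) : (μ + β s • σ) x u u = 0 := by
  have : (μ + β s • σ) x u u = μ x u u + β s * σ x u u := rfl
  rw [this, h.alt_left, h.alt_right, mul_zero, add_zero]

theorem smooth_v (h : IsBoundedFlow p H μ σ θ θ' c c' β X J v η) :
    ContMDiff 𝓘(ℝ, ℝ × ℝ) (cotModel n) ∞ (fun z : ℝ × ℝ => v z.1 z.2) :=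
  contMDiff_prod_self_iff.1 h.flow.smooth_v

/-- The energy density of a gradient flow line. -/
def energy (μ σ : BilinField (𝓡 n) N) (β : ℝ → ℝ)
    (X : ℝ → ∀ x : Cotangent n N, TangentSpace (cotModel n) x)
    (J : ℝ → ℝ → ∀ x : Cotangent n N,
      TangentSpace (cotModel n) x →L[ℝ] TangentSpace (cotModel n) x)
    (v : ℝ → ℝ → Cotangent n N) (η : ℝ → ℝ) (s : ℝ) : ℝ :=
  (∫ t in (0 : ℝ)..1, defectEnergy (fun s => μ + β s • σ) X J v η s t) + deriv η s ^ 2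

variable [IsContMDiffRiemannianBundle (𝓡 n) ∞
      (EuclideanSpace ℝ (Fin n)) (fun q : N => TangentSpace (𝓡 n) q)] [ConnectedSpace N]

theorem continuous_defectEnergy (h : IsBoundedFlow p H μ σ θ θ' c c' β X J v η) :
    Continuous fun z : ℝ × ℝ => defectEnergy (fun s => μ + β s • σ) X J v η z.1 z.2 := by
  obtain ⟨-, h1, -⟩ := hasDerivAt_twisted h.cover h.prim_left h.prim_right h.nonneg_left
    h.nonneg_right h.bound_left h.bound_right h.smooth_v (fun s t => h.flow.periodic s t)
  have h2 := continuous_mfderiv_velocity h.smooth_H h.smooth_v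
  refine ((h1 β h.smooth_β.continuous).sub ((h.flow.smooth_η.continuous.comp continuous_fst).mul
    h2)).congr fun z => ?_
  exact (defectEnergy_eq h.alternating h.hamiltonian h.flow z.1 z.2).symm

theorem continuous_defectEnergy_slice (h : IsBoundedFlow p H μ σ θ θ' c c' β X J v η) (s : ℝ) :
    Continuous fun t : ℝ => defectEnergy (fun s => μ + β s • σ) X J v η s t :=
  h.continuous_defectEnergy.comp (f := fun t : ℝ => (s, t)) (by fun_prop)

theorem continuous_energy (h : IsBoundedFlow p H μ σ θ θ' c c' β X J v η) :
    Continuous (energy μ σ β X J v η) :=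
  (continuous_integral_unit h.continuous_defectEnergy).add
    ((h.flow.smooth_η.continuous_deriv (by simp)).pow 2)

theorem integral_defectEnergy_nonneg (h : IsBoundedFlow p H μ σ θ θ' c c' β X J v η) (s : ℝ) :
    0 ≤ ∫ t in (0 : ℝ)..1, defectEnergy (fun s => μ + β s • σ) X J v η s t :=
  intervalIntegral.integral_nonneg zero_le_one fun t _ => defectEnergy_nonneg h.compatible s t

theorem energy_nonneg (h : IsBoundedFlow p H μ σ θ θ' c c' β X J v η) (s : ℝ) :
    0 ≤ energy μ σ β X J v η s :=
  add_nonneg (h.integral_defectEnergy_nonneg s) (sq_nonneg _)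

/-- The energy identity. The flow equations turn the differential of the functional into the energy
density, and the β' term comes from the explicit time dependence. -/
theorem hasDerivAt_meanAction (h : IsBoundedFlow p H μ σ θ θ' c c' β X J v η)
    (x₀ : ℝ → Cotangent n N) (s : ℝ) :
    HasDerivAt (fun s => meanAction p H θ θ' x₀ (β s) (v s) (η s))
      (energy μ σ β X J v η s + deriv β s * (asymptoticMean p θ' (fun t => (v s t).proj) -
        asymptoticMean p θ' (fun t => (x₀ t).proj))) s := by
  obtain ⟨-, h1, hd⟩ := hasDerivAt_twisted h.cover h.prim_left h.prim_right h.nonneg_left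
    h.nonneg_right h.bound_left h.bound_right h.smooth_v (fun s t => h.flow.periodic s t)
  have d1 := hd β (deriv β s) s (asymptoticMean p θ' (fun t => (x₀ t).proj))
    (h.smooth_β.differentiable (by simp) s).hasDerivAt
  have d2 : HasDerivAt (fun s => ∫ t in (0 : ℝ)..1, H (v s t)) (∫ t in (0 : ℝ)..1,
      differential H (v s t) (velocity (cotModel n) (fun s' => v s' t) s)) s :=
    hasDerivAt_integral_comp h.smooth_H h.smooth_v s
  have d3 := (h.flow.smooth_η.differentiable (by simp) s).hasDerivAt
  refine ((d1.sub (d3.mul d2)).sub_const (lineIntegral liouville x₀ 1 +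
    asymptoticMean p θ (fun t => (x₀ t).proj))).congr_deriv ?_
  have h2 := continuous_mfderiv_velocity h.smooth_H h.smooth_v
  have i1 := ((h1 β h.smooth_β.continuous).comp (f := fun t => (s, t)) (by fun_prop)).intervalIntegrable
    (μ := MeasureTheory.volume) 0 1
  have i2 := (h2.comp (f := fun t => (s, t)) (by fun_prop)).intervalIntegrable
    (μ := MeasureTheory.volume) 0 1
  have e2 : (∫ t in (0 : ℝ)..1, (twistedForm (μ + β s • σ) (v s t)
        (velocity (cotModel n) (fun s' => v s' t) s) (velocity (cotModel n) (fun t' => v s t') t) -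
      η s * differential H (v s t) (velocity (cotModel n) (fun s' => v s' t) s))) = _ :=
    intervalIntegral.integral_sub i1 (i2.const_mul (η s))
  have e3 := intervalIntegral.integral_const_mul (μ := MeasureTheory.volume) (a := 0) (b := 1) (η s)
    (fun t => differential H (v s t)
        (velocity (cotModel n) (fun s' => v s' t) s))
  have e4 : (∫ t in (0 : ℝ)..1, defectEnergy (fun s => μ + β s • σ) X J v η s t) =
      ∫ t in (0 : ℝ)..1, (twistedForm (μ + β s • σ) (v s t)
        (velocity (cotModel n) (fun s' => v s' t) s) (velocity (cotModel n) (fun t' => v s t') t) -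
      η s * differential H (v s t) (velocity (cotModel n) (fun s' => v s' t) s)) :=
    intervalIntegral.integral_congr fun t _ =>
      defectEnergy_eq h.alternating h.hamiltonian h.flow s t
  have e5 := e4.trans (e2.trans (congrArg₂ (· - ·) rfl e3))
  have e6 := h.flow.multiplier s
  rw [energy, e5, eq_neg_of_add_eq_zero_right e6]
  ring

end IsBoundedFlow

theorem tendsto_meanAction {p : N' → N} {H : Cotangent n N → ℝ} {θ θ' : OneForm (𝓡 n) N'}
    {β η : ℝ → ℝ} {v : ℝ → ℝ → Cotangent n N} {x : ℝ → Cotangent n N} (x₀ : ℝ → Cotangent n N)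
    {l : Filter ℝ} [l.IsCountablyGenerated] {b η' : ℝ} (hH : ContMDiff (cotModel n) 𝓘(ℝ, ℝ) ∞ H)
    (hv : ContMDiff 𝓘(ℝ, ℝ × ℝ) (cotModel n) ∞ (fun z : ℝ × ℝ => v z.1 z.2)) (hx : IsLoop x)
    (h : LoopTendsto v l x)
    (hθ : Tendsto (fun s => asymptoticMean p θ (fun t => (v s t).proj)) l
      (𝓝 (asymptoticMean p θ (fun t => (x t).proj))))
    (hθ' : Tendsto (fun s => asymptoticMean p θ' (fun t => (v s t).proj)) l
      (𝓝 (asymptoticMean p θ' (fun t => (x t).proj))))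
    (hβ : Tendsto β l (𝓝 b)) (hη : Tendsto η l (𝓝 η')) :
    Tendsto (fun s => meanAction p H θ θ' x₀ (β s) (v s) (η s)) l
      (𝓝 (meanAction p H θ θ' x₀ b x η')) := by
  have hl : ∀ y : ℝ → Cotangent n N, ContMDiff 𝓘(ℝ, ℝ) (cotModel n) ∞ y →
      Continuous fun t => liouville (y t) (velocity (cotModel n) y t) := fun y hy => by
    have h : ∀ t, liouville (y t) (velocity (cotModel n) y t) = pullbackForm liouville y t 1 :=
      fun t => rfl
    simp_rw [h]
    exact (contDiff_pullbackForm liouville_isChartSmoothAt hy).continuous.clm_apply continuous_const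
  have h1 : Tendsto (fun s => lineIntegral liouville (v s) 1) l
      (𝓝 (lineIntegral liouville x 1)) :=
    tendsto_intervalIntegral_of_forall_tendsto (fun s => hl _ (contMDiff_slice hv s))
      (hl x hx.smooth) (fun t₀ => h.tendsto_form hx.smooth (contMDiff_slice hv) t₀ contMDiffAt_id
        (liouville_isChartSmoothAt _)) 0 1
  have h2 : Tendsto (fun s => ∫ t in (0 : ℝ)..1, H (v s t)) l
      (𝓝 (∫ t in (0 : ℝ)..1, H (x t))) :=
    tendsto_intervalIntegral_of_forall_tendsto
      (fun s => hH.continuous.comp (contMDiff_slice hv s).continuous)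
      (hH.continuous.comp hx.smooth.continuous) (fun t₀ => h.tendsto_comp hx.smooth hH t₀) 0 1
  exact ((((h1.add hθ).add (hβ.mul (hθ'.sub_const _))).sub (hη.mul h2)).sub_const _)

end RFH

/-! ### Length of the loops and distance to the energy hypersurface. -/

namespace RFH

section Periodic

variable {E : Type*} [NormedAddCommGroup E] [NormedSpace ℝ E]
  {H : Type*} [TopologicalSpace H] {I : ModelWithCorners ℝ E H}
  {M : Type*} [TopologicalSpace M] [ChartedSpace H M]

theorem periodic_form_velocity (α : OneForm I M) {γ : ℝ → M} (hγ : ContMDiff 𝓘(ℝ, ℝ) I ∞ γ)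
    (hper : ∀ t, γ (t + 1) = γ t) : Function.Periodic (fun t => α (γ t) (velocity I γ t)) 1 := by
  intro t
  have h1 := velocity_add_const (γ := γ) (t := t) 1 ((hγ _).mdifferentiableAt (by simp))
  have h2 : ∀ y : ℝ → M, y = γ → α (y t) (velocity I y t) = α (γ t) (velocity I γ t) := by
    rintro y rfl; rfl
  beta_reduce
  rw [← h2 _ (funext hper), h1]

end Periodic

section Truncation

variable {ξ : ℝ} {χ : ℝ → ℝ}

/-- χ is monotone and fixes ±m, so a value strictly between them comes from an argument strictly
between them, where χ is locally the identity. -/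
theorem IsTruncation.eq_of_abs_lt (h : IsTruncation ξ χ) (hξ : 0 < ξ) {x : ℝ}
    (hx : |χ x| < ξ - min (1 / 3) (ξ / 3)) : χ x = x ∧ deriv χ x = 1 := by
  have hmono : Monotone χ := monotone_of_deriv_nonneg (h.smooth.differentiable (by simp))
    fun t => (h.deriv_mem t).1
  set m := ξ - min (1 / 3) (ξ / 3) with hm
  have hm0 : 0 < m := by have := min_le_right (1 / 3) (ξ / 3); linarith
  have h1 : χ m = m := h.eq_id m (by rw [abs_of_pos hm0])
  have h2 : χ (-m) = -m := h.eq_id (-m) (by rw [abs_neg, abs_of_pos hm0])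
  rw [abs_lt] at hx
  have hx1 : |x| < m := by
    rw [abs_lt]
    constructor
    · by_contra! hc
      have := hmono hc
      linarith
    · by_contra! hc
      have := hmono hc
      linarith
  refine ⟨h.eq_id x hx1.le, ?_⟩
  have h3 : χ =ᶠ[𝓝 x] id := by
    filter_upwards [(isOpen_lt continuous_abs continuous_const).mem_nhds hx1] with y hy
    exact h.eq_id y (le_of_lt hy)
  rw [h3.deriv_eq, deriv_id]

end Truncation

variable {n : ℕ}
  {N : Type*} [MetricSpace N] [ChartedSpace (EuclideanSpace ℝ (Fin n)) N]
  [IsManifold (𝓡 n) ∞ N] [RiemannianBundle (fun q : N => TangentSpace (𝓡 n) q)]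
  {N' : Type*} [TopologicalSpace N'] [ChartedSpace (EuclideanSpace ℝ (Fin n)) N']
  [IsManifold (𝓡 n) ∞ N'] [RiemannianBundle (fun z : N' => TangentSpace (𝓡 n) z)]
  {p : N' → N} {θ : OneForm (𝓡 n) N'}

/-- A covector on the cover descends to the base. -/
theorem IsUniversalRiemannianCover.exists_covector (hp : IsUniversalRiemannianCover n p)
    (θ : OneForm (𝓡 n) N') {γ : ℝ → N'} (hγ : ContMDiff 𝓘(ℝ, ℝ) (𝓡 n) ∞ γ) {q : ℝ → N}
    (h : ∀ t, p (γ t) = q t) (t : ℝ) : ∃ ϑ : TangentSpace (𝓡 n) (q t) →L[ℝ] ℝ,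
      θ (γ t) (velocity (𝓡 n) γ t) = ϑ (velocity (𝓡 n) q t) ∧ ‖ϑ‖ ≤ ‖θ (γ t)‖ := by
  obtain rfl : q = fun t => p (γ t) := funext fun t => (h t).symm
  set e := (hp.localDiffeo (γ t)).mfderivToContinuousLinearEquiv (by simp) with he
  have h1 : ∀ u, e u = mfderiv (𝓡 n) (𝓡 n) p (γ t) u := fun u => rfl
  refine ⟨(θ (γ t)).comp (e.symm : TangentSpace (𝓡 n) (p (γ t)) →L[ℝ] TangentSpace (𝓡 n) (γ t)),
    ?_, ?_⟩
  · rw [velocity_comp (hp.mdifferentiableAt _) ((hγ t).mdifferentiableAt (by simp)), ← h1]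
    simp
  · refine ContinuousLinearMap.opNorm_le_bound _ (ContinuousLinearMap.opNorm_nonneg (θ (γ t))) fun w => ?_
    have h2 := hp.isometric (γ t) (e.symm w)
    rw [← h1, e.apply_symm_apply] at h2
    rw [h2]
    exact ContinuousLinearMap.le_opNorm (θ (γ t)) (e.symm w)

namespace IsBoundedFlow

variable [IsContMDiffRiemannianBundle (𝓡 n) ∞
      (EuclideanSpace ℝ (Fin n)) (fun q : N => TangentSpace (𝓡 n) q)] [ConnectedSpace N]
  {H : Cotangent n N → ℝ} {μ σ : BilinField (𝓡 n) N}
  {θ' : OneForm (𝓡 n) N'} {c c' : ℝ} {β : ℝ → ℝ}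
  {X : ℝ → ∀ x : Cotangent n N, TangentSpace (cotModel n) x}
  {J : ℝ → ℝ → ∀ x : Cotangent n N,
    TangentSpace (cotModel n) x →L[ℝ] TangentSpace (cotModel n) x}
  {v : ℝ → ℝ → Cotangent n N} {η : ℝ → ℝ} {L : ℝ}

/-- The norm of the orbit defect. -/
def defectNorm (μ σ : BilinField (𝓡 n) N) (β : ℝ → ℝ)
    (X : ℝ → ∀ x : Cotangent n N, TangentSpace (cotModel n) x)
    (J : ℝ → ℝ → ∀ x : Cotangent n N,
      TangentSpace (cotModel n) x →L[ℝ] TangentSpace (cotModel n) x)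
    (v : ℝ → ℝ → Cotangent n N) (η : ℝ → ℝ) (s t : ℝ) : ℝ :=
  √(defectEnergy (fun s => μ + β s • σ) X J v η s t)

theorem continuous_defectNorm (h : IsBoundedFlow p H μ σ θ θ' c c' β X J v η) (s : ℝ) :
    Continuous (defectNorm μ σ β X J v η s) := (h.continuous_defectEnergy_slice s).sqrt

theorem periodic_defectNorm (h : IsBoundedFlow p H μ σ θ θ' c c' β X J v η) (s : ℝ) :
    Function.Periodic (defectNorm μ σ β X J v η s) 1 := by
  intro t
  have h1 := velocity_add_const (γ := v s) (t := t) 1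
    ((contMDiff_slice h.smooth_v s _).mdifferentiableAt (by simp))
  have h2 : ∀ y : ℝ → Cotangent n N, y = v s →
      twistedForm (μ + β s • σ) (y t) (velocity (cotModel n) y t - η s • X s (y t))
        (J s (t + 1) (y t) (velocity (cotModel n) y t - η s • X s (y t))) =
      defectEnergy (fun s => μ + β s • σ) X J v η s t := by
    rintro y rfl
    rw [h.compatible.periodic]
    rfl
  have h3 := h2 (fun t => v s (t + 1)) (funext fun t => h.flow.periodic s t)
  rw [h1] at h3
  exact congrArg Real.sqrt h3

/-- Pointwise 2m ≤ ε + m²/ε. The weight is 1 for the length estimate and small where the energy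
density is small. -/
theorem integral_defectNorm_le (h : IsBoundedFlow p H μ σ θ θ' c c' β X J v η) (s : ℝ) {ε : ℝ}
    (hε : 0 < ε) : ∫ t in (0 : ℝ)..1, defectNorm μ σ β X J v η s t ≤
      (ε + energy μ σ β X J v η s / ε) / 2 := by
  have h1 : ∀ t, defectNorm μ σ β X J v η s t ≤
      (ε + defectEnergy (fun s => μ + β s • σ) X J v η s t / ε) / 2 := fun t => by
    have h2 := Real.sq_sqrt (defectEnergy_nonneg (X := X) (v := v) (η := η) h.compatible s t)
    rw [← h2, defectNorm, le_div_iff₀ two_pos, ← sub_nonneg]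
    set m := √(defectEnergy (fun s => μ + β s • σ) X J v η s t)
    have : ε + m ^ 2 / ε - m * 2 = (ε - m) ^ 2 / ε := by field_simp; ring
    rw [this]
    positivity
  have hc := h.continuous_defectEnergy_slice s
  refine (intervalIntegral.integral_mono_on zero_le_one
    ((h.continuous_defectNorm s).intervalIntegrable _ _)
    (Continuous.intervalIntegrable (by fun_prop) _ _) fun t _ => h1 t).trans ?_
  rw [intervalIntegral.integral_div, intervalIntegral.integral_add (by simp)
    (Continuous.intervalIntegrable (by fun_prop) _ _), intervalIntegral.integral_div]
  simp only [intervalIntegral.integral_const, sub_zero, one_smul]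
  have h3 : ∫ t in (0 : ℝ)..1, defectEnergy (fun s => μ + β s • σ) X J v η s t ≤
    energy μ σ β X J v η s := le_add_of_nonneg_right (sq_nonneg _)
  gcongr

theorem integral_defectNorm_le_of_energy_le (h : IsBoundedFlow p H μ σ θ θ' c c' β X J v η) {s ε : ℝ}
    (hε : 0 < ε) (hs : energy μ σ β X J v η s ≤ ε ^ 2) :
    ∫ t in (0 : ℝ)..1, defectNorm μ σ β X J v η s t ≤ ε := by
  refine (h.integral_defectNorm_le s hε).trans ?_
  have : energy μ σ β X J v η s / ε ≤ ε := by rw [div_le_iff₀ hε]; linarith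
  linarith

theorem abs_deriv_le (h : IsBoundedFlow p H μ σ θ θ' c c' β X J v η) {s ε : ℝ}
    (hε : 0 ≤ ε) (hs : energy μ σ β X J v η s ≤ ε ^ 2) : |deriv η s| ≤ ε := by
  refine abs_le_of_sq_le_sq ?_ hε
  have := h.integral_defectEnergy_nonneg s
  rw [energy] at hs
  linarith

theorem abs_deriv_le_one_add (h : IsBoundedFlow p H μ σ θ θ' c c' β X J v η) (s : ℝ) :
    |deriv η s| ≤ 1 + energy μ σ β X J v η s := by
  have := h.integral_defectEnergy_nonneg s
  rw [energy, ← sq_abs]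
  nlinarith [sq_nonneg (|deriv η s| - 1 / 2)]

theorem abs_le_sqrt_mul {a L D : ℝ} (hL : 0 ≤ L) (h : a ^ 2 ≤ L * D) : |a| ≤ √L * √D := by
  rw [← Real.sqrt_mul hL]
  exact Real.abs_le_sqrt h

/-- The velocity of the footpoint of a flow line. -/
theorem velocity_proj (h : IsBoundedFlow p H μ σ θ θ' c c' β X J v η) (s t : ℝ) :
    velocity (𝓡 n) (fun t => (v s t).proj) t =
      dProj (v s t) (orbitDefect X v η s t) + η s • dProj (v s t) (X s (v s t)) := by
  rw [← dProj_velocity ((contMDiff_slice h.smooth_v s t).mdifferentiableAt (by simp)),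
    ← ContinuousLinearMap.map_smul, ← ContinuousLinearMap.map_add, orbitDefect, sub_add_cancel]

theorem norm_dProj_orbitDefect_le (hL : 0 ≤ L)
    (hgeo : GeometryBound L (fun s => μ + β s • σ) X J) (s t : ℝ) :
    ‖dProj (v s t) (orbitDefect X v η s t)‖ ≤ √L * defectNorm μ σ β X J v η s t := by
  have := abs_le_sqrt_mul hL ((hgeo s t (v s t)).1 (orbitDefect X v η s t))
  rwa [abs_norm] at this

theorem norm_dProj_hamiltonianVectorField_le (hL : 0 ≤ L)
    (hgeo : GeometryBound L (fun s => μ + β s • σ) X J) (s : ℝ) (x : Cotangent n N) :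
    ‖dProj x (X s x)‖ ≤ L := by
  obtain ⟨h1, h2⟩ := hgeo s 0 x
  refine abs_le_of_sq_le_sq' ?_ hL |>.2
  nlinarith [h1 (X s x)]

/-- The footpoint velocity is the projected defect plus η times the projected Hamiltonian vector
field; the bounded geometry controls each. -/
theorem loopLength_le (h : IsBoundedFlow p H μ σ θ θ' c c' β X J v η) (hL : 0 ≤ L)
    (hgeo : GeometryBound L (fun s => μ + β s • σ) X J) (s : ℝ) :
    loopLength n (fun t => (v s t).proj) ≤
      √L * ((1 + energy μ σ β X J v η s) / 2) + |η s| * L := by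
  have hv : ContMDiff 𝓘(ℝ, ℝ) (𝓡 n) ∞ (fun t => (v s t).proj) :=
    contMDiff_cotProj.comp (contMDiff_slice h.smooth_v s)
  have h1 : ∀ t, ‖velocity (𝓡 n) (fun t => (v s t).proj) t‖ ≤
      √L * defectNorm μ σ β X J v η s t + |η s| * L := fun t => by
    rw [h.velocity_proj]
    refine (norm_add_le _ _).trans (add_le_add (norm_dProj_orbitDefect_le hL hgeo s t) ?_)
    rw [norm_smul, Real.norm_eq_abs]
    exact mul_le_mul_of_nonneg_left (norm_dProj_hamiltonianVectorField_le hL hgeo s _) (abs_nonneg _)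
  have hc := h.continuous_defectNorm s
  refine (intervalIntegral.integral_mono_on zero_le_one
    ((continuous_norm_velocity hv).intervalIntegrable _ _)
    (Continuous.intervalIntegrable (by fun_prop) _ _) fun t _ => h1 t).trans ?_
  rw [intervalIntegral.integral_add (Continuous.intervalIntegrable (by fun_prop) _ _) (by simp),
    intervalIntegral.integral_const_mul]
  simp only [intervalIntegral.integral_const, sub_zero, one_smul]
  have h2 := h.integral_defectNorm_le s one_pos
  rw [div_one] at h2
  gcongr

/-- If the energy density is small, then the loop is close to the hypersurface `H = 0`. -/
theorem abs_hamiltonian_le (h : IsBoundedFlow p H μ σ θ θ' c c' β X J v η) (hL : 0 ≤ L)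
    (hgeo : GeometryBound L (fun s => μ + β s • σ) X J) {s ε : ℝ} (hε : 0 < ε)
    (hs : energy μ σ β X J v η s ≤ ε ^ 2) (t : ℝ) : |H (v s t)| ≤ (1 + √L) * ε := by
  have hv := contMDiff_slice h.smooth_v s
  have hper : Function.Periodic (v s) 1 := h.flow.periodic s
  obtain ⟨t₀, ht₀, htt⟩ := hper.exists_mem_Ico₀ one_pos t
  rw [htt]
  have hc := h.continuous_defectNorm s
  have hd : ∀ t, HasDerivAt (fun t => H (v s t)) (differential H (v s t) (orbitDefect X v η s t)) t :=
    fun t => by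
    have h1 := hasDerivAt_comp_velocity (F := H) (γ := v s) (t := t)
      ((h.smooth_H _).mdifferentiableAt (by simp)) ((hv t).mdifferentiableAt (by simp))
    exact h1.congr_deriv (mfderiv_velocity_eq (H := H) h.alternating h.hamiltonian s t)
  have hdb : ∀ t, |differential H (v s t) (orbitDefect X v η s t)| ≤
      √L * defectNorm μ σ β X J v η s t := fun t =>
    abs_le_sqrt_mul hL (sq_mfderiv_le (H := H) h.alternating h.hamiltonian h.compatible
      (hgeo s t (v s t)).2 _)
  have hint := h.integral_defectNorm_le_of_energy_le hε hs
  have hn0 : ∀ t, 0 ≤ √L * defectNorm μ σ β X J v η s t := fun t =>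
    mul_nonneg (Real.sqrt_nonneg _) (Real.sqrt_nonneg _)
  -- The oscillation of H on the loop is at most √L times the integrated defect. Its mean is -η',
  -- which is at most ε in absolute value; the sum of both gives (1 + √L)ε.
  have hosc : ∀ t₁ ∈ Set.Icc (0 : ℝ) 1, ∀ t₂ ∈ Set.Icc (0 : ℝ) 1,
      |H (v s t₁) - H (v s t₂)| ≤ √L * ε := by
    have hle : ∀ t₁ ∈ Set.Icc (0 : ℝ) 1, ∀ t₂ ∈ Set.Icc (0 : ℝ) 1, t₁ ≤ t₂ →
      |H (v s t₂) - H (v s t₁)| ≤ √L * ε := by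
      intro t₁ ht₁ t₂ ht₂ h12
      have hH : ContDiff ℝ ∞ (fun t => H (v s t)) := (h.smooth_H.comp hv).contDiff
      have hde : ∀ t, deriv (fun t => H (v s t)) t =
        differential H (v s t) (orbitDefect X v η s t) := fun t => (hd t).deriv
      have hb : ∀ t, ‖deriv (fun t => H (v s t)) t‖ ≤ √L * defectNorm μ σ β X J v η s t :=
        fun t => by rw [Real.norm_eq_abs, hde]; exact hdb t
      have hi : IntervalIntegrable (fun t => √L * defectNorm μ σ β X J v η s t)
        MeasureTheory.volume t₁ t₂ := Continuous.intervalIntegrable (by fun_prop) _ _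
      have h2 := intervalIntegral.norm_integral_le_of_norm_le h12
        (Eventually.of_forall fun t _ => hb t) hi
      rw [intervalIntegral.integral_deriv_eq_sub (fun t _ => (hd t).differentiableAt)
        ((hH.continuous_deriv (by simp)).intervalIntegrable _ _), Real.norm_eq_abs] at h2
      refine h2.trans ((intervalIntegral.integral_mono_interval ht₁.1 h12 ht₂.2
        (Eventually.of_forall hn0) (Continuous.intervalIntegrable (by fun_prop) _ _)).trans ?_)
      rw [intervalIntegral.integral_const_mul]
      gcongr
    intro t₁ ht₁ t₂ ht₂
    rcases le_total t₁ t₂ with h12 | h12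
    · rw [abs_sub_comm]; exact hle t₁ ht₁ t₂ ht₂ h12
    · exact hle t₂ ht₂ t₁ ht₁ h12
  have hHc : Continuous fun t => H (v s t) := h.smooth_H.continuous.comp hv.continuous
  have h3 : |∫ t in (0 : ℝ)..1, (H (v s t₀) - H (v s t))| ≤ √L * ε := by
    have := intervalIntegral.norm_integral_le_of_norm_le_const (a := (0 : ℝ)) (b := 1)
      (f := fun t => H (v s t₀) - H (v s t)) (C := √L * ε) fun t ht => by
        rw [Set.uIoc_of_le zero_le_one] at ht
        exact hosc t₀ ⟨ht₀.1, ht₀.2.le⟩ t ⟨ht.1.le, ht.2⟩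
    simpa using this
  rw [intervalIntegral.integral_sub (by simp) (hHc.intervalIntegrable _ _)] at h3
  simp only [intervalIntegral.integral_const, sub_zero, one_smul] at h3
  have h4 := h.abs_deriv_le hε.le hs
  rw [eq_neg_of_add_eq_zero_left (h.flow.multiplier s), abs_neg] at h4
  have h5 := abs_add_le (H (v s t₀) - ∫ t in (0 : ℝ)..1, H (v s t)) (∫ t in (0 : ℝ)..1, H (v s t))
  rw [sub_add_cancel] at h5
  linarith

end IsBoundedFlow

end RFH

/-! ### Bounding the multiplier by the action. -/

namespace RFH

section Pairing

variable {n : ℕ}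
  {N : Type*} [MetricSpace N] [ChartedSpace (EuclideanSpace ℝ (Fin n)) N]
  [IsManifold (𝓡 n) ∞ N] [RiemannianBundle (fun q : N => TangentSpace (𝓡 n) q)]
  [IsContMDiffRiemannianBundle (𝓡 n) ∞
      (EuclideanSpace ℝ (Fin n)) (fun q : N => TangentSpace (𝓡 n) q)]
  {U : N → ℝ} {k d : ℝ} {χ : ℝ → ℝ}

/-- Near the hypersurface `H_U = k` above the critical value, the Hamiltonian vector field is
positive on the shifted Liouville form. -/
theorem le_add_apply_dProj_hamiltonianVectorField (hU : ContMDiff (𝓡 n) 𝓘(ℝ, ℝ) ∞ U)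
    (hχ : ContDiff ℝ ∞ χ) {σ : BilinField (𝓡 n) N}
    {X : ∀ x : Cotangent n N, TangentSpace (cotModel n) x}
    (hX : IsHamiltonianVectorField σ (definingHamiltonian U k χ) X) (x : Cotangent n N)
    (w : TangentSpace (𝓡 n) x.proj →L[ℝ] ℝ)
    (hx : -(d / 2) ≤ (1 / 2) * ‖x.2‖ ^ 2 + U x.proj - k)
    (hd : deriv χ ((1 / 2) * ‖x.2‖ ^ 2 + U x.proj - k) = 1)
    (hw : (1 / 2) * ‖w‖ ^ 2 + U x.proj ≤ k - d) :
    d / 2 ≤ (x.2 + w) (dProj x (X x)) := by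
  rw [apply_dProj_hamiltonianVectorField hU hχ hX x (x.2 + w), hd, one_mul]
  have h1 := sharp_add_smul x.2 w 1
  rw [one_smul, one_smul] at h1
  rw [h1, inner_add_right, real_inner_self_eq_norm_sq, norm_sharp]
  have h2 := abs_real_inner_le_norm (sharp x.2) (sharp w)
  rw [norm_sharp, norm_sharp] at h2
  have h3 := neg_le_of_abs_le h2
  -- |p|² - |p||w| ≥ ½|p|² - ½|w|², and the hypotheses bound this below by (k - U - d/2) - (k - d -
  -- U) = d/2.
  nlinarith [sq_nonneg (‖x.2‖ - ‖w‖)]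

end Pairing

namespace IsBoundedFlow

variable {n : ℕ}
  {N : Type*} [MetricSpace N] [ChartedSpace (EuclideanSpace ℝ (Fin n)) N]
  [IsManifold (𝓡 n) ∞ N] [RiemannianBundle (fun q : N => TangentSpace (𝓡 n) q)]
  {N' : Type*} [TopologicalSpace N'] [ChartedSpace (EuclideanSpace ℝ (Fin n)) N']
  [IsManifold (𝓡 n) ∞ N'] [RiemannianBundle (fun z : N' => TangentSpace (𝓡 n) z)]
  {p : N' → N} {θ : OneForm (𝓡 n) N'}
  [IsContMDiffRiemannianBundle (𝓡 n) ∞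
      (EuclideanSpace ℝ (Fin n)) (fun q : N => TangentSpace (𝓡 n) q)] [ConnectedSpace N]
  {U : N → ℝ} {k d u ξ : ℝ} {χ : ℝ → ℝ} {μ σ : BilinField (𝓡 n) N}
  {θ' : OneForm (𝓡 n) N'} {c c' : ℝ} {β : ℝ → ℝ}
  {X : ℝ → ∀ x : Cotangent n N, TangentSpace (cotModel n) x}
  {J : ℝ → ℝ → ∀ x : Cotangent n N,
    TangentSpace (cotModel n) x →L[ℝ] TangentSpace (cotModel n) x}
  {v : ℝ → ℝ → Cotangent n N} {η : ℝ → ℝ} {L : ℝ}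

/-- Writing ∂ₜv as η X plus the defect, λ + θ evaluates to ηa plus an error linear in the defect,
with a = (λ + θ)(X) ≥ d/2. Since θ lives on the cover, its value on the lift is first transported to
a covector `w` on the base. -/
theorem abs_multiplier_mul_sub_pairing_le
    (h : IsBoundedFlow p (definingHamiltonian U k χ) μ σ θ θ' c c' β X J v η)
    (hU : ContMDiff (𝓡 n) 𝓘(ℝ, ℝ) ∞ U) (hχ : IsTruncation ξ χ) (hξ : 0 < ξ)
    (hθU : ∀ z, (1 / 2) * ‖θ z‖ ^ 2 + U (p z) ≤ k - d) (hu : ∀ q, -U q ≤ u) (hL : 0 ≤ L)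
    (hgeo : GeometryBound L (fun s => μ + β s • σ) X J) {s : ℝ}
    (hsd : ∀ t, |definingHamiltonian U k χ (v s t)| ≤ d / 2)
    (hsξ : ∀ t, |definingHamiltonian U k χ (v s t)| < ξ - min (1 / 3) (ξ / 3))
    {γ : ℝ → N'} (hγ : ContMDiff 𝓘(ℝ, ℝ) (𝓡 n) ∞ γ) (hγv : ∀ t, p (γ t) = (v s t).proj) (t : ℝ) :
    ∃ a : ℝ, d / 2 ≤ a ∧
      |liouville (v s t) (velocity (cotModel n) (v s) t) + θ (γ t) (velocity (𝓡 n) γ t) - η s * a| ≤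
        ((1 + d) / 2 + k + u + c) * (√L * defectNorm μ σ β X J v η s t) := by
  obtain ⟨w, hw1, hw2⟩ := h.cover.exists_covector θ hγ hγv t
  obtain ⟨h1, h2⟩ := hχ.eq_of_abs_lt hξ (hsξ t)
  have h3 := hsd t
  rw [definingHamiltonian, h1, abs_le] at h3
  have h4 : (1 / 2) * ‖w‖ ^ 2 + U (v s t).proj ≤ k - d := by
    refine le_trans ?_ (hθU (γ t))
    rw [hγv]
    gcongr
  refine ⟨_, le_add_apply_dProj_hamiltonianVectorField hU hχ.smooth (h.hamiltonian s) (v s t) w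
    h3.1 h2 h4, ?_⟩
  have h5 : liouville (v s t) (velocity (cotModel n) (v s) t) =
      (v s t).2 (velocity (𝓡 n) (fun t => (v s t).proj) t) := by
    rw [← dProj_velocity ((contMDiff_slice h.smooth_v s t).mdifferentiableAt (by simp))]
    rfl
  have h6 : liouville (v s t) (velocity (cotModel n) (v s) t) + θ (γ t) (velocity (𝓡 n) γ t) -
      η s * ((v s t).2 + w) (dProj (v s t) (X s (v s t))) =
      ((v s t).2 + w) (dProj (v s t) (orbitDefect X v η s t)) := by
    rw [h5, hw1, h.velocity_proj, ContinuousLinearMap.map_add, ContinuousLinearMap.map_add,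
      ContinuousLinearMap.map_smul, ContinuousLinearMap.map_smul, add_apply,
      add_apply, smul_eq_mul, smul_eq_mul]
    ring
  rw [h6]
  have h7 : ‖(v s t).2 + w‖ ≤ (1 + d) / 2 + k + u + c := by
    have h8 := norm_add_le (v s t).2 w
    have h9 : ‖w‖ ≤ c := hw2.trans (h.bound_left _)
    have h10 := hu (v s t).proj
    nlinarith [sq_nonneg (‖(v s t).2‖ - 1), h3.2]
  refine (ContinuousLinearMap.le_opNorm ((v s t).2 + w) _).trans ?_
  exact mul_le_mul h7 (norm_dProj_orbitDefect_le hL hgeo s t) (norm_nonneg _)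
    ((ContinuousLinearMap.opNorm_nonneg ((v s t).2 + w)).trans h7)

/-- On loops of small energy density, the multiplier is controlled by the periods of the primitive
`λ + θ`. -/
theorem abs_multiplier_mul_le
    (h : IsBoundedFlow p (definingHamiltonian U k χ) μ σ θ θ' c c' β X J v η)
    (hU : ContMDiff (𝓡 n) 𝓘(ℝ, ℝ) ∞ U) (hχ : IsTruncation ξ χ) (hξ : 0 < ξ) (hd : 0 ≤ d)
    (hku : 0 ≤ k + u)
    (hθU : ∀ z, (1 / 2) * ‖θ z‖ ^ 2 + U (p z) ≤ k - d) (hu : ∀ q, -U q ≤ u) (hL : 0 ≤ L)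
    (hgeo : GeometryBound L (fun s => μ + β s • σ) X J) {s ε : ℝ} (hε : 0 < ε)
    (hs : energy μ σ β X J v η s ≤ ε ^ 2)
    (hεd : (1 + √L) * ε ≤ d / 2) (hεξ : (1 + √L) * ε < ξ - min (1 / 3) (ξ / 3)) :
    |η s| * (d / 2) ≤ |lineIntegral liouville (v s) 1 +
        asymptoticMean p θ (fun t => (v s t).proj)| + ((1 + d) / 2 + k + u + c) * (√L * ε) := by
  have hH := fun t => h.abs_hamiltonian_le hL hgeo hε hs t
  have hv := contMDiff_slice h.smooth_v s
  have hq : ContMDiff 𝓘(ℝ, ℝ) (𝓡 n) ∞ (fun t => (v s t).proj) := contMDiff_cotProj.comp hv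
  have hqper : ∀ t, (v s (t + 1)).proj = (v s t).proj := fun t => by rw [h.flow.periodic]
  set K := (1 + d) / 2 + k + u + c with hKdef
  have hK : 0 ≤ K := by linarith [h.nonneg_left]
  set ℓ := lineIntegral liouville (v s) 1 with hℓ
  set B := c * loopLength n (fun t => (v s t).proj) with hB
  have hc := h.continuous_defectNorm s
  have hl : Continuous fun t => liouville (v s t) (velocity (cotModel n) (v s) t) := by
    have h : ∀ t, liouville (v s t) (velocity (cotModel n) (v s) t) =
      pullbackForm liouville (v s) t 1 := fun t => rfl
    simp_rw [h]
    exact (contDiff_pullbackForm liouville_isChartSmoothAt hv).continuous.clm_apply continuous_const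
  -- The pairing a varies with t and is known only from below, so the sign of η decides which
  -- one-sided estimate is available. Each grows linearly in R and passes to the mean.
  have key : ∀ γ : ℝ → N', ContMDiff 𝓘(ℝ, ℝ) (𝓡 n) ∞ γ → (∀ t, p (γ t) = (v s t).proj) → ∀ R : ℕ,
      (0 ≤ η s → R * (η s * (d / 2) - K * (√L * ε) - ℓ) ≤ lineIntegral θ γ R) ∧
      (η s ≤ 0 → lineIntegral θ γ R ≤ R * (η s * (d / 2) + K * (√L * ε) - ℓ)) := by
    intro γ hγ hγv R
    have hθc := continuous_form_velocity h.prim_left.1.isChartSmoothAt hγ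
    have hm : ∫ t in (0 : ℝ)..R, K * (√L * defectNorm μ σ β X J v η s t) ≤ R * (K * (√L * ε)) := by
      rw [intervalIntegral.integral_const_mul, intervalIntegral.integral_const_mul,
        integral_nat_of_periodic hc (h.periodic_defectNorm s)]
      have := h.integral_defectNorm_le_of_energy_le hε hs
      refine le_of_eq_of_le ?_ ((mul_le_mul_of_nonneg_left (mul_le_mul_of_nonneg_left
        (mul_le_mul_of_nonneg_left this R.cast_nonneg) (Real.sqrt_nonneg L)) hK).trans_eq ?_) <;> ring
    have hmi : IntervalIntegrable (fun t => K * (√L * defectNorm μ σ β X J v η s t))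
      MeasureTheory.volume 0 R := Continuous.intervalIntegrable (by fun_prop) _ _
    have hli : ∫ t in (0 : ℝ)..R, liouville (v s t) (velocity (cotModel n) (v s) t) = R * ℓ :=
      integral_nat_of_periodic hl (periodic_form_velocity liouville hv (h.flow.periodic s)) R
    have hsum : ∫ t in (0 : ℝ)..R, (liouville (v s t) (velocity (cotModel n) (v s) t) +
        θ (γ t) (velocity (𝓡 n) γ t)) = R * ℓ + lineIntegral θ γ R := by
      rw [intervalIntegral.integral_add (hl.intervalIntegrable _ _) (hθc.intervalIntegrable _ _),
        hli, lineIntegral]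
    have hsi : IntervalIntegrable (fun t => liouville (v s t) (velocity (cotModel n) (v s) t) +
        θ (γ t) (velocity (𝓡 n) γ t)) MeasureTheory.volume 0 R := (hl.add hθc).intervalIntegrable _ _
    have hpt := fun t => h.abs_multiplier_mul_sub_pairing_le hU hχ hξ hθU hu hL hgeo
      (fun t => (hH t).trans hεd) (fun t => (hH t).trans_lt hεξ) hγ hγv t
    have hR : (0 : ℝ) ≤ R := R.cast_nonneg
    have hconst : ∫ t in (0 : ℝ)..R, η s * (d / 2) = R * (η s * (d / 2)) := by
      rw [intervalIntegral.integral_const, sub_zero, smul_eq_mul]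
    constructor
    · intro h0
      have h1 := intervalIntegral.integral_mono_on hR (hmi.const_mul (-1) |>.add
        (intervalIntegrable_const (c := η s * (d / 2)))) hsi fun t _ => by
          obtain ⟨a, ha, hb⟩ := hpt t
          rw [← hKdef] at hb
          have := (abs_le.1 hb).1
          have := mul_le_mul_of_nonneg_left ha h0
          show -1 * _ + _ ≤ _
          linarith
      rw [intervalIntegral.integral_add (hmi.const_mul (-1)) intervalIntegrable_const,
        intervalIntegral.integral_const_mul, hconst, hsum] at h1
      linarith
    · intro h0
      have h1 := intervalIntegral.integral_mono_on hR hsi (hmi.add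
        (intervalIntegrable_const (c := η s * (d / 2)))) fun t _ => by
          obtain ⟨a, ha, hb⟩ := hpt t
          rw [← hKdef] at hb
          have := (abs_le.1 hb).2
          have := mul_le_mul_of_nonpos_left ha h0
          show _ ≤ _ + _
          linarith
      rw [intervalIntegral.integral_add hmi intervalIntegrable_const, hconst, hsum] at h1
      linarith
  rcases le_total 0 (η s) with h0 | h0
  · have h1 := (asymptoticMean_mem_Icc (θ := θ) h.cover hq (l := η s * (d / 2) - K * (√L * ε) - ℓ)
      (u := B) fun γ hγ hγv R _ => ⟨(key γ hγ hγv R).1 h0, (abs_le.1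
        (h.cover.abs_lineIntegral_le h.nonneg_left h.bound_left hγ hq hqper hγv R)).2⟩).2.2.1
    rw [abs_of_nonneg h0]
    linarith [le_abs_self (ℓ + asymptoticMean p θ (fun t => (v s t).proj))]
  · have h1 := (asymptoticMean_mem_Icc (θ := θ) h.cover hq (l := -B)
      (u := η s * (d / 2) + K * (√L * ε) - ℓ) fun γ hγ hγv R _ => ⟨by
        linarith [(abs_le.1 (h.cover.abs_lineIntegral_le h.nonneg_left h.bound_left hγ hq hqper hγv R)).1],
        (key γ hγ hγv R).2 h0⟩).2.2.2
    rw [abs_of_nonpos h0]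
    linarith [neg_le_abs (ℓ + asymptoticMean p θ (fun t => (v s t).proj))]

/-- The perturbation term grows at most linearly in the multiplier and the energy density. -/
theorem abs_asymptoticMean_sub_le {H : Cotangent n N → ℝ}
    (h : IsBoundedFlow p H μ σ θ θ' c c' β X J v η) (hL : 0 ≤ L)
    (hgeo : GeometryBound L (fun s => μ + β s • σ) X J) {x₀ : ℝ → Cotangent n N} (hx₀ : IsLoop x₀)
    (s : ℝ) :
    |asymptoticMean p θ' (fun t => (v s t).proj) - asymptoticMean p θ' (fun t => (x₀ t).proj)| ≤
      c' * (√L * ((1 + energy μ σ β X J v η s) / 2) + |η s| * L +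
        loopLength n (fun t => (x₀ t).proj)) := by
  have h1 := (asymptoticMean_bounds h.cover h.nonneg_right h.bound_right
    (contMDiff_cotProj.comp (contMDiff_slice h.smooth_v s))
    (fun t => congrArg TotalSpace.proj (h.flow.periodic s t))).2.2
  have h2 := (asymptoticMean_bounds h.cover h.nonneg_right h.bound_right
    (contMDiff_cotProj.comp hx₀.smooth)
    (fun t => congrArg TotalSpace.proj (hx₀.periodic t))).2.2
  have h3 := mul_le_mul_of_nonneg_left (h.loopLength_le hL hgeo s) h.nonneg_right
  rw [mul_add, abs_le]
  have e1 := h1.1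
  have e2 := h1.2
  have e3 := h2.1
  have e4 := h2.2
  simp only [Function.comp_def] at e1 e2 e3 e4
  constructor <;> linarith

/-- On loops of small energy density, the multiplier is bounded in terms of the action. -/
theorem abs_multiplier_le
    (h : IsBoundedFlow p (definingHamiltonian U k χ) μ σ θ θ' c c' β X J v η)
    (hU : ContMDiff (𝓡 n) 𝓘(ℝ, ℝ) ∞ U) (hχ : IsTruncation ξ χ) (hξ : 0 < ξ) (hd : 0 < d)
    (hku : 0 ≤ k + u)
    (hθU : ∀ z, (1 / 2) * ‖θ z‖ ^ 2 + U (p z) ≤ k - d) (hu : ∀ q, -U q ≤ u) (hL : 0 ≤ L)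
    (hgeo : GeometryBound L (fun s => μ + β s • σ) X J) {x₀ : ℝ → Cotangent n N} (hx₀ : IsLoop x₀)
    (hβ : IsCutoff β) {s ε : ℝ} (hε : 0 < ε)
    (hs : energy μ σ β X J v η s ≤ ε ^ 2)
    (hεd : (1 + √L) * ε ≤ d / 2) (hεξ : (1 + √L) * ε < ξ - min (1 / 3) (ξ / 3))
    (hε1 : ε ≤ 1) (hε8 : ε ≤ d / 8) (hc' : c' ≤ 1) (hc'L : c' * L ≤ d / 8) :
    |η s| ≤ 4 / d * (1 + √L + loopLength n (fun t => (x₀ t).proj) +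
        |lineIntegral liouville x₀ 1 + asymptoticMean p θ (fun t => (x₀ t).proj)| +
        ((1 + d) / 2 + k + u + c) * √L) *
      (|meanAction p (definingHamiltonian U k χ) θ θ' x₀ (β s) (v s) (η s)| + 1) := by
  have h1 := h.abs_multiplier_mul_le hU hχ hξ hd.le hku hθU hu hL hgeo hε hs hεd hεξ
  have h2 := h.abs_asymptoticMean_sub_le hL hgeo hx₀ s
  set F := asymptoticMean p θ' (fun t => (v s t).proj) - asymptoticMean p θ' (fun t => (x₀ t).proj)
    with hF
  set G := lineIntegral liouville x₀ 1 + asymptoticMean p θ (fun t => (x₀ t).proj) with hG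
  set S := meanAction p (definingHamiltonian U k χ) θ θ' x₀ (β s) (v s) (η s) with hS
  set L₀ := loopLength n (fun t => (x₀ t).proj) with hL₀
  set W := lineIntegral liouville (v s) 1 + asymptoticMean p θ (fun t => (v s t).proj) with hW
  set K := (1 + d) / 2 + k + u + c with hK
  have hK0 : 0 ≤ K := by linarith [h.nonneg_left]
  have hL₀0 : 0 ≤ L₀ := intervalIntegral.integral_nonneg zero_le_one fun t _ => norm_nonneg _
  -- The flow equation replaces ∫H by -η'.
  have h3 : W = S - β s * F - η s * deriv η s + G := by
    rw [hS, meanAction, eq_neg_of_add_eq_zero_left (h.flow.multiplier s)]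
    ring
  have h4 : |β s * F| ≤ |F| := by
    rw [abs_mul, abs_of_nonneg (hβ.mem s).1]
    exact mul_le_of_le_one_left (abs_nonneg _) (hβ.mem s).2
  have h5 : |η s * deriv η s| ≤ |η s| * (d / 8) := by
    rw [abs_mul]
    exact mul_le_mul_of_nonneg_left ((h.abs_deriv_le hε.le hs).trans hε8) (abs_nonneg _)
  have h6 : |W| ≤ |S| + |F| + |η s| * (d / 8) + |G| := by
    rw [h3]
    have := abs_add_le (S - β s * F - η s * deriv η s) G
    have := abs_sub (S - β s * F) (η s * deriv η s)
    have := abs_sub S (β s * F)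
    linarith
  have h7 : energy μ σ β X J v η s ≤ 1 := hs.trans (by nlinarith)
  have h8 : |F| ≤ √L + |η s| * (d / 8) + L₀ := by
    have e1 : c' * (√L * ((1 + energy μ σ β X J v η s) / 2)) ≤ √L := by
      have e2 : √L * ((1 + energy μ σ β X J v η s) / 2) ≤ √L :=
        mul_le_of_le_one_right (Real.sqrt_nonneg _) (by linarith)
      have e3 : 0 ≤ √L * ((1 + energy μ σ β X J v η s) / 2) := by
        have := h.energy_nonneg s
        positivity
      exact (mul_le_of_le_one_left e3 hc').trans e2
    have e4 : c' * L₀ ≤ L₀ := mul_le_of_le_one_left hL₀0 hc'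
    have e5 := mul_le_mul_of_nonneg_left hc'L (abs_nonneg (η s))
    linarith
  have h9 : K * (√L * ε) ≤ K * √L :=
    mul_le_mul_of_nonneg_left (mul_le_of_le_one_right (Real.sqrt_nonneg _) hε1) hK0
  -- The terms |η||η'| and |F| each contribute at most |η|d/8; absorbing them leaves half of the
  -- coefficient d/2.
  have h10 : |η s| * (d / 4) ≤ |S| + (√L + L₀ + |G| + K * √L) := by linarith
  have h11 : |S| + (√L + L₀ + |G| + K * √L) ≤ (1 + √L + L₀ + |G| + K * √L) * (|S| + 1) := by
    have : 0 ≤ (√L + L₀ + |G| + K * √L) * |S| := by positivity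
    nlinarith [abs_nonneg S]
  have h12 : |η s| = 4 / d * (|η s| * (d / 4)) := by field_simp
  rw [h12, mul_assoc]
  exact mul_le_mul_of_nonneg_left (h10.trans h11) (by positivity)

end IsBoundedFlow

end RFH

/-! ### Choice of the primitives. -/

namespace RFH

section

variable {E : Type*} [NormedAddCommGroup E] [NormedSpace ℝ E]
  {H : Type*} [TopologicalSpace H] {I : ModelWithCorners ℝ E H}
  {M : Type*} [TopologicalSpace M] [ChartedSpace H M]

theorem add_zero_smul_bilinField (μ σ : BilinField I M) : μ + (0 : ℝ) • σ = μ := by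
  funext x
  ext u w
  change μ x u w + 0 * σ x u w = μ x u w
  ring

theorem add_one_smul_bilinField (μ σ : BilinField I M) : μ + (1 : ℝ) • σ = μ + σ := by
  funext x
  ext u w
  change μ x u w + 1 * σ x u w = μ x u w + σ x u w
  ring

end

section

variable {n : ℕ}
  {N : Type*} [MetricSpace N] [ChartedSpace (EuclideanSpace ℝ (Fin n)) N]
  [IsManifold (𝓡 n) ∞ N] [RiemannianBundle (fun q : N => TangentSpace (𝓡 n) q)]
  {N' : Type*} [TopologicalSpace N'] [ChartedSpace (EuclideanSpace ℝ (Fin n)) N']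
  [IsManifold (𝓡 n) ∞ N'] [RiemannianBundle (fun z : N' => TangentSpace (𝓡 n) z)]
  {p : N' → N}

/-- Above Mañé's critical value there is a primitive with a uniform gap. -/
theorem exists_primitive_of_maneCriticalValue_lt {U : N → ℝ} {μ : BilinField (𝓡 n) N} {k : ℝ}
    (h : maneCriticalValue p U μ < (k : EReal)) :
    ∃ θ ∈ primitives p μ, ∃ d : ℝ, 0 < d ∧ ∀ z, (1 / 2) * ‖θ z‖ ^ 2 + U (p z) ≤ k - d := by
  rw [maneCriticalValue] at h
  simp only [iInf_lt_iff] at h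
  obtain ⟨θ, hθ, h1⟩ := h
  obtain ⟨k', h2, h3⟩ := EReal.lt_iff_exists_real_btwn.1 h1
  refine ⟨θ, hθ, k - k', sub_pos.2 (EReal.coe_lt_coe_iff.1 h3), fun z => ?_⟩
  rw [sub_sub_cancel]
  exact EReal.coe_le_coe_iff.1 ((le_iSup (fun z => (((1 / 2 : ℝ) * ‖θ z‖ ^ 2 + U (p z) : ℝ) : EReal))
    z).trans h2.le)

/-- Only the sup-norm entry of the maximum is needed; the length of the reference loop is fixed and
enters the constants separately. -/
theorem exists_primitive_of_isoperimetricConstant_lt {σ : BilinField (𝓡 n) N} {q : ℝ → N} {C : ℝ}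
    (h : isoperimetricConstant p σ q < ENNReal.ofReal C) :
    ∃ θ ∈ primitives p σ, ∃ c : ℝ, 0 ≤ c ∧ c < C ∧ ∀ z, ‖θ z‖ ≤ c := by
  rw [isoperimetricConstant] at h
  simp only [iInf_lt_iff] at h
  obtain ⟨θ, hθ, h1⟩ := h
  have h2 := (le_max_left _ _).trans_lt h1
  refine ⟨θ, hθ, (⨆ z : N', ‖θ z‖ₑ).toReal, ENNReal.toReal_nonneg,
    ENNReal.toReal_lt_of_lt_ofReal h2, fun z => ?_⟩
  have h3 := ENNReal.toReal_mono h2.ne_top (le_iSup (fun z => ‖θ z‖ₑ) z)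
  rwa [toReal_enorm] at h3

theorem GeometryBound.mono {Λ L : ℝ} {ρ : ℝ → BilinField (𝓡 n) N}
    {X : ℝ → ∀ x : Cotangent n N, TangentSpace (cotModel n) x}
    {J : ℝ → ℝ → ∀ x : Cotangent n N,
      TangentSpace (cotModel n) x →L[ℝ] TangentSpace (cotModel n) x}
    (h : GeometryBound Λ ρ X J) (hJ : IsCompatibleFamily ρ J) (hL : Λ ≤ L) :
    GeometryBound L ρ X J := fun s t x =>
  ⟨fun u => ((h s t x).1 u).trans (mul_le_mul_of_nonneg_right hL (hJ.nonneg s t x u)),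
    (h s t x).2.trans hL⟩

end

end RFH

end

/-! ### Choice of constants and conclusion. -/

theorem lemma4p7 {n : ℕ}
    {N : Type*} [MetricSpace N] [CompactSpace N] [ConnectedSpace N]
    [ChartedSpace (EuclideanSpace ℝ (Fin n)) N] [IsManifold (𝓡 n) ∞ N]
    [RiemannianBundle (fun q : N => TangentSpace (𝓡 n) q)]
    [IsContMDiffRiemannianBundle (𝓡 n) ∞ (EuclideanSpace ℝ (Fin n))
      (fun q : N => TangentSpace (𝓡 n) q)]
    [IsRiemannianManifold (𝓡 n) N]
    {N' : Type*} [TopologicalSpace N'] [ChartedSpace (EuclideanSpace ℝ (Fin n)) N']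
    [IsManifold (𝓡 n) ∞ N'] [RiemannianBundle (fun z : N' => TangentSpace (𝓡 n) z)]
    (p : N' → N) (hp : RFH.IsUniversalRiemannianCover n p)
    (U : N → ℝ) (hU : ContMDiff (𝓡 n) 𝓘(ℝ, ℝ) ∞ U) (k : ℝ)
    (ξ : ℝ) (hξ : 0 < ξ) (χ : ℝ → ℝ) (hχ : RFH.IsTruncation ξ χ)
    (μ : RFH.BilinField (𝓡 n) N) (hμ : RFH.IsSmoothTwoForm (𝓡 n) μ)
    (hk : RFH.maneCriticalValue p U μ < (k : EReal))
    (vν : ℝ → RFH.Cotangent n N) (hvν : RFH.IsLoop vν) (Λ : ℝ) :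
    ∃ C₀ : ℝ, 0 < C₀ ∧
      ∀ σ : RFH.BilinField (𝓡 n) N, RFH.IsSmoothTwoForm (𝓡 n) σ →
      RFH.isoperimetricConstant p σ (fun t => (vν t).proj) < ENNReal.ofReal C₀ →
      ∀ β : ℝ → ℝ, RFH.IsCutoff β →
      (∀ s, RFH.maneCriticalValue p U (μ + β s • σ) < (k : EReal)) →
      ∀ X : ℝ → ∀ x : RFH.Cotangent n N, TangentSpace (RFH.cotModel n) x,
      (∀ s, RFH.IsHamiltonianVectorField (μ + β s • σ)
        (RFH.definingHamiltonian U k χ) (X s)) →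
      ∀ J : ℝ → ℝ → ∀ x : RFH.Cotangent n N,
        TangentSpace (RFH.cotModel n) x →L[ℝ] TangentSpace (RFH.cotModel n) x,
      RFH.IsCompatibleFamily (fun s => μ + β s • σ) J →
      RFH.GeometryBound Λ (fun s => μ + β s • σ) X J →
      ∀ (v : ℝ → ℝ → RFH.Cotangent n N) (η : ℝ → ℝ),
      RFH.IsGradientFlowLine (RFH.definingHamiltonian U k χ) X J v η →
      ∀ (xm xp : ℝ → RFH.Cotangent n N) (ηm ηp : ℝ),
      RFH.IsCriticalPoint (RFH.definingHamiltonian U k χ) (X 0) xm ηm →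
      RFH.IsCriticalPoint (RFH.definingHamiltonian U k χ) (X 1) xp ηp →
      RFH.LoopTendsto v atBot xm → Tendsto η atBot (𝓝 ηm) →
      RFH.LoopTendsto v atTop xp → Tendsto η atTop (𝓝 ηp) →
      ∀ a b : ℝ,
      RFH.HasAction μ (RFH.definingHamiltonian U k χ) vν xm ηm a →
      RFH.HasAction (μ + σ) (RFH.definingHamiltonian U k χ) vν xp ηp b →
      (1 / 9 ≤ a → a / 2 ≤ b) ∧ (b ≤ -(1 / 9) → a ≤ b / 2) := by
  obtain ⟨θ, hθ, d, hd, hθU⟩ := RFH.exists_primitive_of_maneCriticalValue_lt hk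
  obtain ⟨u, hku, hu⟩ : ∃ u : ℝ, 0 ≤ k + u ∧ ∀ q, -U q ≤ u := by
    obtain ⟨u, hu⟩ := (isCompact_range hU.continuous.neg).bddAbove
    refine ⟨max u (-k), by linarith [le_max_right u (-k)], fun q => ?_⟩
    exact (hu ⟨q, rfl⟩).trans (le_max_left _ _)
  -- The gap inequality bounds ½|θ|² because U is bounded below on the compact N; then |θ| ≤ ½ +
  -- ½|θ|².
  obtain ⟨c, hc0, hc⟩ : ∃ c : ℝ, 0 ≤ c ∧ ∀ z, ‖θ z‖ ≤ c := by
    refine ⟨max 0 (1 / 2 + (k - d) + u), le_max_left _ _, fun z => le_max_of_le_right ?_⟩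
    nlinarith [sq_nonneg (‖θ z‖ - 1), hθU z, hu (p z)]
  set L := max Λ 0 with hLdef
  have hL : 0 ≤ L := le_max_right _ _
  set L₀ := RFH.loopLength n (fun t => (vν t).proj) with hL₀
  have hL₀0 : 0 ≤ L₀ := intervalIntegral.integral_nonneg zero_le_one fun t _ => norm_nonneg _
  have hr : 0 ≤ √L := Real.sqrt_nonneg L
  set G := RFH.lineIntegral RFH.liouville vν 1 + RFH.asymptoticMean p θ (fun t => (vν t).proj) with hG
  set C := 4 / d * (1 + √L + L₀ + |G| + ((1 + d) / 2 + k + u + c) * √L) with hC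
  have hC0 : 0 < C := by
    have : 0 ≤ (1 + d) / 2 + k + u + c := by linarith
    positivity
  set κ := ξ - min (1 / 3) (ξ / 3) with hκ
  have hκ0 : 0 < κ := by linarith [min_le_right (1 / 3) (ξ / 3)]
  -- The threshold keeps |H| ≤ (1 + √L)ε below d/2, for the positivity of the pairing, and below κ,
  -- where χ is the identity. The bound d/8 lets |η||η'| be absorbed.
  set ε := min (min 1 (d / 8)) (min (d / 2) (κ / 2) / (1 + √L)) with hε
  have hε0 : 0 < ε := by positivity
  have hε1 : ε ≤ 1 := (min_le_left _ _).trans (min_le_left _ _)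
  have hε8 : ε ≤ d / 8 := (min_le_left _ _).trans (min_le_right _ _)
  have hε2 : (1 + √L) * ε ≤ min (d / 2) (κ / 2) := by
    rw [mul_comm, ← le_div_iff₀ (by positivity)]
    exact min_le_right _ _
  have hεd : (1 + √L) * ε ≤ d / 2 := hε2.trans (min_le_left _ _)
  have hεκ : (1 + √L) * ε < κ := by linarith [hε2.trans (min_le_right _ _)]
  -- `A` collects the coefficients of the flux estimate. The energy threshold is ε², because ε
  -- bounds the integrated defect norm and |η'|.
  obtain ⟨D, hD0, hD⟩ := RFH.exists_action_comparison_constant (A := √L + L + L₀ + 1) (C := C)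
    (ε := ε ^ 2) (by positivity) hC0 (by positivity)
  -- 1/D closes the bootstrap; the other two entries give c' ≤ 1 and c'L ≤ d/8, so that the flux can
  -- be absorbed in the multiplier bound.
  refine ⟨min (1 / D) (min 1 (d / (8 * (L + 1)))), by positivity, ?_⟩
  intro σ hσ hiso β hβ _ X hX J hJ hgeo v η hflow xm xp ηm ηp hxm hxp hvm hηm hvp hηp a b ha hb
  obtain ⟨θ', hθ', c', hc'0, hc'C, hc'⟩ := RFH.exists_primitive_of_isoperimetricConstant_lt hiso
  have hc'D : c' * D < 1 := by
    rw [← lt_div_iff₀ hD0]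
    exact hc'C.trans_le (min_le_left _ _)
  have hc'1 : c' ≤ 1 := hc'C.le.trans ((min_le_right _ _).trans (min_le_left _ _))
  have hc'L : c' * L ≤ d / 8 := by
    have h1 : c' ≤ d / (8 * (L + 1)) :=
      hc'C.le.trans ((min_le_right _ _).trans (min_le_right _ _))
    rw [le_div_iff₀ (by positivity)] at h1
    nlinarith
  have hgeo' := hgeo.mono hJ (le_max_left Λ 0)
  rw [← hLdef] at hgeo'
  have hH := RFH.contMDiff_definingHamiltonian (n := n) (k := k) hU hχ.smooth
  have h : RFH.IsBoundedFlow p (RFH.definingHamiltonian U k χ) μ σ θ θ' c c' β X J v η :=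
    ⟨hp, hH, hμ.alternating, hσ.alternating, hθ, hθ', hc0, hc'0, hc, hc', hβ.smooth, hX, hJ, hflow⟩
  have hF : Continuous fun s => RFH.asymptoticMean p θ' (fun t => (v s t).proj) -
      RFH.asymptoticMean p θ' (fun t => (vν t).proj) := by
    refine Continuous.sub (continuous_iff_continuousAt.2 fun s => ?_) continuous_const
    exact (RFH.hasDerivAt_asymptoticMean hp hθ' hc'0 hc' (q := fun z => (v z.1 z.2).proj)
      (RFH.contMDiff_cotProj.comp h.smooth_v)
      (fun s t => congrArg TotalSpace.proj (hflow.periodic s t)) s).continuousAt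
  have ha' : a = RFH.meanAction p (RFH.definingHamiltonian U k χ) θ θ' vν 0 xm ηm := by
    refine RFH.HasAction.eq_meanAction hp hθ hθ' hc0 hc'0 hc hc' (μ := μ) (σ := σ) ?_
    rwa [RFH.add_zero_smul_bilinField]
  have hb' : b = RFH.meanAction p (RFH.definingHamiltonian U k χ) θ θ' vν 1 xp ηp := by
    refine RFH.HasAction.eq_meanAction hp hθ hθ' hc0 hc'0 hc hc' (μ := μ) (σ := σ) ?_
    rwa [RFH.add_one_smul_bilinField]
  refine hD c' hc'0 hc'D β
    (fun s => RFH.meanAction p (RFH.definingHamiltonian U k χ) θ θ' vν (β s) (v s) (η s)) η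
    (RFH.IsBoundedFlow.energy μ σ β X J v η) _ a b hβ (h.hasDerivAt_meanAction vν)
    h.continuous_energy hF h.energy_nonneg ?_ ?_ (hflow.smooth_η.of_le (by simp))
    h.abs_deriv_le_one_add
    (fun s hs => h.abs_multiplier_le hU hχ hξ hd hku hθU hu hL hgeo' hvν hβ hε0 hs hεd hεκ hε1 hε8
      hc'1 hc'L) fun s => ?_
  · rw [ha']
    exact RFH.tendsto_meanAction vν hH h.smooth_v hxm.loop hvm
      (RFH.tendsto_asymptoticMean_atBot hp hθ hc0 hc h.smooth_v hflow.periodic hxm.loop hvm)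
      (RFH.tendsto_asymptoticMean_atBot hp hθ' hc'0 hc' h.smooth_v hflow.periodic hxm.loop hvm)
      (tendsto_const_nhds.congr' ((eventually_le_atBot 0).mono fun s hs => (hβ.eq_zero s hs).symm))
      hηm
  · rw [hb']
    exact RFH.tendsto_meanAction vν hH h.smooth_v hxp.loop hvp
      (RFH.tendsto_asymptoticMean_atTop hp hθ hc0 hc h.smooth_v hflow.periodic hxp.loop hvp)
      (RFH.tendsto_asymptoticMean_atTop hp hθ' hc'0 hc' h.smooth_v hflow.periodic hxp.loop hvp)
      (tendsto_const_nhds.congr' ((eventually_ge_atTop 1).mono fun s hs => (hβ.eq_one s hs).symm))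
      hηp
  · refine (h.abs_asymptoticMean_sub_le hL hgeo' hvν s).trans
      (mul_le_mul_of_nonneg_left ?_ hc'0)
    rw [← hL₀]
    have h1 := h.energy_nonneg s
    have h2 := abs_nonneg (η s)
    set e := RFH.IsBoundedFlow.energy μ σ β X J v η s
    have h3 : 0 ≤ √L * |η s| := by positivity
    have h6 : 0 ≤ √L * e := by positivity
    have h4 : 0 ≤ L * e + L := by positivity
    have h5 : 0 ≤ L₀ * |η s| + L₀ * e := by positivity
    linarith
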